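/- A $k$-CNF formula on $n$ variables is a set of clauses, each of which is a set of at most $k$ literals over $n$ Boolean variables. Running times refer to randomised word-RAM algorithms with words of logarithmic size (the number of bits of a word is at most a constant times the logarithm of the sum of the input length, the largest input word and the running time) and fair coin tosses; they are worst-case bounds, over all inputs and all outcomes of the coin tosses. Let $\mathrm{SAT}(F)$ denote the number of satisfying assignments of $F$. Theorem. Let $\delta>0$. Suppose that for every $k\in\mathbb{N}$ there is a randomised algorithm which, given a $k$-CNF formula $F$ on $n$ variables, runs in time $O(2^{(1-\delta)n})$ and decides whether $F$ is satisfiable, correctly with probability at least $2/3$ on every input. Then for every $\delta'>0$ and every $k\in\mathbb{N}$ there is a randomised algorithm which, given a $k$-CNF formula $F$ on $n$ variables and a rational number $0<\epsilon<1$, runs in time $\epsilon^{-2}\cdot O(2^{(1-\delta+\delta')n})$ and outputs a rational number $z$ that satisfies $|z-\mathrm{SAT}(F)|\le\epsilon\cdot\mathrm{SAT}(F)$ with probability at least $2/3$ on every input. The constants in both $O(\cdot)$ do not depend on $n$, $F$ or $\epsilon$; they may depend on $k$, $\delta$, $\delta'$ and on the algorithms. -/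

import Mathlib

open scoped ENNReal

/-! A randomised word RAM with a step count. -/

namespace WordRAM

/-- The binary operations on words. `sub` is truncated, `lt` and `eq` return `1` or `0`. -/
inductive Op where
  | add | sub | mul | div | mod | band | bor | bxor | shl | shr | lt | eq

/-- The value of an operation. -/
def Op.eval : Op → ℕ → ℕ → ℕ
  | .add, x, y => x + y
  | .sub, x, y => x - y
  | .mul, x, y => x * y
  | .div, x, y => x / y
  | .mod, x, y => x % y
  | .band, x, y => x &&& y
  | .bor, x, y => x ||| y
  | .bxor, x, y => x ^^^ y
  | .shl, x, y => x <<< y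
  | .shr, x, y => x >>> y
  | .lt, x, y => if x < y then 1 else 0
  | .eq, x, y => if x = y then 1 else 0

/-- Programs. A program is a finite object that mentions finitely many registers and constants;
it is the same for all inputs. Control flow is written with conditionals and loops (a program
with jumps is a single loop that dispatches on a program counter, at the cost of a constant
factor in the number of steps).
* `const r v`: write the constant `v` to register `r`;
* `op o r a b`: apply `o` to registers `a` and `b` and write the result to register `r`;
* `load r a`: write to register `r` the memory word whose address is in register `a`;
* `store a r`: write register `r` to the memory word whose address is in register `a`;
* `coin r`: write a fair random bit to register `r`;
* `ite r p q`: run `p` if register `r` is nonzero, otherwise run `q`;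
* `loop r p`: while register `r` is nonzero, run `p`. -/
inductive Prog where
  | skip
  | const (r v : ℕ)
  | op (o : Op) (r a b : ℕ)
  | load (r a : ℕ)
  | store (a r : ℕ)
  | coin (r : ℕ)
  | seq (p q : Prog)
  | ite (r : ℕ) (p q : Prog)
  | loop (r : ℕ) (p : Prog)

/-- Registers and random access memory. -/
structure State where
  reg : ℕ → ℕ
  mem : ℕ → ℕ

/-- Write to a register. -/
def State.setReg (s : State) (r v : ℕ) : State := ⟨Function.update s.reg r v, s.mem⟩

/-- Write to a memory word. -/
def State.setMem (s : State) (a v : ℕ) : State := ⟨s.reg, Function.update s.mem a v⟩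

/-- A configuration: the parts of the program that are still to be run, in this order (this is
the position in the program), together with registers and memory. -/
structure Config where
  todo : List Prog
  st : State

/-- One step of the machine, each of which costs one unit of time; `b` is the random bit that is
available in this step. A configuration with nothing left to run has halted. -/
def step (b : Bool) : Config → Config
  | ⟨[], s⟩ => ⟨[], s⟩
  | ⟨.skip :: K, s⟩ => ⟨K, s⟩
  | ⟨.const r v :: K, s⟩ => ⟨K, s.setReg r v⟩
  | ⟨.op o r x y :: K, s⟩ => ⟨K, s.setReg r (o.eval (s.reg x) (s.reg y))⟩
  | ⟨.load r a :: K, s⟩ => ⟨K, s.setReg r (s.mem (s.reg a))⟩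
  | ⟨.store a r :: K, s⟩ => ⟨K, s.setMem (s.reg a) (s.reg r)⟩
  | ⟨.coin r :: K, s⟩ => ⟨K, s.setReg r b.toNat⟩
  | ⟨.seq p q :: K, s⟩ => ⟨p :: q :: K, s⟩
  | ⟨.ite r p q :: K, s⟩ => if s.reg r ≠ 0 then ⟨p :: K, s⟩ else ⟨q :: K, s⟩
  | ⟨.loop r p :: K, s⟩ => if s.reg r ≠ 0 then ⟨p :: .loop r p :: K, s⟩ else ⟨K, s⟩

/-- The distribution of the configuration after `t` steps, with an independent fair random bit
in every step. -/
noncomputable def run : ℕ → Config → PMF Config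
  | 0, c => PMF.pure c
  | t + 1, c => (PMF.uniformOfFintype Bool).bind fun b => run t (step b c)

/-- The initial configuration of `P` on the input array `x`: the input stands at the memory
addresses `0, 1, 2, …`; all registers and all other memory words are `0`. -/
def init (P : Prog) (x : List ℕ) : Config := ⟨[P], ⟨fun _ => 0, fun a => x.getD a 0⟩⟩

/-- All words of a configuration (and so all addresses that it accesses) are below `M`. -/
def Config.WordsBelow (c : Config) (M : ℕ) : Prop :=
  (∀ r, c.st.reg r < M) ∧ ∀ a, c.st.mem a < M

/-- The size of an instance `x` that is to be solved in time `T`: the number of its words, its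
largest word and the time `T` (plus `2`). Words of logarithmic size are words of at most
`c * log (sizeBound x T)` bits for a constant `c`. -/
def sizeBound (x : List ℕ) (T : ℕ) : ℕ := x.length + x.foldr max 0 + T + 2

/-- On the input `x`, the randomised program `P` halts after at most `T` steps, whatever the
random bits are, uses only words of at most `c * log₂ (sizeBound x T)` bits, and with probability
at least `2 / 3` halts with register contents that satisfy `Good`. -/
def Prog.Solves (P : Prog) (x : List ℕ) (T c : ℕ) (Good : (ℕ → ℕ) → Prop) : Prop :=
  (∀ d ∈ (run T (init P x)).support, d.todo = []) ∧
  (∀ t, ∀ d ∈ (run t (init P x)).support, d.WordsBelow (sizeBound x T ^ c)) ∧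
  (2 / 3 : ℝ≥0∞) ≤ (run T (init P x)).toOuterMeasure {d | Good d.st.reg}

end WordRAM

/-- A `k`-CNF formula in the variables `0, …, n - 1`. A literal `(i, true)` is the variable `i`
and `(i, false)` its negation. A clause is a set of at most `k` literals and a formula is a set of
clauses; both are listed in an arbitrary order, without repetitions (two clauses with the same
literals in a different order count as a repetition), as they are presented to an algorithm. -/
structure KCNF (k n : ℕ) where
  clauses : List (List (Fin n × Bool))
  nodup : ∀ C ∈ clauses, C.Nodup
  distinct : clauses.Pairwise fun C D => ¬ C.Perm D
  width : ∀ C ∈ clauses, C.length ≤ k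

namespace KCNF

variable {k n : ℕ}

/-- The assignment `a` satisfies the formula `F`. -/
def SatisfiedBy (F : KCNF k n) (a : Fin n → Bool) : Prop :=
  ∀ C ∈ F.clauses, ∃ l ∈ C, a l.1 = l.2

/-- The formula `F` is satisfiable. -/
def Satisfiable (F : KCNF k n) : Prop := ∃ a, F.SatisfiedBy a

/-- The number of satisfying assignments of `F`. -/
noncomputable def numSat (F : KCNF k n) : ℕ := Nat.card {a : Fin n → Bool // F.SatisfiedBy a}

/-- The formula as an array of words: the number of variables, the number of clauses, and for each
clause its length followed by its literals, one word per literal. -/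
def encode (F : KCNF k n) : List ℕ :=
  n :: F.clauses.length ::
    F.clauses.flatMap fun C => C.length :: C.map fun l => 2 * (l.1 : ℕ) + l.2.toNat

end KCNF

/-- A positive rational number as an array of words: the lengths of the binary expansions of its
numerator and its denominator in lowest terms, followed by their binary digits, least significant
digit first, one word per digit. -/
def encodeRat (ε : ℚ) : List ℕ :=
  ε.num.toNat.bits.length :: ε.den.bits.length ::
    (ε.num.toNat.bits ++ ε.den.bits).map Bool.toNat

/-- There is a randomised algorithm that decides the satisfiability of `n`-variable `k`-CNF
formulas in time `O (T n)`. It answers in register `0`, with `1` for yes and `0` for no. -/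
def KSATInTime (k : ℕ) (T : ℕ → ℝ) : Prop :=
  ∃ (P : WordRAM.Prog) (A : ℝ) (c : ℕ), ∀ (n : ℕ) (F : KCNF k n),
    P.Solves F.encode ⌊A * T n⌋₊ c
      fun r => (F.Satisfiable ∧ r 0 = 1) ∨ (¬ F.Satisfiable ∧ r 0 = 0)

/-- There is a randomised algorithm that takes as input an `n`-variable `k`-CNF formula and a
rational number `0 < ε < 1` and outputs an `ε`-approximation to the number of satisfying
assignments in time `ε⁻² * O (T n)`. The output is the rational number whose numerator and
denominator are in the registers `0` and `1`. -/
def ApproxCountKSATInTime (k : ℕ) (T : ℕ → ℝ) : Prop :=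
  ∃ (P : WordRAM.Prog) (A : ℝ) (c : ℕ), ∀ (n : ℕ) (F : KCNF k n) (ε : ℚ), 0 < ε → ε < 1 →
    P.Solves (encodeRat ε ++ F.encode) ⌊((ε : ℝ) ^ 2)⁻¹ * (A * T n)⌋₊ c
      fun r => r 1 ≠ 0 ∧ |(r 0 : ℚ) / (r 1 : ℚ) - F.numSat| ≤ ε * F.numSat

/-! ### Simulation of probability distributions by programs -/

namespace WordRAM

/-! The solutions are thinned out until about one is left, the survivors are counted by a search
that uses the decision algorithm, and the count is scaled back. A fixed assignment satisfies a
random clause of `s` literals with probability `p = 1 - 2^(-s)`, so `m` such clauses leave `N p^m`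
of `N` solutions on average. These clauses add no variables and keep the width constant, so the
assumed algorithm applies to the thinned formula with the same exponent.

The price is limited independence. Two assignments that differ in at least `β n` places survive a
clause almost independently (`bothSat_le_of_far`); closer pairs are correlated, but every assignment
has few close neighbours. For a suitable constant `s`, a mean of at least `1` and `m ≤ n 2^s`, the
second moment is at most `2 * 2^(γ n)` times the squared mean (`exists_width`). Adding up the counts
of about `ε⁻² 2^(η n)` independent hashes, with small `η`, is then accurate by Chebyshev's
inequality (`sums_good`). Some `m` brings the mean into `[1, 2]` (`exists_level`). It is not known
in advance, so `m = 0, 1, …` are tried with a common budget of queries. With high probability the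
budget suffices at the latest at the right `m`, and any earlier `m` at which it suffices also yields
an accurate count (`ex_levels`, `levels_good`).

Solutions are enumerated by depth first search on prefixes, where unit clauses fix a prefix and each
query asks whether a solution extends it. The number of queries is at most `1 + 2 n` times the
number of solutions (`cost_le`). Each answer is a majority over linearly many runs of the decision
algorithm, so that a union bound covers the exponentially many queries (`majority_error`, `Close`).
The scaled count is rounded to an integer. This allows the precision to be capped at `n + 2` bits,
where the result is already exact (`output_good`), and keeps all quantities exponential in `n`
however small `ε` is.

On the machine side, `Sim` relates a program to the distribution that it samples, with time and word
bounds built in. The decision program is moved to its own registers and to a memory region unused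
before (`sim_reloc`, `sim_vote`), because it expects zeros behind its input. The time of the search
is charged to the query budget, which is shared by all trials of a level (`sim_dfs`). Polynomial
factors and the variance loss are absorbed by `2^(δ' n)` (`total_time_le`). Words stay logarithmic
because the running time itself is exponential in `n` (`ExpBound.mul_le_pow`). This uses `δ ≤ 1`;
for larger `δ` the hypothesis is contradictory (`not_ksatInTime`). -/

/-- All words of a state are below `M`. -/
def State.Below (s : State) (M : ℕ) : Prop := (∀ r, s.reg r < M) ∧ ∀ a, s.mem a < M

@[simp] theorem State.setReg_reg (s : State) (r v r' : ℕ) :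
    (s.setReg r v).reg r' = if r' = r then v else s.reg r' := by
  simp [State.setReg, Function.update_apply]

@[simp] theorem State.setReg_mem (s : State) (r v : ℕ) : (s.setReg r v).mem = s.mem := rfl

@[simp] theorem State.setMem_mem (s : State) (a v a' : ℕ) :
    (s.setMem a v).mem a' = if a' = a then v else s.mem a' := by
  simp [State.setMem, Function.update_apply]

@[simp] theorem State.setMem_reg (s : State) (a v : ℕ) : (s.setMem a v).reg = s.reg := rfl

theorem State.Below.setReg {s : State} {M r v : ℕ} (h : s.Below M) (hv : v < M) :
    (s.setReg r v).Below M := by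
  refine ⟨fun r' => ?_, fun a => h.2 a⟩
  rw [State.setReg_reg]; split_ifs; exacts [hv, h.1 _]

theorem State.Below.setMem {s : State} {M a v : ℕ} (h : s.Below M) (hv : v < M) :
    (s.setMem a v).Below M := by
  refine ⟨fun r => h.1 r, fun a' => ?_⟩
  rw [State.setMem_mem]; split_ifs; exacts [hv, h.2 _]

/-- Within `T` steps, and with words below `M` only, the program `L` started in the state `s`
draws a value `a` from the distribution `f` and halts in a state `s'` with `R a s'`. -/
def Sim {α : Type} (M : ℕ) (R : α → State → Prop) : ℕ → List Prog → State → PMF α → Prop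
  | _, [], s, f => s.Below M ∧ ∃ a, f = PMF.pure a ∧ R a s
  | 0, _ :: _, _, _ => False
  | T + 1, p :: L, s, f => s.Below M ∧ ∃ g : Bool → PMF α,
      f = (PMF.uniformOfFintype Bool).bind g ∧
      ∀ b, Sim M R T (step b ⟨p :: L, s⟩).todo (step b ⟨p :: L, s⟩).st (g b)

/-- Simulation of a deterministic computation. -/
abbrev Det (M : ℕ) (Q : State → Prop) (T : ℕ) (L : List Prog) (s : State) : Prop :=
  Sim M (fun _ : Unit => Q) T L s (PMF.pure ())

namespace Sim

variable {α β : Type} {M : ℕ} {R : α → State → Prop} {T T' : ℕ} {L : List Prog} {s : State}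
  {f : PMF α}

theorem nil_iff : Sim M R T [] s f ↔ s.Below M ∧ ∃ a, f = PMF.pure a ∧ R a s := by
  cases T <;> rfl

theorem nil {a : α} (hb : s.Below M) (h : R a s) : Sim M R T [] s (PMF.pure a) :=
  nil_iff.2 ⟨hb, a, rfl, h⟩

theorem below (h : Sim M R T L s f) : s.Below M := by
  cases L with
  | nil => exact (nil_iff.1 h).1
  | cons p L => cases T with
    | zero => exact h.elim
    | succ T => exact h.1

theorem mono (hT : T ≤ T') (h : Sim M R T L s f) : Sim M R T' L s f := by
  induction T generalizing T' L s f with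
  | zero => cases L with
    | nil => exact nil_iff.2 (nil_iff.1 h)
    | cons p L => exact h.elim
  | succ T ih => cases L with
    | nil => exact nil_iff.2 (nil_iff.1 h)
    | cons p L =>
      obtain ⟨T', rfl⟩ : ∃ t, T' = t + 1 := ⟨T' - 1, by omega⟩
      obtain ⟨hb, g, hg, h⟩ := h
      exact ⟨hb, g, hg, fun b => ih (by omega) (h b)⟩

/-- The machine inspects only the head of the list of pending programs, so anything behind it is
carried along unchanged. Sequential composition in `Sim.bind` rests on this. -/
theorem step_append (b : Bool) (p : Prog) (L K : List Prog) (s : State) :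
    (step b ⟨p :: L ++ K, s⟩).todo = (step b ⟨p :: L, s⟩).todo ++ K ∧
    (step b ⟨p :: L ++ K, s⟩).st = (step b ⟨p :: L, s⟩).st := by
  cases p <;> simp only [step, List.cons_append, and_self] <;> split_ifs <;> simp

/-- Sequencing of programs corresponds to the monadic bind of the sampled distributions, and times
add up. The second program need only be understood from states related to the value that the first
one drew. -/
theorem bind {R' : β → State → Prop} {T₁ T₂ : ℕ} {L₁ L₂ : List Prog} {g : α → PMF β}
    (h₁ : Sim M R T₁ L₁ s f)
    (h₂ : ∀ a s', s'.Below M → R a s' → Sim M R' T₂ L₂ s' (g a)) :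
    Sim M R' (T₁ + T₂) (L₁ ++ L₂) s (f.bind g) := by
  induction T₁ generalizing L₁ s f with
  | zero => cases L₁ with
    | nil =>
      obtain ⟨hb, a, rfl, ha⟩ := nil_iff.1 h₁
      simpa using h₂ a s hb ha
    | cons p L => exact h₁.elim
  | succ T ih => cases L₁ with
    | nil =>
      obtain ⟨hb, a, rfl, ha⟩ := nil_iff.1 h₁
      rw [PMF.pure_bind]
      exact (h₂ a s hb ha).mono (by omega)
    | cons p L =>
      obtain ⟨hb, k, rfl, h⟩ := h₁
      rw [show T + 1 + T₂ = T + T₂ + 1 by omega, PMF.bind_bind]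
      refine ⟨hb, _, rfl, fun b => ?_⟩
      have e := step_append b p L L₂ s
      change Sim M R' (T + T₂) (step b ⟨p :: L ++ L₂, s⟩).todo (step b ⟨p :: L ++ L₂, s⟩).st _
      rw [e.1, e.2]
      exact ih (h b)

theorem conseq {R' : α → State → Prop} (h : Sim M R T L s f)
    (hR : ∀ a s', s'.Below M → R a s' → R' a s') : Sim M R' T L s f := by
  have := h.bind (L₂ := []) (T₂ := 0) (g := PMF.pure) (R' := R')
    fun a s' hb ha => nil hb (hR a s' hb ha)
  simpa using this

/-- Run the first part of a program and go on from any state it may reach. -/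
theorem call {R' : β → State → Prop} {T₁ T₂ : ℕ} {p : Prog} {g : α → PMF β}
    (h₁ : Sim M R T₁ [p] s f)
    (h₂ : ∀ a s', s'.Below M → R a s' → Sim M R' T₂ L s' (g a)) :
    Sim M R' (T₁ + T₂) (p :: L) s (f.bind g) :=
  h₁.bind h₂

/-- Every step consumes a random bit; a step that ignores it averages over two equal continuations,
and binding to a constant leaves the distribution as it is. -/
theorem detStep {p : Prog} {s' : State} {L' : List Prog} (hb : s.Below M)
    (hs : ∀ b, step b ⟨p :: L, s⟩ = ⟨L', s'⟩) (h : Sim M R T L' s' f) :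
    Sim M R (T + 1) (p :: L) s f := by
  refine ⟨hb, fun _ => f, by simp, fun b => ?_⟩
  rw [hs b]; exact h

theorem skip (hb : s.Below M) (h : Sim M R T L s f) : Sim M R (T + 1) (.skip :: L) s f :=
  detStep hb (fun _ => rfl) h

theorem seq {p q : Prog} (hb : s.Below M) (h : Sim M R T (p :: q :: L) s f) :
    Sim M R (T + 1) (.seq p q :: L) s f :=
  detStep hb (fun _ => rfl) h

theorem const {r v : ℕ} (hb : s.Below M) (hv : v < M)
    (h : (s.setReg r v).Below M → Sim M R T L (s.setReg r v) f) :
    Sim M R (T + 1) (.const r v :: L) s f :=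
  detStep hb (fun _ => rfl) (h (hb.setReg hv))

theorem op {o : Op} {r x y : ℕ} (hb : s.Below M) (hv : o.eval (s.reg x) (s.reg y) < M)
    (h : (s.setReg r (o.eval (s.reg x) (s.reg y))).Below M →
      Sim M R T L (s.setReg r (o.eval (s.reg x) (s.reg y))) f) :
    Sim M R (T + 1) (.op o r x y :: L) s f :=
  detStep hb (fun _ => rfl) (h (hb.setReg hv))

theorem load {r a : ℕ} (hb : s.Below M)
    (h : (s.setReg r (s.mem (s.reg a))).Below M → Sim M R T L (s.setReg r (s.mem (s.reg a))) f) :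
    Sim M R (T + 1) (.load r a :: L) s f :=
  detStep hb (fun _ => rfl) (h (hb.setReg (hb.2 _)))

theorem store {a r : ℕ} (hb : s.Below M)
    (h : (s.setMem (s.reg a) (s.reg r)).Below M →
      Sim M R T L (s.setMem (s.reg a) (s.reg r)) f) :
    Sim M R (T + 1) (.store a r :: L) s f :=
  detStep hb (fun _ => rfl) (h (hb.setMem (hb.1 _)))

theorem coin {r : ℕ} {g : Bool → PMF α} (hb : s.Below M) (hM : 1 < M)
    (h : ∀ b : Bool, (s.setReg r b.toNat).Below M → Sim M R T L (s.setReg r b.toNat) (g b)) :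
    Sim M R (T + 1) (.coin r :: L) s ((PMF.uniformOfFintype Bool).bind g) :=
  ⟨hb, g, rfl, fun b => h b (hb.setReg (by cases b <;> simp <;> omega))⟩

theorem loop_zero {r : ℕ} {p : Prog} (hb : s.Below M) (hr : s.reg r = 0)
    (h : Sim M R T L s f) : Sim M R (T + 1) (.loop r p :: L) s f :=
  detStep hb (fun _ => by simp [step, hr]) h

theorem loop_succ {r : ℕ} {p : Prog} (hb : s.Below M) (hr : s.reg r ≠ 0)
    (h : Sim M R T (p :: .loop r p :: L) s f) : Sim M R (T + 1) (.loop r p :: L) s f :=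
  detStep hb (fun _ => by simp [step, hr]) h

end Sim

/-! ### Straight-line programs -/

/-- The programs of a list, one after the other. -/
def block : List Prog → Prog
  | [] => .skip
  | p :: ps => .seq p (block ps)

/-- The effect of an instruction (other than tossing a coin and the control structures). -/
def exec : Prog → State → State
  | .const r v, s => s.setReg r v
  | .op o r x y, s => s.setReg r (o.eval (s.reg x) (s.reg y))
  | .load r a, s => s.setReg r (s.mem (s.reg a))
  | .store a r, s => s.setMem (s.reg a) (s.reg r)
  | _, s => s

/-- The instruction is deterministic, and the word it computes is below `M`. -/
def execOk (M : ℕ) : Prog → State → Prop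
  | .const _ v, _ => v < M
  | .op o _ x y, s => o.eval (s.reg x) (s.reg y) < M
  | .load _ _, _ => True
  | .store _ _, _ => True
  | .skip, _ => True
  | _, _ => False

def execs : List Prog → State → State
  | [], s => s
  | p :: ps, s => execs ps (exec p s)

def execsOk (M : ℕ) : List Prog → State → Prop
  | [], _ => True
  | p :: ps, s => execOk M p s ∧ execsOk M ps (exec p s)

/-- The instruction does not write to registers below `ρ`. -/
def writesFrom (ρ : ℕ) : Prog → Bool
  | .const r _ => ρ.ble r
  | .op _ r _ _ => ρ.ble r
  | .load r _ => ρ.ble r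
  | _ => true

/-- The instruction does not write to the memory. -/
def noStore : Prog → Bool
  | .store _ _ => false
  | _ => true

/-- The side condition is a Boolean computation, so for a concrete block the preservation of low
registers is discharged by `rfl`. The register discipline relies on it: inner routines write only to
high register numbers. -/
theorem execs_reg {ρ r : ℕ} {ps : List Prog} (s : State) (h : ps.all (writesFrom ρ) = true)
    (hr : r < ρ) : (execs ps s).reg r = s.reg r := by
  induction ps generalizing s with
  | nil => rfl
  | cons p ps ih =>
    simp only [List.all_cons, Bool.and_eq_true] at h
    rw [execs, ih _ h.2]
    have hp := h.1
    cases p <;> simp only [writesFrom, Nat.ble_eq] at hp <;> simp [exec] <;> omega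

theorem execs_mem {ps : List Prog} (s : State) (h : ps.all noStore = true) :
    (execs ps s).mem = s.mem := by
  induction ps generalizing s with
  | nil => rfl
  | cons p ps ih =>
    simp only [List.all_cons, Bool.and_eq_true] at h
    rw [execs, ih _ h.2]
    have hp := h.1
    cases p <;> simp_all [exec, noStore]

namespace Sim

variable {α β : Type} {M : ℕ} {R : α → State → Prop} {T T' : ℕ} {L : List Prog} {s : State}
  {f : PMF α}

theorem cons {p : Prog} {ps : List Prog} (hb : s.Below M)
    (h : Sim M R T (p :: block ps :: L) s f) : Sim M R (T + 1) (block (p :: ps) :: L) s f :=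
  seq hb h

theorem block_nil (hb : s.Below M) (h : Sim M R T L s f) :
    Sim M R (T + 1) (block [] :: L) s f :=
  skip hb h

theorem exec_step {p : Prog} (hb : s.Below M) (hok : execOk M p s)
    (h : (exec p s).Below M → Sim M R T L (exec p s) f) : Sim M R (T + 1) (p :: L) s f := by
  cases p <;> simp only [execOk] at hok
  · exact skip hb (h hb)
  · exact const hb hok h
  · exact op hb hok h
  · exact load hb h
  · exact store hb h

theorem line (ps : List Prog) (hb : s.Below M) (hok : execsOk M ps s)
    (h : (execs ps s).Below M → Sim M R T L (execs ps s) f) :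
    Sim M R (T + (2 * ps.length + 1)) (block ps :: L) s f := by
  induction ps generalizing s with
  | nil => exact block_nil hb (h hb)
  | cons p ps ih =>
    rw [show T + (2 * (p :: ps).length + 1) = T + (2 * ps.length + 1) + 1 + 1 by simp; omega]
    exact cons hb (exec_step hb hok.1 fun hb' => ih hb' hok.2 h)

theorem callDet {T₁ T₂ : ℕ} {p : Prog} {Q : State → Prop} (h₁ : Det M Q T₁ [p] s)
    (h₂ : ∀ s', s'.Below M → Q s' → Sim M R T₂ L s' f) :
    Sim M R (T₁ + T₂) (p :: L) s f := by
  have := h₁.bind (g := fun _ => f) fun _ => h₂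
  simpa using this

/-! The same rules for a given time bound, of which the time used is subtracted. -/

theorem subLine (ps : List Prog) (hb : s.Below M) (hok : execsOk M ps s)
    (h : (execs ps s).Below M → Sim M R (T - (2 * ps.length + 1)) L (execs ps s) f)
    (hT : 2 * ps.length + 1 ≤ T := by first | omega | (simp only [List.length_cons, List.length_nil]; omega)) :
    Sim M R T (block ps :: L) s f :=
  (line ps hb hok h).mono (by omega)

theorem subConsLine (ps : List Prog) {qs : List Prog} (hb : s.Below M) (hok : execsOk M ps s)
    (h : (execs ps s).Below M →
      Sim M R (T - (2 * ps.length + 2)) (block qs :: L) (execs ps s) f)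
    (hT : 2 * ps.length + 2 ≤ T := by first | omega | (simp only [List.length_cons, List.length_nil]; omega)) :
    Sim M R T (block (block ps :: qs) :: L) s f :=
  (cons hb (line ps hb hok h)).mono (by omega)

theorem subDet {T₁ : ℕ} {p : Prog} {Q : State → Prop} (h₁ : Det M Q T₁ [p] s)
    (h₂ : ∀ s', s'.Below M → Q s' → Sim M R (T - T₁) L s' f)
    (hT : T₁ ≤ T := by first | omega | (simp only [List.length_cons, List.length_nil]; omega)) :
    Sim M R T (p :: L) s f :=
  (callDet h₁ h₂).mono (by omega)

theorem subConsDet {T₁ : ℕ} {p : Prog} {qs : List Prog} {Q : State → Prop}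
    (h₁ : Det M Q T₁ [p] s)
    (h₂ : ∀ s', s'.Below M → Q s' → Sim M R (T - (T₁ + 1)) (block qs :: L) s' f)
    (hT : T₁ + 1 ≤ T := by first | omega | (simp only [List.length_cons, List.length_nil]; omega)) :
    Sim M R T (block (p :: qs) :: L) s f :=
  (cons h₁.below (callDet h₁ h₂)).mono (by omega)

theorem subConsCall {R' : β → State → Prop} {T₁ : ℕ} {p : Prog} {qs : List Prog}
    {g : α → PMF β} (h₁ : Sim M R T₁ [p] s f)
    (h₂ : ∀ a s', s'.Below M → R a s' → Sim M R' (T - (T₁ + 1)) (block qs :: L) s' (g a))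
    (hT : T₁ + 1 ≤ T := by first | omega | (simp only [List.length_cons, List.length_nil]; omega)) :
    Sim M R' T (block (p :: qs) :: L) s (f.bind g) :=
  (cons h₁.below (call h₁ h₂)).mono (by omega)

theorem subConsCoin {r : ℕ} {qs : List Prog} {g : Bool → PMF α} (hb : s.Below M) (hM : 1 < M)
    (h : ∀ b : Bool, (s.setReg r b.toNat).Below M →
      Sim M R (T - 2) (block qs :: L) (s.setReg r b.toNat) (g b))
    (hT : 2 ≤ T := by first | omega | (simp only [List.length_cons, List.length_nil]; omega)) :
    Sim M R T (block (.coin r :: qs) :: L) s ((PMF.uniformOfFintype Bool).bind g) :=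
  (cons hb (coin hb hM h)).mono (by omega)

theorem subEnd (hb : s.Below M) (h : Sim M R (T - 1) L s f)
    (hT : 1 ≤ T := by first | omega | (simp only [List.length_cons, List.length_nil]; omega)) :
    Sim M R T (block [] :: L) s f :=
  (block_nil hb h).mono (by omega)

theorem subConsIte {r T₀ : ℕ} {p q : Prog} {qs : List Prog} (hb : s.Below M)
    (h₁ : s.reg r ≠ 0 → Sim M R T₀ (p :: block qs :: L) s f)
    (h₂ : s.reg r = 0 → Sim M R T₀ (q :: block qs :: L) s f)
    (hT : T₀ + 2 ≤ T := by first | omega | (simp only [List.length_cons, List.length_nil]; omega)) :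
    Sim M R T (block (.ite r p q :: qs) :: L) s f := by
  refine (cons hb (T := T₀ + 1) ?_).mono (by omega)
  by_cases hr : s.reg r = 0
  · exact detStep hb (fun _ => by simp [step, hr]) (h₂ hr)
  · exact detStep hb (fun _ => by simp [step, hr]) (h₁ hr)

/-- Everything that is drawn lies in the support of the distribution. -/
theorem support (h : Sim M R T L s f) : Sim M (fun a s' => R a s' ∧ a ∈ f.support) T L s f := by
  -- The support shrinks along each branch of the computation, so the induction needs a set that
  -- stays fixed.
  suffices H : ∀ A : Set α, f.support ⊆ A → Sim M (fun a s' => R a s' ∧ a ∈ A) T L s f from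
    H _ subset_rfl
  intro A hA
  induction T generalizing L s f with
  | zero => cases L with
    | nil =>
      obtain ⟨hb, a, rfl, ha⟩ := nil_iff.1 h
      exact nil hb ⟨ha, hA (by simp)⟩
    | cons p L => exact h.elim
  | succ T ih => cases L with
    | nil =>
      obtain ⟨hb, a, rfl, ha⟩ := nil_iff.1 h
      exact nil hb ⟨ha, hA (by simp)⟩
    | cons p L =>
      obtain ⟨hb, g, rfl, h⟩ := h
      refine ⟨hb, g, rfl, fun b => ih (h b) fun a ha => hA ?_⟩
      rw [PMF.mem_support_bind_iff]
      exact ⟨b, by simp, ha⟩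

/-- A loop that counts down to `0`, with an invariant. -/
theorem loopDet {r : ℕ} {p : Prog} {Tb : ℕ} (I : ℕ → State → Prop)
    (hbody : ∀ j s, s.Below M → I (j + 1) s → s.reg r ≠ 0 ∧ Det M (I j) Tb [p] s)
    (hzero : ∀ s, I 0 s → s.reg r = 0) (j : ℕ) (hb : s.Below M) (hI : I j s) :
    Det M (I 0) (j * (Tb + 1) + 1) [.loop r p] s := by
  induction j generalizing s with
  | zero =>
    exact (loop_zero (T := 0) hb (hzero s hI)
      (nil (R := fun _ : Unit => I 0) (a := ()) hb hI)).mono (by omega)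
  | succ j ih =>
    obtain ⟨hr, h⟩ := hbody j s hb hI
    rw [show (j + 1) * (Tb + 1) + 1 = Tb + (j * (Tb + 1) + 1) + 1 by ring]
    exact loop_succ hb hr (callDet h fun s' hb' hI' => ih hb' hI')

/-- A randomised loop that counts down to `0`, with an invariant. -/
theorem loopCount {γ : Type} {r : ℕ} {p : Prog} {Tb : ℕ} (I : ℕ → γ → State → Prop)
    (F : ℕ → γ → PMF γ) (G : γ → PMF γ)
    (hF0 : ∀ c, F 0 c = PMF.pure c) (hF : ∀ j c, F (j + 1) c = (G c).bind (F j))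
    (hbody : ∀ j c s, s.Below M → I (j + 1) c s → s.reg r ≠ 0 ∧ Sim M (I j) Tb [p] s (G c))
    (hzero : ∀ c s, I 0 c s → s.reg r = 0) (j : ℕ) (c : γ) (hb : s.Below M) (hI : I j c s) :
    Sim M (I 0) (j * (Tb + 1) + 1) [.loop r p] s (F j c) := by
  induction j generalizing s c with
  | zero =>
    rw [hF0]
    exact (loop_zero (T := 0) hb (hzero c s hI) (nil hb hI)).mono (by omega)
  | succ j ih =>
    obtain ⟨hr, h⟩ := hbody j c s hb hI
    rw [show (j + 1) * (Tb + 1) + 1 = Tb + (j * (Tb + 1) + 1) + 1 by ring, hF]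
    exact loop_succ hb hr (call h fun a s' hb' hI' => ih a hb' hI')

end Sim

/-! ### From simulation to runs -/

theorem run_nil (t : ℕ) (s : State) : run t ⟨[], s⟩ = PMF.pure ⟨[], s⟩ := by
  induction t with
  | zero => rfl
  | succ t ih => simp [run, step, ih]

theorem Sim.halts {α : Type} {M : ℕ} {R : α → State → Prop} {T : ℕ} {L : List Prog} {s : State}
    {f : PMF α} (h : Sim M R T L s f) : ∀ d ∈ (run T ⟨L, s⟩).support, d.todo = [] := by
  induction T generalizing L s f with
  | zero => cases L with
    | nil => simp [run]
    | cons p L => exact h.elim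
  | succ T ih => cases L with
    | nil => rw [run_nil]; simp
    | cons p L =>
      obtain ⟨-, g, -, h⟩ := h
      intro d hd
      rw [run, PMF.mem_support_bind_iff] at hd
      obtain ⟨b, -, hd⟩ := hd
      exact ih (h b) d hd

theorem Sim.wordsBelow {α : Type} {M : ℕ} {R : α → State → Prop} {T : ℕ} {L : List Prog}
    {s : State} {f : PMF α} (h : Sim M R T L s f) (t : ℕ) :
    ∀ d ∈ (run t ⟨L, s⟩).support, d.WordsBelow M := by
  induction t generalizing T L s f with
  | zero =>
    intro d hd
    simp only [run, PMF.support_pure, Set.mem_singleton_iff] at hd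
    subst hd; exact h.below
  | succ t ih => cases L with
    | nil =>
      intro d hd
      rw [run_nil] at hd
      simp only [PMF.support_pure, Set.mem_singleton_iff] at hd
      subst hd; exact h.below
    | cons p L => cases T with
      | zero => exact h.elim
      | succ T =>
        obtain ⟨-, g, -, h⟩ := h
        intro d hd
        rw [run, PMF.mem_support_bind_iff] at hd
        obtain ⟨b, -, hd⟩ := hd
        exact ih (h b) d hd

/-- Run and distribution branch over the same coin in every step, so the comparison goes through
step by step. Only an inequality holds, since a value outside `A` may also lead to a good state. -/
theorem Sim.prob_le {α : Type} {M : ℕ} {R : α → State → Prop} {T : ℕ} {L : List Prog}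
    {s : State} {f : PMF α} (h : Sim M R T L s f) (A : Set α) (Good : State → Prop)
    (hA : ∀ a ∈ A, ∀ s', R a s' → Good s') :
    f.toOuterMeasure A ≤ (run T ⟨L, s⟩).toOuterMeasure {d | Good d.st} := by
  induction T generalizing L s f with
  | zero => cases L with
    | nil =>
      obtain ⟨-, a, rfl, ha⟩ := nil_iff.1 h
      rw [run, PMF.toOuterMeasure_pure_apply, PMF.toOuterMeasure_pure_apply]
      split_ifs with h1 h2
      · rfl
      · exact (h2 (hA a h1 s ha)).elim
      · simp
      · rfl
    | cons p L => exact h.elim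
  | succ T ih => cases L with
    | nil =>
      obtain ⟨-, a, rfl, ha⟩ := nil_iff.1 h
      rw [run_nil, PMF.toOuterMeasure_pure_apply, PMF.toOuterMeasure_pure_apply]
      split_ifs with h1 h2
      · rfl
      · exact (h2 (hA a h1 s ha)).elim
      · simp
      · rfl
    | cons p L =>
      obtain ⟨-, g, rfl, h⟩ := h
      rw [run, PMF.toOuterMeasure_bind_apply, PMF.toOuterMeasure_bind_apply]
      exact ENNReal.tsum_le_tsum fun b => by gcongr; exact ih (h b)

end WordRAM

/-! ### Subroutine calls -/

namespace WordRAM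

/-- A strict upper bound on the registers of a program. -/
def Prog.regBound : Prog → ℕ
  | .skip => 0
  | .const r _ => r + 1
  | .op _ r a b => max (r + 1) (max (a + 1) (b + 1))
  | .load r a => max (r + 1) (a + 1)
  | .store a r => max (r + 1) (a + 1)
  | .coin r => r + 1
  | .seq p q => max p.regBound q.regBound
  | .ite r p q => max (r + 1) (max p.regBound q.regBound)
  | .loop r p => max (r + 1) p.regBound

/-- The program moved to the registers `64, 65, …` and to the part of the memory that starts at
the address in register `63`. -/
def Prog.reloc : Prog → Prog
  | .skip => .skip
  | .const r v => .const (r + 64) v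
  | .op o r a b => .op o (r + 64) (a + 64) (b + 64)
  | .load r a => .seq (.op .add 62 63 (a + 64)) (.load (r + 64) 62)
  | .store a r => .seq (.op .add 62 63 (a + 64)) (.store 62 (r + 64))
  | .coin r => .coin (r + 64)
  | .seq p q => .seq p.reloc q.reloc
  | .ite r p q => .ite (r + 64) p.reloc q.reloc
  | .loop r p => .loop (r + 64) p.reloc

/-- The state `S` holds the state `s` in the registers from `64` to `63 + ρ` and in the `N` memory
words that start at `base`. -/
structure Holds (ρ N base : ℕ) (s S : State) : Prop where
  baseReg : S.reg 63 = base
  reg : ∀ r < ρ, S.reg (r + 64) = s.reg r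
  mem : ∀ a < N, S.mem (base + a) = s.mem a

/-- The states agree outside of the registers and the memory of a subroutine. -/
def SameOutside (N base : ℕ) (S S' : State) : Prop :=
  (∀ r < 62, S'.reg r = S.reg r) ∧ ∀ a, a < base ∨ base + N ≤ a → S'.mem a = S.mem a

theorem Holds.setReg {ρ N base : ℕ} {s S : State} (h : Holds ρ N base s S) (r v : ℕ) :
    Holds ρ N base (s.setReg r v) (S.setReg (r + 64) v) where
  baseReg := by simp [h.baseReg]
  reg r' hr' := by simp [h.reg r' hr']
  mem a ha := by simp [h.mem a ha]

theorem Holds.setReg_tmp {ρ N base : ℕ} {s S : State} (h : Holds ρ N base s S) (v : ℕ) :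
    Holds ρ N base s (S.setReg 62 v) where
  baseReg := by simp [h.baseReg]
  reg r' hr' := by simp [h.reg r' hr']
  mem a ha := by simp [h.mem a ha]

theorem Holds.setMem {ρ N base : ℕ} {s S : State} (h : Holds ρ N base s S) (a v : ℕ) :
    Holds ρ N base (s.setMem a v) (S.setMem (base + a) v) where
  baseReg := by simp [h.baseReg]
  reg r' hr' := by simp [h.reg r' hr']
  mem a ha := by simp [h.mem a ha]

theorem SameOutside.setReg {N base r v : ℕ} {S S' : State} (h : SameOutside N base S S')
    (hr : 62 ≤ r) : SameOutside N base S (S'.setReg r v) :=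
  ⟨fun r' hr' => by rw [← h.1 r' hr']; simp; omega, h.2⟩

theorem SameOutside.setMem {N base a v : ℕ} {S S' : State} (h : SameOutside N base S S')
    (ha : a < N) : SameOutside N base S (S'.setMem (base + a) v) :=
  ⟨h.1, fun a' ha' => by rw [← h.2 a' ha']; simp; omega⟩

theorem run_halts_succ {T : ℕ} {c : Config}
    (h : ∀ d ∈ (run (T + 1) c).support, d.todo = []) (b : Bool) :
    ∀ d ∈ (run T (step b c)).support, d.todo = [] := fun d hd =>
  h d (by rw [run, PMF.mem_support_bind_iff]; exact ⟨b, by simp, hd⟩)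

theorem run_words_succ {N : ℕ} {c : Config}
    (h : ∀ t, ∀ d ∈ (run t c).support, d.WordsBelow N) (b : Bool) :
    ∀ t, ∀ d ∈ (run t (step b c)).support, d.WordsBelow N := fun t d hd =>
  h (t + 1) d (by rw [run, PMF.mem_support_bind_iff]; exact ⟨b, by simp, hd⟩)

theorem run_words_zero {N : ℕ} {c : Config}
    (h : ∀ t, ∀ d ∈ (run t c).support, d.WordsBelow N) : c.WordsBelow N :=
  h 0 c (by simp [run])

/-- One original step costs at most three: a memory access becomes a sequence of an address addition
and the access. Agreement on `N` words of memory suffices, because an address is a register value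
and these stay below `N`. The induction is on the running time and not on the program, so loops need
no invariant. -/
theorem sim_reloc {M ρ N base : ℕ} {S₀ : State} (hM : base + N ≤ M) (hρ : 0 < ρ) (T : ℕ) :
    ∀ (L : List Prog) (s S : State), (∀ p ∈ L, p.regBound ≤ ρ) →
      (∀ d ∈ (run T ⟨L, s⟩).support, d.todo = []) →
      (∀ t, ∀ d ∈ (run t ⟨L, s⟩).support, d.WordsBelow N) →
      S.Below M → Holds ρ N base s S → SameOutside N base S₀ S →
      Sim M (fun a S' => S'.reg 64 = a ∧ SameOutside N base S₀ S') (3 * T) (L.map Prog.reloc) S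
        ((run T ⟨L, s⟩).map fun d => d.st.reg 0) := by
  induction T with
  | zero =>
    intro L s S _ hT hw hb hH hS
    have : L = [] := hT ⟨L, s⟩ (by simp [run])
    subst this
    rw [run, PMF.pure_map]
    exact Sim.nil hb ⟨hH.reg 0 hρ, hS⟩
  | succ T ih =>
    intro L s S hL hT hw hb hH hS
    cases L with
    | nil =>
      rw [run_nil, PMF.pure_map]
      exact Sim.nil hb ⟨hH.reg 0 hρ, hS⟩
    | cons p L =>
      have hT' := run_halts_succ hT
      have hw' := run_words_succ hw
      have hw0 := run_words_zero hw
      have hw1 := fun b => run_words_zero (hw' b)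
      have hp : p.regBound ≤ ρ := hL p (by simp)
      have hL' : ∀ q ∈ L, q.regBound ≤ ρ := fun q hq => hL q (by simp [hq])
      rw [run, PMF.map_bind]
      rw [show 3 * (T + 1) = 3 * T + 1 + 1 + 1 by ring]
      cases p with
      | skip =>
        simp only [step, PMF.bind_const]
        exact (Sim.skip hb (ih L s S hL' (hT' true) (hw' true) hb hH hS)).mono (by omega)
      | const r v =>
        simp only [step, PMF.bind_const]
        have hv : v < N := by simpa [step] using (hw1 true).1 r
        exact (Sim.const hb (by omega) fun hb' => ih _ _ _ hL' (hT' true) (hw' true) hb'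
          (hH.setReg r v) (hS.setReg (by omega))).mono (by omega)
      | op o r x y =>
        simp only [step, PMF.bind_const]
        simp only [Prog.regBound] at hp
        have hv : o.eval (s.reg x) (s.reg y) < N := by simpa [step] using (hw1 true).1 r
        have hx := hH.reg x (by omega)
        have hy := hH.reg y (by omega)
        refine (Sim.op hb (by rw [hx, hy]; omega) fun hb' => ?_).mono (T := 3 * T + 1) (by omega)
        rw [hx, hy] at hb' ⊢
        exact ih _ _ _ hL' (hT' true) (hw' true) hb' (hH.setReg r _) (hS.setReg (by omega))
      | load r a =>
        simp only [step, PMF.bind_const]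
        simp only [Prog.regBound] at hp
        have ha := hH.reg a (by omega)
        have ha' := hw0.1 a
        simp only at ha'
        refine Sim.seq hb (Sim.op hb (by simp only [Op.eval]; rw [hH.baseReg, ha]; omega) fun hb' => ?_)
        refine Sim.load hb' fun hb'' => ?_
        have e : ((S.setReg 62 (Op.add.eval (S.reg 63) (S.reg (a + 64)))).mem
            ((S.setReg 62 (Op.add.eval (S.reg 63) (S.reg (a + 64)))).reg 62)) =
            s.mem (s.reg a) := by
          simp [Op.eval, hH.baseReg, ha, hH.mem _ ha']
        rw [e] at hb'' ⊢
        exact ih _ _ _ hL' (hT' true) (hw' true) hb'' ((hH.setReg_tmp _).setReg r _)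
          ((hS.setReg le_rfl).setReg (by omega))
      | store a r =>
        simp only [step, PMF.bind_const]
        simp only [Prog.regBound] at hp
        have ha := hH.reg a (by omega)
        have hr := hH.reg r (by omega)
        have ha' := hw0.1 a
        simp only at ha'
        refine Sim.seq hb (Sim.op hb (by simp only [Op.eval]; rw [hH.baseReg, ha]; omega) fun hb' => ?_)
        refine Sim.store hb' fun hb'' => ?_
        have e : (S.setReg 62 (Op.add.eval (S.reg 63) (S.reg (a + 64)))).reg 62 =
            base + s.reg a := by
          simp [Op.eval, hH.baseReg, ha]
        have e' : (S.setReg 62 (Op.add.eval (S.reg 63) (S.reg (a + 64)))).reg (r + 64) =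
            s.reg r := by
          simp [hr]
        rw [e, e'] at hb'' ⊢
        exact ih _ _ _ hL' (hT' true) (hw' true) hb'' ((hH.setReg_tmp _).setMem _ _)
          ((hS.setReg le_rfl).setMem ha')
      | coin r =>
        have h1 : ∀ b : Bool, b.toNat < N := fun b => by simpa [step] using (hw1 b).1 r
        have h2 := h1 true
        simp only [Bool.toNat_true] at h2
        refine Sim.mono (T := 3 * T + 1) (by omega) (Sim.coin hb (by omega) fun b hb' => ?_)
        exact ih _ _ _ hL' (hT' b) (hw' b) hb' (hH.setReg r _) (hS.setReg (by omega))
      | seq p q =>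
        simp only [step, PMF.bind_const]
        simp only [Prog.regBound] at hp
        refine Sim.mono (T := 3 * T + 1) (by omega) (Sim.seq hb ?_)
        refine ih _ _ _ ?_ (hT' true) (hw' true) hb hH hS
        intro p' hp'
        simp only [List.mem_cons] at hp'
        rcases hp' with rfl | rfl | hp'
        exacts [by omega, by omega, hL' _ hp']
      | ite r p q =>
        simp only [Prog.regBound] at hp
        have hr := hH.reg r (by omega)
        by_cases h0 : s.reg r = 0
        · simp only [step, h0, ne_eq, not_true_eq_false, if_false, PMF.bind_const] at hT' hw' ⊢
          refine Sim.mono (T := 3 * T + 1) (by omega) (Sim.detStep (s' := S)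
            (L' := (q :: L).map Prog.reloc) hb (fun _ => by simp [step, Prog.reloc, hr, h0]) ?_)
          refine ih _ _ _ ?_ (hT' true) (hw' true) hb hH hS
          simp only [List.mem_cons, forall_eq_or_imp]
          exact ⟨by omega, hL'⟩
        · simp only [step, h0, ne_eq, not_false_eq_true, if_true, PMF.bind_const] at hT' hw' ⊢
          refine Sim.mono (T := 3 * T + 1) (by omega) (Sim.detStep (s' := S)
            (L' := (p :: L).map Prog.reloc) hb (fun _ => by simp [step, Prog.reloc, hr, h0]) ?_)
          refine ih _ _ _ ?_ (hT' true) (hw' true) hb hH hS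
          simp only [List.mem_cons, forall_eq_or_imp]
          exact ⟨by omega, hL'⟩
      | loop r p =>
        have hp' := hp
        simp only [Prog.regBound] at hp
        have hr := hH.reg r (by omega)
        by_cases h0 : s.reg r = 0
        · simp only [step, h0, ne_eq, not_true_eq_false, if_false, PMF.bind_const] at hT' hw' ⊢
          exact Sim.mono (T := 3 * T + 1) (by omega) (Sim.loop_zero hb (by rw [hr, h0])
            (ih _ _ _ hL' (hT' true) (hw' true) hb hH hS))
        · simp only [step, h0, ne_eq, not_false_eq_true, if_true, PMF.bind_const] at hT' hw' ⊢
          refine Sim.mono (T := 3 * T + 1) (by omega) (Sim.loop_succ hb (by rwa [hr]) ?_)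
          refine ih (p :: .loop r p :: L) _ _ ?_ (hT' true) (hw' true) hb hH hS
          simp only [List.mem_cons, forall_eq_or_imp]
          exact ⟨by omega, hp', hL'⟩

/-- Set the registers `64, …, 63 + ρ` to `0`. -/
def clearRegs (ρ : ℕ) : List Prog := (List.range ρ).map fun r => .const (r + 64) 0

theorem execsOk_clearRegs {M : ℕ} (hM : 0 < M) (l : List ℕ) (s : State) :
    execsOk M (l.map fun r => .const (r + 64) 0) s := by
  induction l generalizing s with
  | nil => trivial
  | cons r l ih => exact ⟨hM, ih _⟩

theorem execs_clearRegs (l : List ℕ) (s : State) :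
    (execs (l.map fun r => .const (r + 64) 0) s).mem = s.mem ∧
    (∀ r < 64, (execs (l.map fun r => .const (r + 64) 0) s).reg r = s.reg r) ∧
    (∀ r, r ∈ l ∨ s.reg (r + 64) = 0 →
      (execs (l.map fun r => .const (r + 64) 0) s).reg (r + 64) = 0) := by
  induction l generalizing s with
  | nil => simp [execs]
  | cons r l ih =>
    obtain ⟨h1, h2, h3⟩ := ih (s.setReg (r + 64) 0)
    refine ⟨h1, fun r' hr' => ?_, fun r' hr' => ?_⟩
    · exact (h2 r' hr').trans (by simp; omega)
    · refine h3 r' ?_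
      simp only [List.mem_cons, State.setReg_reg] at hr' ⊢
      by_cases h : r' = r
      · simp [h]
      · simpa [h] using hr'

/-- Run `P` on the input that stands in the memory from the address in register `63` on. -/
def callProg (P : Prog) : Prog := .seq (block (clearRegs (P.regBound + 1))) P.reloc

/-- The hypothesis `hx` covers all addresses: the program starts with zeros behind its input and may
read or rely on them. One register more than `regBound` is cleared, so that the answer register is
covered even if the program mentions no register. -/
theorem sim_callProg {M N T base : ℕ} {P : Prog} {x : List ℕ} {S : State}
    (hM : base + N ≤ M) (hT : ∀ d ∈ (run T (init P x)).support, d.todo = [])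
    (hw : ∀ t, ∀ d ∈ (run t (init P x)).support, d.WordsBelow N)
    (hb : S.Below M) (hbase : S.reg 63 = base) (hx : ∀ a, S.mem (base + a) = x.getD a 0) :
    Sim M (fun a S' => S'.reg 64 = a ∧ SameOutside N base S S')
      (3 * T + (2 * (P.regBound + 1) + 1) + 1) [callProg P] S
      ((run T (init P x)).map fun d => d.st.reg 0) := by
  refine Sim.seq hb ?_
  have hM0 : 0 < M := lt_of_le_of_lt (Nat.zero_le _) (hb.1 0)
  refine Sim.mono (by simp) (Sim.line ((List.range (P.regBound + 1)).map fun r =>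
    .const (r + 64) 0) (T := 3 * T) hb (execsOk_clearRegs hM0 _ _) fun hb' => ?_)
  obtain ⟨h1, h2, h3⟩ := execs_clearRegs (List.range (P.regBound + 1)) S
  refine sim_reloc (ρ := P.regBound + 1) hM (by omega) T [P] _ _ (by simp) hT hw hb' ?_ ?_
  · refine ⟨?_, fun r hr => h3 r (by simp; omega), fun a _ => ?_⟩
    · exact (h2 63 (by omega)).trans hbase
    · exact (congrFun h1 _).trans (hx a)
  · exact ⟨fun r hr => h2 r (by omega), fun a _ => congrFun h1 a⟩

end WordRAM

/-! ### Formulas as lists of bit masks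

The literal `(i, b)` has the code `2 * i + b`; a clause is the number whose binary digits mark the
codes of its literals. -/

namespace SATCount

variable {n k K : ℕ}

/-- The value of variable `i`, `false` for `i ≥ n`. -/
def value (a : Fin n → Bool) (i : ℕ) : Bool := if h : i < n then a ⟨i, h⟩ else false

/-- The literal with code `l` is true. -/
def LitTrue (a : Fin n → Bool) (l : ℕ) : Prop := l / 2 < n ∧ value a (l / 2) = decide (l % 2 = 1)

/-- The clause with mask `M` is satisfied. -/
def MaskSat (a : Fin n → Bool) (M : ℕ) : Prop := ∃ l, M.testBit l = true ∧ LitTrue a l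

/-- All clauses of a list of masks are satisfied. -/
def Sat (Ms : List ℕ) (a : Fin n → Bool) : Prop := ∀ M ∈ Ms, MaskSat a M

/-- The codes of the literals of a mask. -/
def maskLits (n M : ℕ) : List ℕ := (List.range (2 * n)).filter fun l => M.testBit l

/-- The encoding of a list of masks as an array of words. -/
def encMasks (n : ℕ) (Ms : List ℕ) : List ℕ :=
  n :: Ms.length :: Ms.flatMap fun M => (maskLits n M).length :: maskLits n M

/-- The mask is a clause with at most `K` literals in `n` variables. -/
def ValidMask (n K M : ℕ) : Prop := M < 2 ^ (2 * n) ∧ (maskLits n M).length ≤ K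

/-- The code of a literal. -/
def code (l : Fin n × Bool) : ℕ := 2 * (l.1 : ℕ) + l.2.toNat

theorem code_lt (l : Fin n × Bool) : code l < 2 * n := by
  have := l.1.2
  unfold code
  cases l.2 <;> simp <;> omega

theorem litTrue_code (a : Fin n → Bool) (l : Fin n × Bool) :
    LitTrue a (code l) ↔ a l.1 = l.2 := by
  obtain ⟨i, b⟩ := l
  have h1 : code (i, b) / 2 = i := by cases b <;> simp [code] <;> omega
  have h2 : decide (code (i, b) % 2 = 1) = b := by cases b <;> simp [code, Nat.add_mod]
  simp [LitTrue, h1, h2, value]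

theorem mem_maskLits {M l : ℕ} : l ∈ maskLits n M ↔ l < 2 * n ∧ M.testBit l = true := by
  simp [maskLits]

theorem nodup_maskLits (M : ℕ) : (maskLits n M).Nodup := List.nodup_range.filter _

/-- The clause of a mask. -/
def clauseOf (n M : ℕ) : List (Fin n × Bool) :=
  (maskLits n M).attach.map fun l =>
    (⟨l.1 / 2, by have := (mem_maskLits.1 l.2).1; omega⟩, decide (l.1 % 2 = 1))

theorem map_code_clauseOf (M : ℕ) : (clauseOf n M).map code = maskLits n M := by
  conv_rhs => rw [← List.attach_map_subtype_val (maskLits n M)]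
  rw [clauseOf, List.map_map]
  refine List.map_congr_left fun l _ => ?_
  rcases Nat.mod_two_eq_zero_or_one l.1 with h | h <;> simp [code, h] <;> omega

/-- Only bits below `2 * n` become literals, hence the bounds: higher bits would be lost. This turns
distinct masks into clauses that are distinct up to order. -/
theorem mask_eq_of_perm {M M' : ℕ} (hM : M < 2 ^ (2 * n)) (hM' : M' < 2 ^ (2 * n))
    (h : (maskLits n M).Perm (maskLits n M')) : M = M' := by
  refine Nat.eq_of_testBit_eq fun l => ?_
  by_cases hl : l < 2 * n
  · have := h.mem_iff (a := l)
    rw [mem_maskLits, mem_maskLits] at this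
    exact Bool.eq_iff_iff.2 (by simpa [hl] using this)
  · have hp : 2 ^ (2 * n) ≤ 2 ^ l := Nat.pow_le_pow_right (by omega) (by omega)
    rw [Nat.testBit_lt_two_pow (by omega), Nat.testBit_lt_two_pow (by omega)]

theorem sat_clauseOf (a : Fin n → Bool) (M : ℕ) :
    (∃ l ∈ clauseOf n M, a l.1 = l.2) ↔ MaskSat a M := by
  constructor
  · rintro ⟨l, hl, h⟩
    have := List.mem_map_of_mem (f := code) hl
    rw [map_code_clauseOf, mem_maskLits] at this
    exact ⟨code l, this.2, (litTrue_code a l).2 h⟩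
  · rintro ⟨l, hl, h⟩
    have hl2 : l < 2 * n := by have := h.1; omega
    have : l ∈ (clauseOf n M).map code := by
      rw [map_code_clauseOf, mem_maskLits]; exact ⟨hl2, hl⟩
    obtain ⟨l', hl', rfl⟩ := List.mem_map.1 this
    exact ⟨l', hl', (litTrue_code a l').1 h⟩

/-- The bridge to the hypothesis: the decision algorithm promises something only on encodings of
formulas, so the words written by the reduction must be such an encoding literally. -/
theorem exists_kcnf (Ms : List ℕ) (hnd : Ms.Nodup) (hv : ∀ M ∈ Ms, ValidMask n K M) :
    ∃ F : KCNF K n, F.encode = encMasks n Ms ∧ ∀ a, F.SatisfiedBy a ↔ Sat Ms a := by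
  refine ⟨⟨Ms.map (clauseOf n), ?_, ?_, ?_⟩, ?_, ?_⟩
  · intro C hC
    obtain ⟨M, -, rfl⟩ := List.mem_map.1 hC
    refine List.Nodup.of_map code ?_
    rw [map_code_clauseOf]; exact nodup_maskLits M
  · rw [List.pairwise_map]
    refine List.Pairwise.imp_of_mem ?_ hnd
    intro M M' hM hM' hne hp
    refine hne (mask_eq_of_perm (hv M hM).1 (hv M' hM').1 ?_)
    rw [← map_code_clauseOf, ← map_code_clauseOf]
    exact hp.map code
  · intro C hC
    obtain ⟨M, hM, rfl⟩ := List.mem_map.1 hC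
    rw [← List.length_map (f := code), map_code_clauseOf]
    exact (hv M hM).2
  · simp only [KCNF.encode, encMasks, List.length_map, List.flatMap_map]
    congr 2
    refine List.flatMap_congr fun M _ => ?_
    rw [← map_code_clauseOf, List.length_map]; rfl
  · intro a
    simp only [KCNF.SatisfiedBy, List.forall_mem_map, Sat]
    exact forall₂_congr fun M _ => sat_clauseOf a M

/-! ### Adding clauses -/

/-- Add a mask to a list unless it occurs already. -/
def addMask (L : List ℕ) (M : ℕ) : List ℕ := if M ∈ L then L else L ++ [M]

theorem mem_addMask {L : List ℕ} {M M' : ℕ} : M' ∈ addMask L M ↔ M' ∈ L ∨ M' = M := by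
  unfold addMask; split_ifs with h
  · constructor
    · exact Or.inl
    · rintro (h' | rfl) <;> assumption
  · simp

theorem nodup_addMask {L : List ℕ} {M : ℕ} (h : L.Nodup) : (addMask L M).Nodup := by
  unfold addMask; split_ifs with h'
  · exact h
  · simp only [List.nodup_append, h, List.nodup_singleton, List.mem_singleton, true_and]
    rintro a ha _ rfl rfl; exact h' ha

theorem length_addMask (L : List ℕ) (M : ℕ) : (addMask L M).length ≤ L.length + 1 := by
  unfold addMask; split_ifs <;> simp

theorem prefix_addMask (L : List ℕ) (M : ℕ) : L <+: addMask L M := by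
  unfold addMask; split_ifs <;> simp

theorem sat_addMask {a : Fin n → Bool} {L : List ℕ} {M : ℕ} :
    Sat (addMask L M) a ↔ Sat L a ∧ MaskSat a M := by
  simp only [Sat, mem_addMask]
  constructor
  · exact fun h => ⟨fun M' hM' => h M' (Or.inl hM'), h M (Or.inr rfl)⟩
  · rintro ⟨h, h'⟩ M' (hM' | rfl)
    exacts [h M' hM', h']

/-- The union of a mask and a list of literals. -/
def orMask (acc : ℕ) (ls : List ℕ) : ℕ := ls.foldl (fun acc l => acc ||| 1 <<< l) acc

theorem testBit_orMask (acc : ℕ) (ls : List ℕ) (i : ℕ) :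
    (orMask acc ls).testBit i = true ↔ acc.testBit i = true ∨ i ∈ ls := by
  induction ls generalizing acc with
  | nil => simp [orMask]
  | cons l ls ih =>
    rw [orMask, List.foldl_cons, ← orMask, ih, Nat.testBit_or, Nat.one_shiftLeft,
      Nat.testBit_two_pow, Bool.or_eq_true, decide_eq_true_eq, List.mem_cons, or_assoc,
      @eq_comm _ l i]

theorem orMask_lt {acc : ℕ} {ls : List ℕ} (h : acc < 2 ^ (2 * n)) (hl : ∀ l ∈ ls, l < 2 * n) :
    orMask acc ls < 2 ^ (2 * n) := by
  induction ls generalizing acc with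
  | nil => exact h
  | cons l ls ih =>
    refine ih ?_ fun l' hl' => hl l' (by simp [hl'])
    simp only [Nat.one_shiftLeft]
    exact Nat.or_lt_two_pow h (Nat.pow_lt_pow_right (by omega) (hl l (by simp)))

theorem maskSat_orMask {a : Fin n → Bool} {acc : ℕ} {ls : List ℕ} :
    MaskSat a (orMask acc ls) ↔ MaskSat a acc ∨ ∃ l ∈ ls, LitTrue a l := by
  simp only [MaskSat, testBit_orMask]
  constructor
  · rintro ⟨l, h | h, h'⟩
    exacts [Or.inl ⟨l, h, h'⟩, Or.inr ⟨l, h, h'⟩]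
  · rintro (⟨l, h, h'⟩ | ⟨l, h, h'⟩)
    exacts [⟨l, Or.inl h, h'⟩, ⟨l, Or.inr h, h'⟩]

theorem not_maskSat_zero (a : Fin n → Bool) : ¬ MaskSat a 0 := by simp [MaskSat]

/-- Random literals may coincide and are merged by the mask, so the width can drop but never exceeds
the number of draws. -/
theorem length_maskLits_orMask (ls : List ℕ) : (maskLits n (orMask 0 ls)).length ≤ ls.length := by
  refine ((nodup_maskLits _).subperm fun l hl => ?_).length_le
  have := (testBit_orMask 0 ls l).1 (mem_maskLits.1 hl).2
  simpa using this

theorem validMask_orMask {ls : List ℕ} (hK : ls.length ≤ K) (hl : ∀ l ∈ ls, l < 2 * n) :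
    ValidMask n K (orMask 0 ls) :=
  ⟨orMask_lt (by positivity) hl, (length_maskLits_orMask ls).trans hK⟩

/-! ### The masks of a formula -/

/-- The masks of a formula. -/
def baseMasks (F : KCNF k n) : List ℕ :=
  (F.clauses.map fun C => orMask 0 (C.map code)).foldl addMask []

theorem mem_foldl_addMask {L Ms : List ℕ} {M : ℕ} :
    M ∈ Ms.foldl addMask L ↔ M ∈ L ∨ M ∈ Ms := by
  induction Ms generalizing L with
  | nil => simp
  | cons M' Ms ih => simp [ih, mem_addMask, or_assoc]

theorem nodup_foldl_addMask {L Ms : List ℕ} (h : L.Nodup) : (Ms.foldl addMask L).Nodup := by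
  induction Ms generalizing L with
  | nil => exact h
  | cons M' Ms ih => exact ih (nodup_addMask h)

theorem length_foldl_addMask (L Ms : List ℕ) :
    (Ms.foldl addMask L).length ≤ L.length + Ms.length := by
  induction Ms generalizing L with
  | nil => simp
  | cons M' Ms ih =>
    have := ih (addMask L M')
    have := length_addMask L M'
    simp only [List.foldl_cons, List.length_cons]; omega

theorem nodup_baseMasks (F : KCNF k n) : (baseMasks F).Nodup := nodup_foldl_addMask List.nodup_nil

theorem length_baseMasks (F : KCNF k n) : (baseMasks F).length ≤ F.clauses.length :=
  (length_foldl_addMask [] (F.clauses.map fun C => orMask 0 (C.map code))).trans (by simp)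

theorem mem_baseMasks {F : KCNF k n} {M : ℕ} :
    M ∈ baseMasks F ↔ ∃ C ∈ F.clauses, orMask 0 (C.map code) = M := by
  simp [baseMasks, mem_foldl_addMask]

theorem valid_baseMasks (F : KCNF k n) : ∀ M ∈ baseMasks F, ValidMask n k M := by
  intro M hM
  obtain ⟨C, hC, rfl⟩ := mem_baseMasks.1 hM
  refine validMask_orMask (by simpa using F.width C hC) ?_
  intro l hl
  obtain ⟨l', -, rfl⟩ := List.mem_map.1 hl
  exact code_lt l'

theorem sat_baseMasks (F : KCNF k n) (a : Fin n → Bool) :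
    Sat (baseMasks F) a ↔ F.SatisfiedBy a := by
  simp only [Sat, mem_baseMasks, forall_exists_index, and_imp, forall_apply_eq_imp_iff₂,
    KCNF.SatisfiedBy, maskSat_orMask, not_maskSat_zero, false_or, List.mem_map]
  refine forall₂_congr fun C _ => ?_
  constructor
  · rintro ⟨_, ⟨l, hl, rfl⟩, h⟩
    exact ⟨l, hl, (litTrue_code a l).1 h⟩
  · rintro ⟨l, hl, h⟩
    exact ⟨_, ⟨l, hl, rfl⟩, (litTrue_code a l).2 h⟩

/-- A clause, as a set, is the range of a partial function from `k` slots to the `2 n` literals, and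
different clauses are different sets. Hence the input is polynomial in `n` and the time to read it
is negligible. -/
theorem length_clauses_le (F : KCNF k n) : F.clauses.length ≤ (2 * n + 1) ^ k := by
  classical
  let g : (Fin k → Option (Fin n × Bool)) → Finset (Fin n × Bool) := fun f =>
    Finset.univ.filter fun x => ∃ i, f i = some x
  have hnd : (F.clauses.map List.toFinset).Nodup := by
    rw [List.Nodup, List.pairwise_map]
    refine List.Pairwise.imp_of_mem ?_ F.distinct
    intro C D hC hD h h'
    have := List.toFinset_eq_iff_perm_dedup.1 h'
    rw [(F.nodup C hC).dedup, (F.nodup D hD).dedup] at this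
    exact h this
  have hsub : (F.clauses.map List.toFinset).toFinset ⊆ Finset.univ.image g := by
    intro s hs
    simp only [List.mem_toFinset, List.mem_map] at hs
    obtain ⟨C, hC, rfl⟩ := hs
    refine Finset.mem_image.2 ⟨fun i => C[(i : ℕ)]?, Finset.mem_univ _, ?_⟩
    ext x
    simp only [g, Finset.mem_filter, Finset.mem_univ, true_and, List.mem_toFinset]
    rw [List.mem_iff_getElem?]
    constructor
    · rintro ⟨i, hi⟩; exact ⟨i, hi⟩
    · rintro ⟨i, hi⟩
      have hlt : i < C.length := (List.getElem?_eq_some_iff.1 hi).1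
      exact ⟨⟨i, hlt.trans_le (F.width C hC)⟩, hi⟩
  have h1 := Finset.card_le_card hsub
  rw [List.toFinset_card_of_nodup hnd, List.length_map] at h1
  refine h1.trans (Finset.card_image_le.trans ?_)
  simp [mul_comm]

/-! ### Prefixes -/

/-- The first `j` values of an assignment as binary digits after a leading `1`. -/
def pre (a : Fin n → Bool) : ℕ → ℕ
  | 0 => 1
  | j + 1 => 2 * pre a j + (value a j).toNat

/-- Fix the first `i` variables to the binary digits of `u` after the leading `1`. -/
def addPrefix : ℕ → ℕ → List ℕ → List ℕ
  | 0, _, L => L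
  | i + 1, u, L => addPrefix i (u / 2) (addMask L (1 <<< (2 * i + u % 2)))

theorem maskSat_single {a : Fin n → Bool} {l : ℕ} : MaskSat a (1 <<< l) ↔ LitTrue a l := by
  rw [Nat.one_shiftLeft]
  simp [MaskSat, Nat.testBit_two_pow]

/-- The last digit of `u` belongs to the last fixed variable, so digits are peeled off from the low
end while the index of the variable decreases. The bounds on `u` say that exactly `i` digits follow
the leading `1`. -/
theorem sat_addPrefix {a : Fin n → Bool} {i u : ℕ} {L : List ℕ} (hi : i ≤ n) (h1 : 2 ^ i ≤ u)
    (h2 : u < 2 ^ (i + 1)) : Sat (addPrefix i u L) a ↔ Sat L a ∧ pre a i = u := by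
  induction i generalizing u L with
  | zero =>
    have : u = 1 := by omega
    simp [addPrefix, pre, this]
  | succ i ih =>
    rw [addPrefix, ih (by omega) (by omega) (by omega), sat_addMask, maskSat_single, and_assoc]
    refine and_congr_right fun _ => ?_
    have e1 : (2 * i + u % 2) / 2 = i := by omega
    have e2 : (2 * i + u % 2) % 2 = u % 2 := by omega
    simp only [LitTrue, e1, e2, pre]
    have hin : i < n := by omega
    cases value a i <;> simp [hin] <;> omega

theorem valid_addPrefix {i u : ℕ} {L : List ℕ} (hi : i ≤ n) (hK : 1 ≤ K)
    (h : ∀ M ∈ L, ValidMask n K M) : ∀ M ∈ addPrefix i u L, ValidMask n K M := by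
  induction i generalizing u L with
  | zero => exact h
  | succ i ih =>
    refine ih (by omega) fun M hM => ?_
    rcases mem_addMask.1 hM with hM | rfl
    · exact h M hM
    · have : (1 : ℕ) <<< (2 * i + u % 2) = orMask 0 [2 * i + u % 2] := by simp [orMask]
      rw [this]
      exact validMask_orMask (by simpa using hK) (by simp; omega)

theorem nodup_addPrefix {i u : ℕ} {L : List ℕ} (h : L.Nodup) : (addPrefix i u L).Nodup := by
  induction i generalizing u L with
  | zero => exact h
  | succ i ih => exact ih (nodup_addMask h)

theorem length_addPrefix (i u : ℕ) (L : List ℕ) :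
    (addPrefix i u L).length ≤ L.length + i := by
  induction i generalizing u L with
  | zero => simp [addPrefix]
  | succ i ih =>
    have := ih (u / 2) (addMask L (1 <<< (2 * i + u % 2)))
    have := length_addMask L (1 <<< (2 * i + u % 2))
    rw [addPrefix]; omega

theorem prefix_addPrefix (i u : ℕ) (L : List ℕ) : L <+: addPrefix i u L := by
  induction i generalizing u L with
  | zero => simp [addPrefix]
  | succ i ih => exact (prefix_addMask L _).trans (ih _ _)

/-- A prefix of full length determines the assignment; therefore a leaf of the search tree carries
at most one solution. -/
theorem pre_injective : Function.Injective fun a : Fin n → Bool => pre a n := by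
  intro a b h
  have key : ∀ j, pre a j = pre b j → ∀ i < j, value a i = value b i := by
    intro j
    induction j with
    | zero => simp
    | succ j ih =>
      intro h i hi
      simp only [pre] at h
      have : pre a j = pre b j ∧ value a j = value b j := by
        revert h; cases value a j <;> cases value b j <;> simp <;> omega
      rcases Nat.lt_succ_iff_lt_or_eq.1 hi with hi | rfl
      exacts [ih this.1 i hi, this.2]
  funext i
  have := key n h i i.2
  simpa [value] using this

end SATCount

/-! ### Expectations -/

namespace SATCount

variable {α β : Type}

/-- The expectation of `φ` under `f`. -/
noncomputable def ex (f : PMF α) (φ : α → ℝ≥0∞) : ℝ≥0∞ := ∑' a, f a * φ a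

/-- The indicator function of an event. -/
noncomputable def ind (p : α → Prop) : α → ℝ≥0∞ := Set.indicator {a | p a} fun _ => 1

theorem ind_apply (p : α → Prop) [DecidablePred p] (a : α) : ind p a = if p a then 1 else 0 := by
  simp [ind, Set.indicator_apply]

theorem ind_of {p : α → Prop} {a : α} (h : p a) : ind p a = 1 := by
  classical simp [ind_apply, h]

theorem ind_of_not {p : α → Prop} {a : α} (h : ¬ p a) : ind p a = 0 := by
  classical simp [ind_apply, h]

theorem ind_le_one (p : α → Prop) (a : α) : ind p a ≤ 1 := by
  classical
  rw [ind_apply]; split_ifs <;> simp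

theorem ind_mul_ind (p : α → Prop) (q : β → Prop) (a : α) (b : β) [Decidable (p a ∧ q b)] :
    ind p a * ind q b = if p a ∧ q b then 1 else 0 := by
  classical
  by_cases hp : p a <;> by_cases hq : q b <;> simp [ind_apply, hp, hq]

theorem toOuterMeasure_eq_ex (f : PMF α) (A : Set α) : f.toOuterMeasure A = ex f (ind (· ∈ A)) := by
  classical
  rw [PMF.toOuterMeasure_apply, ex]
  refine tsum_congr fun a => ?_
  rw [ind_apply, Set.indicator_apply]; split_ifs <;> simp

@[simp] theorem ex_pure (a : α) (φ : α → ℝ≥0∞) : ex (PMF.pure a) φ = φ a := by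
  classical
  rw [ex, tsum_eq_single a]
  · simp
  · intro b hb; simp [PMF.pure_apply, hb]

theorem ex_bind (f : PMF α) (g : α → PMF β) (φ : β → ℝ≥0∞) :
    ex (f.bind g) φ = ex f fun a => ex (g a) φ := by
  simp only [ex, PMF.bind_apply, ← ENNReal.tsum_mul_left, ← ENNReal.tsum_mul_right]
  rw [ENNReal.tsum_comm]
  simp only [mul_assoc]

theorem ex_map (f : PMF α) (k : α → β) (φ : β → ℝ≥0∞) : ex (f.map k) φ = ex f fun a => φ (k a) := by
  simp [← PMF.bind_pure_comp, ex_bind]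

theorem ex_const (f : PMF α) (c : ℝ≥0∞) : ex f (fun _ => c) = c := by
  rw [ex, ENNReal.tsum_mul_right, f.tsum_coe, one_mul]

theorem ex_add (f : PMF α) (φ ψ : α → ℝ≥0∞) : ex f (fun a => φ a + ψ a) = ex f φ + ex f ψ := by
  simp only [ex, mul_add, ENNReal.tsum_add]

theorem ex_const_mul (f : PMF α) (c : ℝ≥0∞) (φ : α → ℝ≥0∞) :
    ex f (fun a => c * φ a) = c * ex f φ := by
  simp only [ex, ← ENNReal.tsum_mul_left]
  exact tsum_congr fun a => by ring

theorem ex_mul_const (f : PMF α) (c : ℝ≥0∞) (φ : α → ℝ≥0∞) :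
    ex f (fun a => φ a * c) = ex f φ * c := by
  simp only [mul_comm _ c, ex_const_mul]

theorem ex_mono (f : PMF α) {φ ψ : α → ℝ≥0∞} (h : ∀ a, φ a ≤ ψ a) : ex f φ ≤ ex f ψ :=
  ENNReal.tsum_le_tsum fun a => by gcongr; exact h a

theorem ex_mono_support (f : PMF α) {φ ψ : α → ℝ≥0∞} (h : ∀ a ∈ f.support, φ a ≤ ψ a) :
    ex f φ ≤ ex f ψ :=
  ENNReal.tsum_le_tsum fun a => by
    by_cases ha : f a = 0
    · simp [ha]
    · gcongr; exact h a ((PMF.mem_support_iff f a).2 ha)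

theorem ex_sum {ι : Type} (f : PMF α) (t : Finset ι) (φ : ι → α → ℝ≥0∞) :
    ex f (fun a => ∑ i ∈ t, φ i a) = ∑ i ∈ t, ex f (φ i) := by
  simp only [ex, Finset.mul_sum]
  exact Summable.tsum_finsetSum fun _ _ => ENNReal.summable

theorem ex_coin (φ : Bool → ℝ≥0∞) :
    ex (PMF.uniformOfFintype Bool) φ = 2⁻¹ * (φ false + φ true) := by
  simp [ex, PMF.uniformOfFintype_apply, mul_add, add_comm]

theorem ex_ind_compl (f : PMF α) (p : α → Prop) : ex f (ind p) + ex f (ind fun a => ¬ p a) = 1 := by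
  classical
  rw [← ex_add, ← ex_const f 1]
  congr 1; funext a
  by_cases h : p a <;> simp [ind_apply, h]

/-! ### Random clauses -/

/-- Append `w` random binary digits to `x`. -/
noncomputable def randBits : ℕ → ℕ → PMF ℕ
  | 0, x => PMF.pure x
  | w + 1, x => (PMF.uniformOfFintype Bool).bind fun b => randBits w (2 * x + b.toNat)

/-- A random literal. -/
noncomputable def randLit (n : ℕ) : PMF ℕ :=
  (randBits n 0).bind fun x => (PMF.uniformOfFintype Bool).map fun b => 2 * (x % n) + b.toNat

/-- The mask `acc` together with `j` random literals. -/
noncomputable def randMask (n : ℕ) : ℕ → ℕ → PMF ℕ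
  | 0, acc => PMF.pure acc
  | j + 1, acc => (randLit n).bind fun l => randMask n j (acc ||| 1 <<< l)

/-- The list `L` together with `m` random clauses of `s` literals. -/
noncomputable def hash (n s : ℕ) : ℕ → List ℕ → PMF (List ℕ)
  | 0, L => PMF.pure L
  | m + 1, L => (randMask n s 0).bind fun M => hash n s m (addMask L M)

theorem ex_randBits (w x : ℕ) (φ : ℕ → ℝ≥0∞) :
    ex (randBits w x) φ = (2⁻¹) ^ w * ∑ y ∈ Finset.range (2 ^ w), φ (2 ^ w * x + y) := by
  induction w generalizing x with
  | zero => simp [randBits]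
  | succ w ih =>
    rw [randBits, ex_bind, ex_coin, ih, ih, ← mul_add, ← mul_assoc, ← pow_succ']
    congr 1
    rw [pow_succ 2 w, mul_two, Finset.sum_range_add]
    congr 1
    · refine Finset.sum_congr rfl fun y _ => ?_
      congr 1; simp; ring
    · refine Finset.sum_congr rfl fun y _ => ?_
      congr 1; simp; ring

variable {n : ℕ}

/-! ### Joint survival of two assignments -/

/-- The variables where two assignments differ. -/
def diff (a b : Fin n → Bool) : Finset (Fin n) := Finset.univ.filter fun i => a i ≠ b i

theorem litTrue_two_mul {a : Fin n → Bool} {i : ℕ} (hi : i < n) (b : Bool) :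
    LitTrue a (2 * i + b.toNat) ↔ a ⟨i, hi⟩ = b := by
  have := litTrue_code a (⟨i, hi⟩, b)
  simpa [code] using this

/-- The probability that a random literal is falsified by both assignments. -/
noncomputable def bothFalse (a b : Fin n → Bool) : ℝ≥0∞ :=
  ex (randLit n) (ind fun l => ¬ LitTrue a l ∧ ¬ LitTrue b l)

/-- Both assignments can falsify a literal only if they agree on its variable; the sign then decides
with a fair coin. -/
theorem bothFalse_eq (hn : 0 < n) (a b : Fin n → Bool) :
    bothFalse a b = 2⁻¹ * ex (randBits n 0) (ind fun x => value a (x % n) = value b (x % n)) := by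
  classical
  rw [bothFalse, randLit, ex_bind, ← ex_const_mul]
  congr 1; funext x
  have hx : x % n < n := Nat.mod_lt _ hn
  rw [ex_map, ex_coin]
  simp only [ind_apply, litTrue_two_mul hx, value, hx, dif_pos]
  cases a ⟨x % n, hx⟩ <;> cases b ⟨x % n, hx⟩ <;> simp

theorem bothFalse_self (hn : 0 < n) (a : Fin n → Bool) : bothFalse a a = 2⁻¹ := by
  classical
  rw [bothFalse_eq hn]
  simp [ind, ex_const]

theorem bothFalse_le_half (hn : 0 < n) (a b : Fin n → Bool) : bothFalse a b ≤ 2⁻¹ := by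
  rw [bothFalse_eq hn]
  calc _ ≤ 2⁻¹ * ex (randBits n 0) (fun _ => 1) := by
        gcongr; exact ex_mono _ fun _ => ind_le_one _ _
    _ = 2⁻¹ := by rw [ex_const, mul_one]

/-- Among `2^n` numbers each residue modulo `n` occurs at least `⌊2^n / n⌋` times, which is at least
half of its fair share because `2^n ≥ n`. Reducing `n` coin tosses modulo `n`, without rejection,
thus costs only a factor `2`. -/
theorem card_mod_ge (hn : 0 < n) (D : Finset (Fin n)) :
    2 ^ n * D.card ≤ 2 * n * ((Finset.range (2 ^ n)).filter fun x =>
      ∃ i ∈ D, (i : ℕ) = x % n).card := by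
  have hq : 2 ^ n ≤ 2 * n * (2 ^ n / n) := by
    have h1 := Nat.div_add_mod (2 ^ n) n
    have h2 := Nat.mod_lt (2 ^ n) hn
    have h3 : 1 ≤ 2 ^ n / n := (Nat.one_le_div_iff hn).2 Nat.lt_two_pow_self.le
    nlinarith
  have hc : D.card * (2 ^ n / n) ≤ ((Finset.range (2 ^ n)).filter fun x =>
      ∃ i ∈ D, (i : ℕ) = x % n).card := by
    rw [← Finset.card_range (2 ^ n / n), ← Finset.card_product]
    refine Finset.card_le_card_of_injOn (fun p => (p.1 : ℕ) + n * p.2) ?_ ?_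
    · rintro ⟨i, j⟩ h
      simp only [Finset.coe_product, Set.mem_prod, Finset.mem_coe, Finset.mem_range] at h
      simp only [Finset.coe_filter, Finset.mem_range, Set.mem_ofPred_eq]
      refine ⟨?_, i, h.1, ?_⟩
      · have h1 : n * (j + 1) ≤ 2 ^ n :=
          (Nat.mul_le_mul_left n h.2).trans (Nat.mul_div_le _ _)
        have := i.2
        rw [mul_add, mul_one] at h1; omega
      · rw [Nat.add_mul_mod_self_left, Nat.mod_eq_of_lt i.2]
    · rintro ⟨i, j⟩ - ⟨i', j'⟩ - h
      simp only at h
      have h1 := congrArg (· % n) h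
      simp only [Nat.add_mul_mod_self_left, Nat.mod_eq_of_lt i.2, Nat.mod_eq_of_lt i'.2] at h1
      have h2 : n * j = n * j' := by omega
      exact Prod.ext (Fin.ext h1) (Nat.eq_of_mul_eq_mul_left hn h2)
  calc 2 ^ n * D.card ≤ 2 * n * (2 ^ n / n) * D.card := by gcongr
    _ = 2 * n * (D.card * (2 ^ n / n)) := by ring
    _ ≤ _ := by gcongr

theorem bothFalse_le (hn : 0 < n) (a b : Fin n → Bool) :
    bothFalse a b ≤ ENNReal.ofReal (2⁻¹ * (1 - (diff a b).card / (2 * n))) := by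
  classical
  rw [bothFalse_eq hn, ex_randBits]
  simp only [ind_apply, mul_zero, zero_add, Finset.sum_boole]
  set A := (Finset.range (2 ^ n)).filter fun x => value a (x % n) = value b (x % n)
  set B := (Finset.range (2 ^ n)).filter fun x => ∃ i ∈ diff a b, (i : ℕ) = x % n
  have hB := card_mod_ge hn (diff a b)
  have hAB : A.card + B.card ≤ 2 ^ n := by
    rw [← Finset.card_union_of_disjoint]
    · refine (Finset.card_le_card (t := Finset.range (2 ^ n)) ?_).trans (by simp)
      exact Finset.union_subset (Finset.filter_subset _ _) (Finset.filter_subset _ _)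
    · rw [Finset.disjoint_left]
      intro x hA hB
      simp only [A, B, Finset.mem_filter, diff, Finset.mem_univ, true_and] at hA hB
      obtain ⟨-, i, hi, hix⟩ := hB
      have := hA.2
      simp only [value, ← hix, i.2, dif_pos] at this
      exact hi this
  have h1 : (2⁻¹ : ℝ≥0∞) * ((2⁻¹) ^ n * (A.card : ℝ≥0∞)) =
      ENNReal.ofReal (2⁻¹ * ((2⁻¹) ^ n * A.card)) := by
    rw [ENNReal.ofReal_mul (by positivity), ENNReal.ofReal_mul (by positivity),
      ENNReal.ofReal_pow (by positivity), ENNReal.ofReal_natCast,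
      ENNReal.ofReal_inv_of_pos (by norm_num)]
    simp
  rw [h1]
  refine ENNReal.ofReal_le_ofReal ?_
  have hn' : (0 : ℝ) < n := by exact_mod_cast hn
  have h2 : (0 : ℝ) < 2 ^ n := by positivity
  have hB' : (2 : ℝ) ^ n * (diff a b).card ≤ 2 * n * B.card := by exact_mod_cast hB
  have hAB' : (A.card : ℝ) + B.card ≤ 2 ^ n := by exact_mod_cast hAB
  have h3 : (2⁻¹ : ℝ) ^ n * A.card ≤ 1 - (diff a b).card / (2 * n) := by
    rw [inv_pow, inv_mul_le_iff₀ h2, mul_sub, mul_one]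
    have : (2 : ℝ) ^ n * ((diff a b).card / (2 * n)) ≤ B.card := by
      rw [← mul_div_assoc, div_le_iff₀ (by positivity)]; linarith
    linarith
  linarith

/-- A clause is falsified by both assignments exactly if each of its independent literals is, so the
probabilities multiply. -/
theorem ex_randMask (a b : Fin n → Bool) (j acc : ℕ) :
    ex (randMask n j acc) (ind fun M => ¬ MaskSat a M ∧ ¬ MaskSat b M) =
      ind (fun M => ¬ MaskSat a M ∧ ¬ MaskSat b M) acc * bothFalse a b ^ j := by
  classical
  induction j generalizing acc with
  | zero => simp [randMask]
  | succ j ih =>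
    rw [randMask, ex_bind]
    simp only [ih]
    rw [ex_mul_const, pow_succ', ← mul_assoc]
    congr 1
    rw [bothFalse, ← ex_const_mul]
    congr 1; funext l
    have h : ∀ c : Fin n → Bool, MaskSat c (acc ||| 1 <<< l) ↔ MaskSat c acc ∨ LitTrue c l := by
      intro c
      have := maskSat_orMask (a := c) (acc := acc) (ls := [l])
      simpa [orMask] using this
    rw [ind_mul_ind]
    simp only [ind_apply, h, not_or]
    exact if_congr (by tauto) rfl rfl

/-- The probability that both assignments satisfy a random clause. -/
noncomputable def bothSat (s : ℕ) (a b : Fin n → Bool) : ℝ≥0∞ :=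
  ex (randMask n s 0) (ind fun M => MaskSat a M ∧ MaskSat b M)

/-- Inclusion and exclusion for the events that `a` or `b` falsifies the clause, arranged without
subtraction because the values lie in `ℝ≥0∞`. -/
theorem bothSat_add (hn : 0 < n) (s : ℕ) (a b : Fin n → Bool) :
    bothSat s a b + 2 * (2⁻¹) ^ s = 1 + bothFalse a b ^ s := by
  classical
  have h1 : ∀ c : Fin n → Bool, ex (randMask n s 0) (ind fun M => ¬ MaskSat c M) = (2⁻¹) ^ s := by
    intro c
    have := ex_randMask c c s 0
    simpa [ind_apply, not_maskSat_zero, bothFalse_self hn] using this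
  have h2 := ex_randMask a b s 0
  rw [ind_of ⟨not_maskSat_zero a, not_maskSat_zero b⟩, one_mul] at h2
  rw [← h2, two_mul]
  nth_rewrite 1 [← h1 a]
  rw [← h1 b, bothSat, ← ex_add, ← ex_add, ← ex_const (randMask n s 0) 1, ← ex_add]
  congr 1; funext M
  by_cases ha : MaskSat a M <;> by_cases hb : MaskSat b M <;> simp [ind_apply, ha, hb]

/-- The clauses are drawn independently. Dropping repeated clauses in `addMask` does not change the
solutions, so the product formula is unaffected. The case `a = b` gives the first moment. -/
theorem ex_hash (s m : ℕ) (L : List ℕ) (a b : Fin n → Bool) :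
    ex (hash n s m L) (ind fun L => Sat L a ∧ Sat L b) =
      ind (fun L => Sat L a ∧ Sat L b) L * bothSat s a b ^ m := by
  classical
  induction m generalizing L with
  | zero => simp [hash]
  | succ m ih =>
    rw [hash, ex_bind]
    simp only [ih]
    rw [ex_mul_const, pow_succ', ← mul_assoc]
    congr 1
    rw [bothSat, ← ex_const_mul]
    congr 1; funext M
    rw [ind_mul_ind]
    simp only [ind_apply, sat_addMask]
    exact if_congr (by tauto) rfl rfl

/-- The probability that a fixed assignment satisfies a random clause. -/
noncomputable def satProb (s : ℕ) : ℝ := 1 - (2⁻¹) ^ s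

theorem half_le_satProb {s : ℕ} (hs : 1 ≤ s) : 2⁻¹ ≤ satProb s := by
  have : (2⁻¹ : ℝ) ^ s ≤ (2⁻¹) ^ 1 := pow_le_pow_of_le_one (by norm_num) (by norm_num) hs
  rw [satProb]; linarith

theorem bothSat_eq (hn : 0 < n) (s : ℕ) (a b : Fin n → Bool) :
    bothSat s a b = ENNReal.ofReal (1 - 2 * (2⁻¹) ^ s + (bothFalse a b).toReal ^ s) := by
  have hf : bothFalse a b ≠ ⊤ := ne_top_of_le_ne_top (by simp) (bothFalse_le_half hn a b)
  have h := bothSat_add hn s a b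
  have ht : bothSat s a b ≠ ⊤ := by
    refine ne_top_of_le_ne_top (b := 1) (by simp) ?_
    calc bothSat s a b ≤ ex (randMask n s 0) (fun _ => 1) := ex_mono _ fun _ => ind_le_one _ _
      _ = 1 := ex_const _ _
  have h' := congrArg ENNReal.toReal h
  rw [ENNReal.toReal_add ht (by finiteness), ENNReal.toReal_add (by simp) (by finiteness)] at h'
  simp only [ENNReal.toReal_mul, ENNReal.toReal_pow, ENNReal.toReal_inv, ENNReal.toReal_ofNat,
    ENNReal.toReal_one] at h'
  rw [← ENNReal.ofReal_toReal ht]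
  congr 1; linarith

theorem bothSat_self (hn : 0 < n) (s : ℕ) (a : Fin n → Bool) :
    bothSat s a a = ENNReal.ofReal (satProb s) := by
  rw [bothSat_eq hn, bothFalse_self hn, satProb]
  congr 1; simp; ring

theorem bothSat_le_satProb (hn : 0 < n) (s : ℕ) (a b : Fin n → Bool) :
    bothSat s a b ≤ ENNReal.ofReal (satProb s) := by
  classical
  rw [← bothSat_self hn s a]
  refine ex_mono _ fun M => ?_
  simp only [ind_apply]
  split_ifs <;> simp_all

/-- With `q = 2^(-s)` and `ρ = q (1 - β/2)^s` the joint probability is at most `1 - 2 q + ρ ≤ (1 -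
q)^2 + ρ`. Since `1 - q ≥ 1/2`, the excess `ρ` is at most `4 ρ (1 - q)^2`, and `1 + 4 ρ ≤ exp (4 ρ)`
puts it into a form that can be raised to the power `m`. -/
theorem bothSat_le_of_far (hn : 0 < n) {s : ℕ} (hs : 1 ≤ s) {β : ℝ} (hβ : β ≤ 1)
    (a b : Fin n → Bool) (hd : β * n ≤ (diff a b).card) :
    bothSat s a b ≤ ENNReal.ofReal (satProb s ^ 2 * Real.exp (4 * ((2⁻¹) ^ s * (1 - β / 2) ^ s))) := by
  rw [bothSat_eq hn]
  refine ENNReal.ofReal_le_ofReal ?_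
  have hn' : (0 : ℝ) < n := by exact_mod_cast hn
  have h1 : (bothFalse a b).toReal ≤ 2⁻¹ * (1 - β / 2) := by
    refine ENNReal.toReal_le_of_le_ofReal (by nlinarith) ((bothFalse_le hn a b).trans ?_)
    refine ENNReal.ofReal_le_ofReal ?_
    have : β / 2 ≤ (diff a b).card / (2 * n) := by
      rw [div_le_div_iff₀ (by norm_num) (by positivity)]; nlinarith
    linarith
  have h2 : (bothFalse a b).toReal ^ s ≤ (2⁻¹) ^ s * (1 - β / 2) ^ s := by
    rw [← mul_pow]; exact pow_le_pow_left₀ ENNReal.toReal_nonneg h1 s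
  set ρ : ℝ := (2⁻¹) ^ s * (1 - β / 2) ^ s
  have hp := half_le_satProb hs
  have hq : (2⁻¹ : ℝ) ^ s = 1 - satProb s := by rw [satProb]; ring
  have hρ : 0 ≤ ρ := (pow_nonneg ENNReal.toReal_nonneg s).trans h2
  have h3 : 4 * ρ + 1 ≤ Real.exp (4 * ρ) := Real.add_one_le_exp _
  have h4 : satProb s ^ 2 * (4 * ρ + 1) ≤ satProb s ^ 2 * Real.exp (4 * ρ) := by gcongr
  rw [hq]
  nlinarith [sq_nonneg (1 - satProb s), mul_nonneg hρ (by nlinarith : (0 : ℝ) ≤ satProb s ^ 2 * 4 - 1)]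

end SATCount

/-! ### Moments of the number of solutions -/

namespace SATCount

variable {n : ℕ}

open Classical in
/-- The number of assignments that satisfy all clauses of a list. -/
noncomputable def solCount (n : ℕ) (L : List ℕ) : ℕ :=
  (Finset.univ.filter fun a : Fin n → Bool => Sat L a).card

theorem solCount_eq_sum (L : List ℕ) :
    (solCount n L : ℝ≥0∞) = ∑ a : Fin n → Bool, ind (fun L => Sat L a) L := by
  classical
  simp [solCount, ind_apply]

theorem solCount_le (L : List ℕ) : solCount n L ≤ 2 ^ n := by
  classical
  exact (Finset.card_le_univ _).trans (by simp)

theorem ex_solCount (hn : 0 < n) (s m : ℕ) (L : List ℕ) :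
    ex (hash n s m L) (fun L' => (solCount n L' : ℝ≥0∞)) =
      ENNReal.ofReal (solCount n L * satProb s ^ m) := by
  simp only [solCount_eq_sum]
  rw [ex_sum, ENNReal.ofReal_mul (by positivity), ENNReal.ofReal_natCast, solCount_eq_sum,
    Finset.sum_mul]
  refine Finset.sum_congr rfl fun a _ => ?_
  have h := ex_hash s m L a a
  simp only [and_self] at h
  have hp : 0 ≤ satProb s := by
    rw [satProb, sub_nonneg]; exact pow_le_one₀ (by norm_num) (by norm_num)
  rw [h, bothSat_self hn, ENNReal.ofReal_pow hp]

/-- The generating function of Hamming distances from `a` factors over the coordinates. -/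
theorem sum_pow_diff (x : ℝ) (a : Fin n → Bool) :
    ∑ b : Fin n → Bool, x ^ (diff a b).card = (1 + x) ^ n := by
  have h : ∀ b : Fin n → Bool, x ^ (diff a b).card = ∏ i, if a i ≠ b i then x else 1 := by
    intro b
    rw [Finset.prod_ite]; simp [diff]
  simp only [h]
  rw [← Fintype.piFinset_univ, Finset.sum_prod_piFinset (Finset.univ : Finset Bool)
    (fun i c => if a i ≠ c then x else 1)]
  have : ∀ i, ∑ c : Bool, (if a i ≠ c then x else 1) = 1 + x := by
    intro i; cases a i <;> simp [add_comm]
  simp only [this, Finset.prod_const, Finset.card_univ, Fintype.card_fin]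

/-- The second moment is a sum over pairs. Far pairs contribute at most the squared mean times the
correlation factor. For close pairs one survival probability is kept, and their number is bounded
through the weight `x^(distance)`. Every pair is bounded by the sum of both terms, so no case
distinction survives in the summation; the weight is summed over all `b`, not only over solutions.
-/
theorem ex_solCount_sq_le (hn : 0 < n) {s : ℕ} (hs : 1 ≤ s) (m : ℕ) (L : List ℕ) {β x : ℝ}
    (hβ : β ≤ 1) (hx : 0 < x) (hx1 : x ≤ 1) :
    ex (hash n s m L) (fun L' => (solCount n L' : ℝ≥0∞) ^ 2) ≤
      ENNReal.ofReal (solCount n L * satProb s ^ m * (x⁻¹ ^ (β * n) * (1 + x) ^ n) +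
        (solCount n L * satProb s ^ m) ^ 2 *
          Real.exp (4 * (m * (2⁻¹) ^ s * (1 - β / 2) ^ s))) := by
  classical
  set p := satProb s
  have hp0 : 0 < p := lt_of_lt_of_le (by norm_num) (half_le_satProb hs)
  set W := Real.exp (4 * (m * (2⁻¹) ^ s * (1 - β / 2) ^ s))
  have hpair : ∀ a b : Fin n → Bool, bothSat s a b ^ m ≤
      ENNReal.ofReal (p ^ m * (x⁻¹ ^ (β * n) * x ^ (diff a b).card) + (p ^ m) ^ 2 * W) := by
    intro a b
    by_cases hd : β * n ≤ (diff a b).card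
    · refine (pow_le_pow_left' (bothSat_le_of_far hn hs hβ a b hd) m).trans ?_
      rw [← ENNReal.ofReal_pow (by positivity)]
      refine ENNReal.ofReal_le_ofReal ?_
      have : (p ^ 2 * Real.exp (4 * ((2⁻¹) ^ s * (1 - β / 2) ^ s))) ^ m = (p ^ m) ^ 2 * W := by
        rw [mul_pow, ← Real.exp_nat_mul, ← pow_mul, ← pow_mul, mul_comm 2 m]
        congr 2; ring
      rw [this]
      have : 0 ≤ p ^ m * (x⁻¹ ^ (β * n) * x ^ (diff a b).card) := by positivity
      linarith
    · refine (pow_le_pow_left' (bothSat_le_satProb hn s a b) m).trans ?_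
      rw [← ENNReal.ofReal_pow (by positivity)]
      refine ENNReal.ofReal_le_ofReal ?_
      -- Below distance `β * n` this weight is at least `1`, so it dominates the indicator of a
      -- Hamming ball; summing it replaces an estimate of the volume.
      have h1 : 1 ≤ x⁻¹ ^ (β * n) * x ^ (diff a b).card := by
        have : (x⁻¹) ^ ((diff a b).card : ℝ) ≤ x⁻¹ ^ (β * n) :=
          Real.rpow_le_rpow_of_exponent_le ((one_le_inv₀ hx).2 hx1) (not_le.1 hd).le
        rw [Real.rpow_natCast] at this
        calc (1 : ℝ) = x⁻¹ ^ (diff a b).card * x ^ (diff a b).card := by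
              rw [← mul_pow, inv_mul_cancel₀ hx.ne', one_pow]
          _ ≤ _ := by gcongr
      have h2 : 0 ≤ (p ^ m) ^ 2 * W := by positivity
      nlinarith [pow_pos hp0 m]
  have e : ∀ L', (solCount n L' : ℝ≥0∞) ^ 2 = ∑ a : Fin n → Bool, ∑ b : Fin n → Bool,
      ind (fun L => Sat L a ∧ Sat L b) L' := by
    intro L'
    rw [solCount_eq_sum, sq, Finset.sum_mul_sum]
    refine Finset.sum_congr rfl fun a _ => Finset.sum_congr rfl fun b _ => ?_
    rw [ind_mul_ind, ind_apply]
  simp only [e]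
  rw [ex_sum]
  simp only [ex_sum, ex_hash]
  set U := Finset.univ.filter fun a : Fin n → Bool => Sat L a
  have hU : (solCount n L : ℝ) = U.card := rfl
  have hmid : ∀ a b : Fin n → Bool,
      ind (fun L => Sat L a ∧ Sat L b) L * bothSat s a b ^ m ≤ ENNReal.ofReal
        (if a ∈ U then (p ^ m * (x⁻¹ ^ (β * n) * x ^ (diff a b).card) +
          if b ∈ U then (p ^ m) ^ 2 * W else 0) else 0) := by
    intro a b
    by_cases ha : a ∈ U
    · by_cases hb : b ∈ U
      · simp only [ha, hb, if_true]
        refine le_trans ?_ (hpair a b)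
        calc _ ≤ 1 * bothSat s a b ^ m := by gcongr; exact ind_le_one _ _
          _ = _ := one_mul _
      · have : ¬ (Sat L a ∧ Sat L b) := fun h => hb (by simpa [U] using h.2)
        rw [ind_of_not (p := fun L => Sat L a ∧ Sat L b) this]; simp
    · have : ¬ (Sat L a ∧ Sat L b) := fun h => ha (by simpa [U] using h.1)
      rw [ind_of_not (p := fun L => Sat L a ∧ Sat L b) this]; simp
  refine (Finset.sum_le_sum fun a _ => Finset.sum_le_sum fun b _ => hmid a b).trans ?_
  have hpos : ∀ a b : Fin n → Bool, 0 ≤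
      (if a ∈ U then (p ^ m * (x⁻¹ ^ (β * n) * x ^ (diff a b).card) +
          if b ∈ U then (p ^ m) ^ 2 * W else 0) else 0) := by
    intro a b; split_ifs <;> positivity
  simp only [← ENNReal.ofReal_sum_of_nonneg fun b _ => hpos _ b]
  rw [← ENNReal.ofReal_sum_of_nonneg fun a _ => Finset.sum_nonneg fun b _ => hpos a b]
  refine ENNReal.ofReal_le_ofReal (le_of_eq ?_)
  have hrow : ∀ a : Fin n → Bool, ∑ b, (if a ∈ U then (p ^ m * (x⁻¹ ^ (β * n) *
      x ^ (diff a b).card) + if b ∈ U then (p ^ m) ^ 2 * W else 0) else 0) =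
      if a ∈ U then p ^ m * (x⁻¹ ^ (β * n) * (1 + x) ^ n) + U.card * ((p ^ m) ^ 2 * W)
      else 0 := by
    intro a
    split_ifs with ha
    · rw [Finset.sum_add_distrib, ← Finset.mul_sum, ← Finset.mul_sum, sum_pow_diff]
      congr 1
      rw [← Finset.sum_filter]; simp
    · simp
  simp only [hrow]
  rw [← Finset.sum_filter]
  simp only [Finset.filter_univ_mem, Finset.sum_const, nsmul_eq_mul, hU]
  ring

/-- The constants are chosen in this order: `x` with `1 + x ≤ 2^(γ/2)`, then `β` with `x^(-β) ≤
2^(γ/2)`, so that close pairs cost at most `2^(γ n)`; then `s` so large that `4 (1 - β/2)^s ≤ γ log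
2`. In the exponent for far pairs the bound `m ≤ n 2^s` cancels the factor `2^(-s)`, which leaves
`2^(γ n)` again. -/
theorem exists_width {γ : ℝ} (hγ : 0 < γ) : ∃ s : ℕ, 1 ≤ s ∧ ∀ (n : ℕ), 0 < n →
    ∀ (m : ℕ) (L : List ℕ), m ≤ n * 2 ^ s → 1 ≤ (solCount n L : ℝ) * satProb s ^ m →
      ex (hash n s m L) (fun L' => (solCount n L' : ℝ≥0∞) ^ 2) ≤
        ENNReal.ofReal (2 * 2 ^ (γ * n) * (solCount n L * satProb s ^ m) ^ 2) := by
  set c : ℝ := 2 ^ (γ / 2) with hc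
  have hc1 : 1 < c := Real.one_lt_rpow (by norm_num) (by positivity)
  obtain ⟨x, hx0, hx1, hxc⟩ : ∃ x : ℝ, 0 < x ∧ x ≤ 1 ∧ 1 + x ≤ c :=
    ⟨min 1 (c - 1), lt_min one_pos (by linarith), min_le_left _ _,
      by linarith [min_le_right 1 (c - 1)]⟩
  obtain ⟨β, hβ0, hβ1, hβc⟩ : ∃ β : ℝ, 0 < β ∧ β ≤ 1 ∧ x⁻¹ ^ β ≤ c := by
    have hcont : Filter.Tendsto (fun β : ℝ => x⁻¹ ^ β) (nhdsWithin 0 (Set.Ioi 0)) (nhds 1) := by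
      have : Continuous fun β : ℝ => x⁻¹ ^ β :=
        Real.continuous_const_rpow (inv_pos.2 hx0).ne'
      have := this.tendsto 0
      rw [Real.rpow_zero] at this
      exact this.mono_left nhdsWithin_le_nhds
    have h1 := hcont.eventually (gt_mem_nhds hc1)
    have h2 : ∀ᶠ β : ℝ in nhdsWithin 0 (Set.Ioi 0), β ∈ Set.Ioo (0 : ℝ) 1 :=
      Ioo_mem_nhdsGT one_pos
    obtain ⟨β, h1, h2⟩ := (h1.and h2).exists
    exact ⟨β, h2.1, h2.2.le, h1.le⟩
  obtain ⟨s₀, hs₀⟩ : ∃ s₀ : ℕ, (1 - β / 2) ^ s₀ < γ * Real.log 2 / 4 :=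
    exists_pow_lt_of_lt_one (by have := Real.log_pos one_lt_two; positivity) (by linarith)
  have hθ : (1 - β / 2) ^ (s₀ + 1) ≤ γ * Real.log 2 / 4 := by
    refine le_trans ?_ hs₀.le
    exact pow_le_pow_of_le_one (by linarith) (by linarith) (by omega)
  refine ⟨s₀ + 1, by omega, fun n hn m L hm h1 => ?_⟩
  have hs : 1 ≤ s₀ + 1 := by omega
  generalize s₀ + 1 = s at *
  refine (ex_solCount_sq_le hn hs m L hβ1 hx0 hx1).trans (ENNReal.ofReal_le_ofReal ?_)
  set μ := (solCount n L : ℝ) * satProb s ^ m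
  have hcn : c ^ (n : ℝ) * c ^ (n : ℝ) = 2 ^ (γ * n) := by
    rw [hc, ← Real.rpow_mul (by norm_num), ← Real.rpow_add (by norm_num)]
    congr 1; ring
  have hY : x⁻¹ ^ (β * n) * (1 + x) ^ n ≤ 2 ^ (γ * n) := by
    rw [← hcn]
    gcongr
    · rw [Real.rpow_mul (by positivity)]
      exact Real.rpow_le_rpow (by positivity) hβc (by positivity)
    · rw [← Real.rpow_natCast]
      exact Real.rpow_le_rpow (by positivity) hxc (by positivity)
  have hW : Real.exp (4 * (m * (2⁻¹) ^ s * (1 - β / 2) ^ s)) ≤ 2 ^ (γ * n) := by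
    rw [Real.rpow_def_of_pos (by norm_num)]
    refine Real.exp_le_exp.2 ?_
    have hm' : (m : ℝ) * (2⁻¹) ^ s ≤ n := by
      rw [inv_pow, ← div_eq_mul_inv, div_le_iff₀ (by positivity)]
      exact_mod_cast hm
    have h0 : 0 ≤ (1 - β / 2) ^ s := pow_nonneg (by linarith) s
    nlinarith [mul_le_mul hm' hθ h0 (by positivity)]
  have h2 : (0 : ℝ) < 2 ^ (γ * n) := by positivity
  -- Here a mean of at least `1` is needed: it absorbs the linear term from the close pairs into the
  -- squared mean.
  have h3 : μ ≤ μ ^ 2 := by nlinarith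
  calc _ ≤ μ * 2 ^ (γ * n) + μ ^ 2 * 2 ^ (γ * n) := by gcongr
    _ ≤ _ := by nlinarith

end SATCount

/-! ### The counting algorithm -/

namespace SATCount

variable {α β : Type}

/-- The number of positive answers in `r` runs, added to `c`. -/
noncomputable def vote (O : PMF Bool) : ℕ → ℕ → PMF ℕ
  | 0, c => PMF.pure c
  | r + 1, c => O.bind fun b => vote O r (c + b.toNat)

/-- The majority of the answers in `r` runs. -/
noncomputable def majority (O : PMF Bool) (r : ℕ) : PMF Bool :=
  (vote O r 0).map fun c => decide (r < 2 * c)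

/-- Divide by `2` as long as possible. -/
def strip (v : ℕ) : ℕ := if v % 2 = 0 ∧ 0 < v then strip (v / 2) else v
termination_by v
decreasing_by omega

/-- The next subtree after the one at `v` in depth first order, `0` if there is none. -/
def adv (v : ℕ) : ℕ := if strip (v + 1) = 1 then 0 else strip (v + 1)

/-- The node that is visited after `v`, where `b` tells whether there is a solution below `v`. -/
def nextNode (n : ℕ) (b : Bool) (v : ℕ) : ℕ := if b = true ∧ v < 2 ^ n then 2 * v else adv v

/-- Whether a leaf with a solution has been found. -/
def leafHit (n : ℕ) (b : Bool) (v : ℕ) : ℕ := if b = true ∧ 2 ^ n ≤ v then 1 else 0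

/-- Depth first search from the node `v` on with at most `φ` queries. The result consists of the
number of queries that are left and the number of solutions found, added to `S`. -/
noncomputable def dfs (n : ℕ) (q : ℕ → PMF Bool) : ℕ → ℕ → ℕ → PMF (ℕ × ℕ)
  | 0, _, S => PMF.pure (0, S)
  | φ + 1, v, S => if v = 0 then PMF.pure (φ + 1, S) else
      (q v).bind fun b => dfs n q φ (nextNode n b v) (S + leafHit n b v)

/-- Count the solutions for `i` random hashes with `m` clauses. -/
noncomputable def trials (n s m : ℕ) (q : List ℕ → ℕ → PMF Bool) (L₀ : List ℕ) :
    ℕ → ℕ × ℕ → PMF (ℕ × ℕ)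
  | 0, p => PMF.pure p
  | i + 1, p => ((hash n s m L₀).bind fun L => dfs n (q L) p.1 1 p.2).bind
      (trials n s m q L₀ i)

/-- Try `j` numbers of clauses, from `m` on, until the queries suffice. -/
noncomputable def levels (lv : ℕ → PMF (ℕ × ℕ)) : ℕ → ℕ → PMF (ℕ × ℕ)
  | 0, m => PMF.pure (m, 0)
  | j + 1, m => (lv m).bind fun p =>
      if p.1 = 0 then levels lv j (m + 1) else PMF.pure (m, p.2)

/-- Is there a solution below the node `v`, according to the majority of `r` runs of `O`? -/
noncomputable def query (O : List ℕ → PMF Bool) (r : ℕ) (L : List ℕ) (v : ℕ) : PMF Bool :=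
  majority (O (addPrefix (Nat.log 2 v) v L)) r

/-! ### Majority votes -/

theorem ex_vote (O : PMF Bool) (w : ℝ≥0∞) (r c : ℕ) :
    ex (vote O r c) (fun c => w ^ c) = w ^ c * ex O (fun b => w ^ b.toNat) ^ r := by
  induction r generalizing c with
  | zero => simp [vote]
  | succ r ih =>
    rw [vote, ex_bind]
    simp only [ih]
    rw [ex_mul_const, pow_succ', ← mul_assoc]
    congr 1
    rw [← ex_const_mul]
    congr 1; funext b; rw [pow_add]

theorem ex_bool (O : PMF Bool) (φ : Bool → ℝ≥0∞) : ex O φ = O false * φ false + O true * φ true := by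
  rw [ex, tsum_fintype, Fintype.sum_bool, add_comm]

/-- An exponential Markov bound. With weight `w` per positive answer and `u` a bound for the mean
weight of one run, the error probability is at most `u^(2 r) w^(-r)`. A tie counts as a negative
answer, so the two cases are not symmetric, but both choices of `w` give `u^2 / w = 8/9`. -/
theorem majority_error (O : PMF Bool) (b : Bool) (h : 2 / 3 ≤ O b) (r : ℕ) :
    ex (majority O (2 * r)) (ind fun b' => b' ≠ b) ≤ ENNReal.ofReal ((8 / 9) ^ r) := by
  classical
  have h1 : O false + O true = 1 := by
    have := O.tsum_coe
    rwa [tsum_fintype, Fintype.sum_bool, add_comm] at this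
  have hr0 : O false = ENNReal.ofReal (O false).toReal :=
    (ENNReal.ofReal_toReal (O.apply_ne_top _)).symm
  have hr1 : O true = ENNReal.ofReal (O true).toReal :=
    (ENNReal.ofReal_toReal (O.apply_ne_top _)).symm
  have h1' : (O false).toReal + (O true).toReal = 1 := by
    rw [← ENNReal.toReal_add (O.apply_ne_top _) (O.apply_ne_top _), h1, ENNReal.toReal_one]
  have h' : 2 / 3 ≤ (O b).toReal := by
    have := ENNReal.toReal_mono (O.apply_ne_top _) h
    simpa using this
  have n0 : 0 ≤ (O false).toReal := ENNReal.toReal_nonneg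
  have n1 : 0 ≤ (O true).toReal := ENNReal.toReal_nonneg
  rw [majority, ex_map]
  have key : ∀ (w u : ℝ), 0 < w → (O false).toReal + (O true).toReal * w ≤ u → 
      u ^ 2 * w⁻¹ = 8 / 9 → (∀ c : ℕ, decide (2 * r < 2 * c) ≠ b → w ^ r ≤ w ^ c) →
      ex (vote O (2 * r) 0) (fun c => ind (fun b' => b' ≠ b) (decide (2 * r < 2 * c))) ≤
        ENNReal.ofReal ((8 / 9) ^ r) := by
    intro w u hw hu huw hc
    have e1 : ex (vote O (2 * r) 0) (fun c => ENNReal.ofReal w ^ c) ≤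
        ENNReal.ofReal (u ^ (2 * r)) := by
      rw [ex_vote, pow_zero, one_mul, ex_bool, hr0, hr1]
      have hu0 : 0 ≤ u := le_trans (by positivity) hu
      rw [ENNReal.ofReal_pow hu0]
      gcongr
      rw [Bool.toNat_false, pow_zero, mul_one, Bool.toNat_true, pow_one,
        ← ENNReal.ofReal_mul n1, ← ENNReal.ofReal_add n0 (by positivity)]
      exact ENNReal.ofReal_le_ofReal hu
    calc _ ≤ ex (vote O (2 * r) 0) (fun c => ENNReal.ofReal ((w⁻¹) ^ r) * ENNReal.ofReal w ^ c) := by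
          refine ex_mono _ fun c => ?_
          rw [ind_apply]
          split_ifs with hcb
          · rw [← ENNReal.ofReal_pow hw.le, ← ENNReal.ofReal_mul (by positivity),
              ← ENNReal.ofReal_one]
            refine ENNReal.ofReal_le_ofReal ?_
            rw [inv_pow, ← div_eq_inv_mul, one_le_div (by positivity)]
            exact hc c hcb
          · exact zero_le
      _ ≤ ENNReal.ofReal ((w⁻¹) ^ r) * ENNReal.ofReal (u ^ (2 * r)) := by
          rw [ex_const_mul]; gcongr
      _ = _ := by
          rw [← ENNReal.ofReal_mul (by positivity), pow_mul, ← mul_pow, mul_comm, huw]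
  cases b with
  | true =>
    -- An error means at most `r` positive answers; with success probability at least `2/3` the mean
    -- of the weight `1/2` is at most `1/3 + 1/3`.
    refine key (1 / 2) (2 / 3) (by norm_num) (by linarith) (by norm_num) fun c hc => ?_
    simp only [ne_eq, decide_eq_true_eq, not_lt] at hc
    exact pow_le_pow_of_le_one (by norm_num) (by norm_num) (by omega)
  | false =>
    -- An error means more than `r` positive answers; each has probability at most `1/3`, so the
    -- mean of the weight `2` is at most `2/3 + 2/3`.
    refine key 2 (4 / 3) (by norm_num) (by linarith) (by norm_num) fun c hc => ?_
    simp only [ne_eq, decide_eq_false_iff_not, not_not] at hc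
    exact pow_le_pow_right₀ (by norm_num) (by omega)

/-! ### Approximation of distributions -/

/-- Expectations under `f` exceed those under `g` by at most `e`. -/
def Close (e : ℝ≥0∞) (f g : PMF α) : Prop :=
  ∀ φ : α → ℝ≥0∞, (∀ a, φ a ≤ 1) → ex f φ ≤ ex g φ + e

theorem ex_le_one (f : PMF α) {φ : α → ℝ≥0∞} (h : ∀ a, φ a ≤ 1) : ex f φ ≤ 1 :=
  (ex_mono f h).trans (ex_const f 1).le

theorem Close.refl (e : ℝ≥0∞) (f : PMF α) : Close e f f := fun _ _ => le_self_add

theorem Close.mono {e e' : ℝ≥0∞} {f g : PMF α} (h : Close e f g) (he : e ≤ e') : Close e' f g :=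
  fun φ hφ => (h φ hφ).trans (by gcongr)

theorem Close.bind_left {e : ℝ≥0∞} {f g : PMF α} (h : Close e f g) (k : α → PMF β) :
    Close e (f.bind k) (g.bind k) := by
  intro φ hφ
  rw [ex_bind, ex_bind]
  exact h _ fun a => ex_le_one _ hφ

theorem Close.bind_right {e : ℝ≥0∞} (f : PMF α) {k k' : α → PMF β}
    (h : ∀ a ∈ f.support, Close e (k a) (k' a)) : Close e (f.bind k) (f.bind k') := by
  intro φ hφ
  rw [ex_bind, ex_bind, ← ex_const f e, ← ex_add]
  exact ex_mono_support f fun a ha => h a ha φ hφ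

theorem Close.trans {e e' : ℝ≥0∞} {f g h : PMF α} (h₁ : Close e f g) (h₂ : Close e' g h) :
    Close (e + e') f h := fun φ hφ =>
  (h₁ φ hφ).trans (by rw [add_comm e, ← add_assoc]; gcongr; exact h₂ φ hφ)

/-- The hybrid argument: replace the first draw, then the continuation, and add the errors. The
continuations need to be compared only on the support of `g`, which later means only at formulas
that can occur. -/
theorem Close.bind {e e' : ℝ≥0∞} {f g : PMF α} {k k' : α → PMF β} (h : Close e f g)
    (hk : ∀ a ∈ g.support, Close e' (k a) (k' a)) : Close (e + e') (f.bind k) (g.bind k') :=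
  (h.bind_left k).trans (Close.bind_right g hk)

theorem close_pure {e : ℝ≥0∞} {f : PMF α} {a : α} (h : ex f (ind fun b => b ≠ a) ≤ e) :
    Close e f (PMF.pure a) := by
  intro φ hφ
  rw [ex_pure]
  calc ex f φ ≤ ex f (fun b => φ a + ind (fun b => b ≠ a) b) := by
        refine ex_mono f fun b => ?_
        by_cases hb : b = a
        · subst hb; exact le_self_add
        · rw [ind_of (p := fun b => b ≠ a) hb]; exact (hφ b).trans le_add_self
    _ = φ a + ex f (ind fun b => b ≠ a) := by rw [ex_add, ex_const]
    _ ≤ _ := by gcongr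

/-! ### Depth first search -/

theorem strip_of_odd {v : ℕ} (h : v % 2 = 1) : strip v = v := by rw [strip]; simp [h]

theorem strip_two_mul {v : ℕ} (h : 0 < v) : strip (2 * v) = strip v := by
  rw [strip]; simp [h]

theorem strip_le (v : ℕ) : strip v ≤ v := by
  induction v using Nat.strong_induction_on with
  | _ v ih =>
    rw [strip]; split_ifs with h
    · exact (ih (v / 2) (by omega)).trans (by omega)
    · rfl

theorem strip_two_pow (j : ℕ) : strip (2 ^ j) = 1 := by
  induction j with
  | zero => exact strip_of_odd rfl
  | succ j ih => rw [pow_succ', strip_two_mul (by positivity), ih]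

/-- Going up from `v + 1` can leave the tree only for `v + 1 = 2^j`; this strips down to the root,
where `adv` stops with `0`. -/
theorem adv_lt {v j : ℕ} (h : v < 2 ^ j) : adv v < 2 ^ j := by
  unfold adv
  split_ifs with h1
  · positivity
  · have h2 := strip_le (v + 1)
    rcases Nat.lt_or_ge (v + 1) (2 ^ j) with h3 | h3
    · omega
    · have : v + 1 = 2 ^ j := by omega
      rw [this, strip_two_pow] at h1
      exact absurd rfl h1

theorem adv_two_mul {v : ℕ} (h : 0 < v) : adv (2 * v) = 2 * v + 1 := by
  rw [adv, strip_of_odd (by omega)]; simp; omega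

/-- Behind a right child the search goes on as behind its parent. With node numbers that carry a
leading `1`, climbing is the removal of trailing zeros of the successor, so no stack is needed. -/
theorem adv_two_mul_add_one (v : ℕ) : adv (2 * v + 1) = adv v := by
  rw [adv, show 2 * v + 1 + 1 = 2 * (v + 1) by ring, strip_two_mul (by omega), ← adv]

theorem adv_one : adv 1 = 0 := by
  have := strip_two_pow 1
  simp only [pow_one] at this
  rw [adv]; simp [this]

theorem nextNode_lt {n v : ℕ} (b : Bool) (h : v < 2 ^ (n + 1)) : nextNode n b v < 2 ^ (n + 1) := by
  unfold nextNode
  split_ifs with h1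
  · have := h1.2; rw [pow_succ]; omega
  · exact adv_lt h

variable {n : ℕ}

open Classical in
/-- The number of solutions below the node `v`. -/
noncomputable def cnt (n : ℕ) (L : List ℕ) (v : ℕ) : ℕ :=
  (Finset.univ.filter fun a : Fin n → Bool => Sat L a ∧ pre a (Nat.log 2 v) = v).card

/-- The answer to a query at the node `v`. -/
noncomputable def truth (n : ℕ) (L : List ℕ) (v : ℕ) : Bool := decide (cnt n L v ≠ 0)

theorem cnt_one (L : List ℕ) : cnt n L 1 = solCount n L := by
  classical
  simp [cnt, solCount, pre]

theorem log_two_mul {v : ℕ} (hv : v ≠ 0) : Nat.log 2 (2 * v) = Nat.log 2 v + 1 := by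
  rw [mul_comm]; exact Nat.log_mul_base (by norm_num) hv

theorem log_two_mul_add_one {v : ℕ} (hv : v ≠ 0) : Nat.log 2 (2 * v + 1) = Nat.log 2 v + 1 := by
  rw [Nat.log_of_one_lt_of_le (by norm_num) (by omega)]
  congr 2; omega

theorem cnt_split {L : List ℕ} {v : ℕ} (hv : v ≠ 0) :
    cnt n L v = cnt n L (2 * v) + cnt n L (2 * v + 1) := by
  classical
  rw [cnt, cnt, cnt, log_two_mul hv, log_two_mul_add_one hv, ← Finset.card_union_of_disjoint]
  · congr 1
    ext a
    simp only [Finset.mem_filter, Finset.mem_univ, true_and, Finset.mem_union]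
    rw [← and_or_left]
    simp only [pre]
    refine and_congr_right fun _ => ?_
    cases value a (Nat.log 2 v) <;> simp <;> omega
  · rw [Finset.disjoint_left]
    intro a h h'
    simp only [Finset.mem_filter] at h h'
    omega

theorem cnt_leaf {L : List ℕ} {v : ℕ} (hv : Nat.log 2 v = n) : cnt n L v ≤ 1 := by
  classical
  rw [cnt, Finset.card_le_one]
  intro a ha b hb
  simp only [Finset.mem_filter, hv] at ha hb
  exact pre_injective (ha.2.2.trans hb.2.2.symm)

/-- The number of queries at the nodes of the subtree of height `h` at `v`. -/
noncomputable def cost (n : ℕ) (L : List ℕ) : ℕ → ℕ → ℕ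
  | 0, _ => 1
  | h + 1, v => if cnt n L v = 0 then 1 else cost n L h (2 * v) + cost n L h (2 * v + 1) + 1

/-- Every query except that at the starting node is caused by a parent with a solution below it, and
each such parent causes two. Each solution has at most `h` ancestors above the leaves. -/
theorem cost_le (L : List ℕ) (h : ℕ) {v : ℕ} (hv : v ≠ 0) :
    cost n L h v ≤ 1 + 2 * h * cnt n L v := by
  induction h generalizing v with
  | zero => simp [cost]
  | succ h ih =>
    rw [cost]; split_ifs with h0
    · omega
    · have h1 := ih (v := 2 * v) (by omega)
      have h2 := ih (v := 2 * v + 1) (by omega)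
      have h3 := cnt_split (n := n) (L := L) hv
      have h4 : 1 ≤ cnt n L v := by omega
      calc _ ≤ 1 + 2 * h * cnt n L (2 * v) + (1 + 2 * h * cnt n L (2 * v + 1)) + 1 := by omega
        _ = 3 + 2 * h * cnt n L v := by rw [h3]; ring
        _ ≤ _ := by nlinarith

theorem cost_pos (L : List ℕ) (h v : ℕ) : 0 < cost n L h v := by
  cases h with
  | zero => simp [cost]
  | succ h => rw [cost]; split_ifs <;> omega

theorem dfs_step {q : ℕ → PMF Bool} {b : Bool} {v : ℕ} (hv : v ≠ 0) (hq : q v = PMF.pure b)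
    (φ S : ℕ) : dfs n q (φ + 1) v S = dfs n q φ (nextNode n b v) (S + leafHit n b v) := by
  rw [dfs, if_neg hv, hq, PMF.pure_bind]

/-- The two parts must be proved together: with enough queries for the subtree the search leaves it
with the exact count, and with too few it ends with no query left. The second part for a node uses
the first part for its left child. -/
theorem dfs_truth (L : List ℕ) (h : ℕ) : ∀ v, v ≠ 0 → Nat.log 2 v + h = n →
    (∀ φ S, dfs n (fun v => PMF.pure (truth n L v)) (φ + cost n L h v) v S =
      dfs n (fun v => PMF.pure (truth n L v)) φ (adv v) (S + cnt n L v)) ∧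
    (∀ φ S, φ < cost n L h v →
      ∃ S', dfs n (fun v => PMF.pure (truth n L v)) φ v S = PMF.pure (0, S')) := by
  set q : ℕ → PMF Bool := fun v => PMF.pure (truth n L v)
  induction h with
  | zero =>
    intro v hv hlog
    have hn : 2 ^ n ≤ v := by
      rw [← Nat.le_log_iff_pow_le (by norm_num) hv]; omega
    refine ⟨fun φ S => ?_, fun φ S hφ => ?_⟩
    · rw [cost, dfs_step hv (b := truth n L v) rfl]
      have h1 := cnt_leaf (n := n) (L := L) (v := v) (by omega)
      congr 1
      · simp [nextNode, hn]
      · congr 1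
        simp only [leafHit, truth, hn, and_true, decide_eq_true_eq]
        split_ifs <;> omega
    · obtain rfl : φ = 0 := by simpa [cost] using hφ
      exact ⟨S, rfl⟩
  | succ h ih =>
    intro v hv hlog
    have hn : v < 2 ^ n := by
      rw [← Nat.log_lt_iff_lt_pow (by norm_num) hv]; omega
    obtain ⟨a1, b1⟩ := ih (2 * v) (by omega) (by rw [log_two_mul hv]; omega)
    obtain ⟨a2, b2⟩ := ih (2 * v + 1) (by omega) (by rw [log_two_mul_add_one hv]; omega)
    have hleaf : ∀ b, leafHit n b v = 0 := fun b => if_neg (by omega)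
    by_cases h0 : cnt n L v = 0
    · have hb : truth n L v = false := by simp [truth, h0]
      rw [cost, if_pos h0, h0]
      refine ⟨fun φ S => ?_, fun φ S hφ => ?_⟩
      · rw [dfs_step hv (b := truth n L v) rfl, hleaf, hb]; simp [nextNode]
      · obtain rfl : φ = 0 := by omega
        exact ⟨S, rfl⟩
    · have hb : truth n L v = true := by simp [truth, h0]
      have hnext : nextNode n true v = 2 * v := by simp [nextNode, hn]
      rw [cost, if_neg h0]
      refine ⟨fun φ S => ?_, fun φ S hφ => ?_⟩
      · rw [show φ + (cost n L h (2 * v) + cost n L h (2 * v + 1) + 1) =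
          φ + cost n L h (2 * v + 1) + cost n L h (2 * v) + 1 by ring,
          dfs_step hv (b := truth n L v) rfl, hleaf, hb, hnext, a1,
          adv_two_mul (Nat.pos_of_ne_zero hv), a2, adv_two_mul_add_one, cnt_split hv,
          add_zero, add_assoc]
      · cases φ with
        | zero => exact ⟨S, rfl⟩
        | succ φ =>
          rw [dfs_step hv (b := truth n L v) rfl, hleaf, hb, hnext]
          rcases Nat.lt_or_ge φ (cost n L h (2 * v)) with h1 | h1
          · exact b1 _ _ h1
          · obtain ⟨φ', rfl⟩ := Nat.exists_eq_add_of_le' h1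
            rw [a1, adv_two_mul (Nat.pos_of_ne_zero hv)]
            exact b2 _ _ (by omega)

theorem dfs_root (L : List ℕ) :
    (∀ φ S, dfs n (fun v => PMF.pure (truth n L v)) (φ + cost n L n 1) 1 S =
      PMF.pure (φ, S + solCount n L)) ∧
    (∀ φ S, φ < cost n L n 1 →
      ∃ S', dfs n (fun v => PMF.pure (truth n L v)) φ 1 S = PMF.pure (0, S')) := by
  obtain ⟨h1, h2⟩ := dfs_truth (n := n) L n 1 one_ne_zero (by simp)
  refine ⟨fun φ S => ?_, h2⟩
  rw [h1, adv_one, cnt_one]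
  cases φ <;> simp [dfs]

end SATCount

/-! ### Sums of independent counts -/

namespace SATCount

variable {α β : Type} {n : ℕ}

/-- Run `i` independent trials, and add up the queries needed and the solutions found. -/
noncomputable def sums (n s m : ℕ) (L₀ : List ℕ) : ℕ → ℕ × ℕ → PMF (ℕ × ℕ)
  | 0, p => PMF.pure p
  | i + 1, p => (hash n s m L₀).bind fun L =>
      sums n s m L₀ i (p.1 + cost n L n 1, p.2 + solCount n L)

/-- The search with correct answers to the queries. -/
noncomputable def idealTrials (n s m : ℕ) : List ℕ → ℕ → ℕ × ℕ → PMF (ℕ × ℕ) :=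
  trials n s m fun L v => PMF.pure (truth n L v)

/-- A coupling of the search with bounded budget and unbounded independent trials: as long as the
total cost is below `Φ` the counts agree, and afterwards the budget is `0` in both. Then the partial
count is meaningless, hence the requirement on `φ 0`. -/
theorem ex_idealTrials (s m Φ : ℕ) (L₀ : List ℕ) (φ : ℕ → ℕ → ℝ≥0∞) (hφ : ∀ S S', φ 0 S = φ 0 S')
    (i : ℕ) : ∀ p c : ℕ × ℕ, p.1 = Φ - c.1 → (c.1 < Φ → p.2 = c.2) →
      ex (idealTrials n s m L₀ i p) (fun p => φ p.1 p.2) =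
        ex (sums n s m L₀ i c) fun c => φ (Φ - c.1) c.2 := by
  induction i with
  | zero =>
    intro p c h1 h2
    simp only [idealTrials, trials, sums, ex_pure, h1]
    by_cases h : c.1 < Φ
    · rw [h2 h]
    · rw [Nat.sub_eq_zero_of_le (by omega)]; exact hφ _ _
  | succ i ih =>
    intro p c h1 h2
    simp only [idealTrials] at ih
    simp only [idealTrials, trials, sums, PMF.bind_bind]
    rw [ex_bind, ex_bind]
    congr 1; funext L
    obtain ⟨d1, d2⟩ := dfs_root (n := n) L
    have hc := cost_pos (n := n) L n 1
    rcases Nat.lt_or_ge p.1 (cost n L n 1) with h | h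
    · obtain ⟨S', hS'⟩ := d2 p.1 p.2 h
      rw [hS', PMF.pure_bind]
      exact ih _ _ (by simp only; omega) (by simp only; omega)
    · obtain ⟨p', hp'⟩ := Nat.exists_eq_add_of_le' h
      rw [hp', d1, PMF.pure_bind]
      exact ih _ _ (by simp only; omega) (by simp only; omega)

/-- The sum of `cost_le` over all trials, valid for every outcome: an accurate total count alone
therefore bounds the total number of queries. -/
theorem sums_support (s m : ℕ) (L₀ : List ℕ) (i : ℕ) : ∀ p, ∀ c ∈ (sums n s m L₀ i p).support,
    c.1 + 2 * n * p.2 ≤ p.1 + i + 2 * n * c.2 := by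
  induction i with
  | zero =>
    intro p c hc
    simp only [sums, PMF.support_pure, Set.mem_singleton_iff] at hc
    subst hc; omega
  | succ i ih =>
    intro p c hc
    simp only [sums, PMF.mem_support_bind_iff] at hc
    obtain ⟨L, -, hc⟩ := hc
    have h1 := ih _ c hc
    have h2 := cost_le (n := n) L n one_ne_zero
    rw [cnt_one] at h2
    simp only [mul_add] at h1
    omega

theorem ex_sums (s m : ℕ) (L₀ : List ℕ) {μ : ℝ≥0∞}
    (hμ : ex (hash n s m L₀) (fun L => (solCount n L : ℝ≥0∞)) = μ) (i : ℕ) (p : ℕ × ℕ) :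
    ex (sums n s m L₀ i p) (fun c => (c.2 : ℝ≥0∞)) = p.2 + i * μ := by
  induction i generalizing p with
  | zero => simp [sums]
  | succ i ih =>
    rw [sums, ex_bind]
    simp only [ih, Nat.cast_add]
    rw [ex_add, ex_add, ex_const, ex_const, hμ]; push_cast; ring

/-- Additivity of the variance for independent trials, with the second moment `v` in the place of
the variance of one trial. -/
theorem ex_sums_sq (s m : ℕ) (L₀ : List ℕ) {μ v : ℝ≥0∞}
    (hμ : ex (hash n s m L₀) (fun L => (solCount n L : ℝ≥0∞)) = μ)
    (hv : ex (hash n s m L₀) (fun L => (solCount n L : ℝ≥0∞) ^ 2) ≤ v) (i : ℕ) (p : ℕ × ℕ) :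
    ex (sums n s m L₀ i p) (fun c => (c.2 : ℝ≥0∞) ^ 2) ≤ i * v + (p.2 + i * μ) ^ 2 := by
  induction i generalizing p with
  | zero => simp [sums]
  | succ i ih =>
    rw [sums, ex_bind]
    refine (ex_mono _ fun L => ih _).trans ?_
    have e : ∀ L, (i * v + ((p.2 + solCount n L : ℕ) + i * μ) ^ 2 : ℝ≥0∞) =
        (i * v + (p.2 + i * μ) ^ 2) + (2 * (p.2 + i * μ)) * solCount n L
          + (solCount n L : ℝ≥0∞) ^ 2 := by
      intro L; push_cast; ring
    simp only [e]
    rw [ex_add, ex_add, ex_const, ex_const_mul, hμ]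
    calc _ ≤ i * v + (p.2 + i * μ) ^ 2 + 2 * (p.2 + i * μ) * μ + v := by gcongr
      -- The extra `μ ^ 2` completes the square; it is the difference between second moment and
      -- variance, which is given away.
      _ ≤ i * v + (p.2 + i * μ) ^ 2 + 2 * (p.2 + i * μ) * μ + v + μ ^ 2 := le_self_add
      _ = _ := by push_cast; ring

/-- Chebyshev's inequality. -/
theorem chebyshev (f : PMF α) (Z : α → ℕ) {a v l : ℝ} (ha : 0 ≤ a) (hv : 0 ≤ v)
    (h1 : ex f (fun x => (Z x : ℝ≥0∞)) = ENNReal.ofReal a)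
    (h2 : ex f (fun x => (Z x : ℝ≥0∞) ^ 2) ≤ ENNReal.ofReal (v + a ^ 2)) :
    ENNReal.ofReal (l ^ 2) * ex f (ind fun x => l ^ 2 ≤ ((Z x : ℝ) - a) ^ 2) ≤
      ENNReal.ofReal v := by
  classical
  -- The expectation of the pointwise bound `l² 1[event] + 2 a Z ≤ Z² + a²`; in this form nothing is
  -- subtracted in `ℝ≥0∞` until the finite term at the end.
  have key : ENNReal.ofReal (l ^ 2) * ex f (ind fun x => l ^ 2 ≤ ((Z x : ℝ) - a) ^ 2) +
      ENNReal.ofReal (2 * a) * ENNReal.ofReal a ≤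
      ENNReal.ofReal (v + a ^ 2) + ENNReal.ofReal (a ^ 2) := by
    rw [← h1, ← ex_const_mul, ← ex_const_mul, ← ex_add]
    calc _ ≤ ex f (fun x => (Z x : ℝ≥0∞) ^ 2 + ENNReal.ofReal (a ^ 2)) := by
          refine ex_mono f fun x => ?_
          have e : (Z x : ℝ≥0∞) = ENNReal.ofReal (Z x) := (ENNReal.ofReal_natCast _).symm
          rw [e, ← ENNReal.ofReal_mul (by positivity), ← ENNReal.ofReal_pow (by positivity),
            ← ENNReal.ofReal_add (by positivity) (by positivity), ind_apply]
          split_ifs with h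
          · rw [mul_one, ← ENNReal.ofReal_add (by positivity) (by positivity)]
            exact ENNReal.ofReal_le_ofReal (by nlinarith)
          · rw [mul_zero, zero_add]
            exact ENNReal.ofReal_le_ofReal (by nlinarith [sq_nonneg ((Z x : ℝ) - a)])
      _ ≤ _ := by rw [ex_add, ex_const]; gcongr
  rw [← ENNReal.ofReal_mul (by positivity), ← ENNReal.ofReal_add (by positivity) (by positivity),
    show v + a ^ 2 + a ^ 2 = v + 2 * a * a by ring, ENNReal.ofReal_add hv (by positivity)] at key
  exact (ENNReal.add_le_add_iff_right ENNReal.ofReal_ne_top).1 key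

/-! ### The success probability of one level -/

/-- `S` is a good estimate of the number of solutions in `t` trials with expectation `μ`. -/
def GoodEst (d t : ℕ) (μ : ℝ) (S : ℕ) : Prop := |(S : ℝ) - t * μ| * 2 ^ d ≤ t * μ

/-- Chebyshev's inequality with deviation `t μ / 2^d`: the second moments sum to at most `t V μ²`,
and the quotient is `V 4^d / t`. This determines the number of trials. -/
theorem sums_good {s m t d : ℕ} {L₀ : List ℕ} {μ V : ℝ} (ht : 0 < t) (hμ0 : 0 < μ) (hV : 0 ≤ V)
    (hμ : ex (hash n s m L₀) (fun L => (solCount n L : ℝ≥0∞)) = ENNReal.ofReal μ)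
    (hv : ex (hash n s m L₀) (fun L => (solCount n L : ℝ≥0∞) ^ 2) ≤ ENNReal.ofReal (V * μ ^ 2)) :
    ex (sums n s m L₀ t (0, 0)) (ind fun c => ¬ GoodEst d t μ c.2) ≤
      ENNReal.ofReal (V * 4 ^ d / t) := by
  classical
  have ht' : (0 : ℝ) < t := by exact_mod_cast ht
  have e1 := ex_sums s m L₀ hμ t (0, 0)
  have e2 := ex_sums_sq s m L₀ hμ hv t (0, 0)
  simp only [CharP.cast_eq_zero, zero_add] at e1 e2
  have e3 : (t : ℝ≥0∞) * ENNReal.ofReal μ = ENNReal.ofReal (t * μ) := by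
    rw [ENNReal.ofReal_mul (by positivity), ENNReal.ofReal_natCast]
  have e4 : (t : ℝ≥0∞) * ENNReal.ofReal (V * μ ^ 2) = ENNReal.ofReal (t * (V * μ ^ 2)) := by
    rw [ENNReal.ofReal_mul (p := (t : ℝ)) (by positivity), ENNReal.ofReal_natCast]
  rw [e3] at e1 e2
  rw [e4, ← ENNReal.ofReal_pow (by positivity),
    ← ENNReal.ofReal_add (by positivity) (by positivity)] at e2
  have hl : (0 : ℝ) < (t * μ / 2 ^ d) ^ 2 := by positivity
  have h := chebyshev (l := t * μ / 2 ^ d) _ (fun c : ℕ × ℕ => c.2) (by positivity)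
    (by positivity) e1 e2
  have hmono : ex (sums n s m L₀ t (0, 0)) (ind fun c => ¬ GoodEst d t μ c.2) ≤
      ex (sums n s m L₀ t (0, 0)) (ind fun c => (t * μ / 2 ^ d) ^ 2 ≤ ((c.2 : ℝ) - t * μ) ^ 2) := by
    refine ex_mono _ fun c => ?_
    by_cases hg : GoodEst d t μ c.2
    · rw [ind_of_not (by simpa using hg)]; exact zero_le
    · rw [ind_of (p := fun c : ℕ × ℕ => ¬ GoodEst d t μ c.2) hg, ind_of]
      rw [GoodEst, not_le] at hg
      rw [← sq_abs ((c.2 : ℝ) - t * μ)]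
      refine pow_le_pow_left₀ (by positivity) ?_ 2
      rw [div_le_iff₀ (by positivity)]; exact hg.le
  refine hmono.trans ?_
  rw [mul_comm, ← ENNReal.le_div_iff_mul_le (Or.inl (by rw [ne_eq, ENNReal.ofReal_eq_zero, not_le]; exact hl))
    (Or.inl ENNReal.ofReal_ne_top), ← ENNReal.ofReal_div_of_pos hl] at h
  refine h.trans (ENNReal.ofReal_le_ofReal (le_of_eq ?_))
  have : (4 : ℝ) ^ d = (2 ^ d) ^ 2 := by rw [← pow_mul, mul_comm, pow_mul]; norm_num
  rw [this]; field_simp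

theorem ex_solCount_of (s m : ℕ) (L : List ℕ) (h : 0 < n ∨ m = 0) :
    ex (hash n s m L) (fun L' => (solCount n L' : ℝ≥0∞)) =
      ENNReal.ofReal (solCount n L * satProb s ^ m) := by
  rcases h with h | rfl
  · exact ex_solCount h s m L
  · simp [hash]

theorem exists_width_of {γ : ℝ} (hγ : 0 < γ) : ∃ s : ℕ, 1 ≤ s ∧ ∀ (n m : ℕ) (L : List ℕ),
    m ≤ n * 2 ^ s → 1 ≤ (solCount n L : ℝ) * satProb s ^ m →
      ex (hash n s m L) (fun L' => (solCount n L' : ℝ≥0∞) ^ 2) ≤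
        ENNReal.ofReal (2 * 2 ^ (γ * n) * (solCount n L * satProb s ^ m) ^ 2) := by
  obtain ⟨s, hs, h⟩ := exists_width hγ
  refine ⟨s, hs, fun n m L hm h1 => ?_⟩
  rcases Nat.eq_zero_or_pos n with rfl | hn
  · obtain rfl : m = 0 := by simpa using hm
    simp only [hash, ex_pure, pow_zero, mul_one, Nat.cast_zero, mul_zero, Real.rpow_zero]
    rw [← ENNReal.ofReal_natCast, ← ENNReal.ofReal_pow (by positivity)]
    refine ENNReal.ofReal_le_ofReal ?_
    nlinarith [sq_nonneg (solCount 0 L : ℝ)]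
  · exact h n hn m L hm h1

/-- A number of clauses for which about one solution is left. -/
theorem exists_level {s : ℕ} (hs : 1 ≤ s) (L : List ℕ) (hN : 0 < solCount n L) :
    ∃ m ≤ n * 2 ^ s, (solCount n L : ℝ) * satProb s ^ m ≤ 2 ∧
      ∀ i ≤ m, 1 ≤ (solCount n L : ℝ) * satProb s ^ i := by
  classical
  have hp := half_le_satProb hs
  have hp1 : satProb s < 1 := by rw [satProb]; simp
  set p := satProb s
  have hN' : (1 : ℝ) ≤ solCount n L := by exact_mod_cast hN
  -- Since `p ^ 2 ^ s ≤ 1/e ≤ 1/2`, after `n * 2 ^ s` clauses at most one of the at most `2 ^ n`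
  -- solutions is left on average; one further clause makes the inequality strict.
  have hex : (solCount n L : ℝ) * p ^ (n * 2 ^ s + 1) < 1 := by
    have h1 : p ^ 2 ^ s ≤ 2⁻¹ := by
      have h2 : p ≤ Real.exp (-(2⁻¹) ^ s) := by
        have := Real.add_one_le_exp (-(2⁻¹ : ℝ) ^ s)
        simp only [p, satProb]; linarith
      have h3 : p ^ 2 ^ s ≤ Real.exp (-1) := by
        refine (pow_le_pow_left₀ (by linarith) h2 _).trans (le_of_eq ?_)
        rw [← Real.exp_nat_mul]; congr 1; push_cast
        rw [mul_neg, ← mul_pow]; norm_num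
      refine h3.trans ?_
      rw [Real.exp_neg]
      exact inv_anti₀ (by norm_num) (by have := Real.add_one_le_exp (1 : ℝ); linarith)
    have h2 : (solCount n L : ℝ) ≤ 2 ^ n := by exact_mod_cast solCount_le L
    have h3 : p ^ (n * 2 ^ s) ≤ (2⁻¹) ^ n := by
      rw [mul_comm, pow_mul]; exact pow_le_pow_left₀ (by positivity) h1 n
    have h4 : (solCount n L : ℝ) * p ^ (n * 2 ^ s) ≤ 1 := by
      calc _ ≤ (2 : ℝ) ^ n * (2⁻¹) ^ n := by gcongr
        _ = 1 := by rw [← mul_pow]; norm_num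
    rw [pow_succ, ← mul_assoc]
    have : 0 ≤ (solCount n L : ℝ) * p ^ (n * 2 ^ s) := by positivity
    nlinarith
  have hex' : ∃ m, (solCount n L : ℝ) * p ^ (m + 1) < 1 := ⟨_, hex⟩
  -- For the first level whose successor drops below `1`, minimality gives the lower bounds up to
  -- this level, and `p ≥ 1/2` gives the upper bound `2`.
  refine ⟨Nat.find hex', Nat.find_min' hex' hex, ?_, ?_⟩
  · have := Nat.find_spec hex'
    rw [pow_succ, ← mul_assoc] at this
    have h0 : 0 ≤ (solCount n L : ℝ) * p ^ Nat.find hex' := by positivity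
    nlinarith
  · intro i hi
    cases i with
    | zero => simpa using hN'
    | succ i => exact not_lt.1 (Nat.find_min hex' (by omega))

/-! ### The success probability of the algorithm -/

/-- A union bound over the levels up to `M`. Before `M` it is harmless to run out of queries, and
only a completed wrong count is a failure; at `M` running out is a failure as well. Nothing is
required beyond `M`. -/
theorem ex_levels {lv : ℕ → PMF (ℕ × ℕ)} {G : ℕ → ℕ → Prop} {η : ℝ≥0∞} {M : ℕ} (k : ℕ) :
    ∀ m j, m + k = M → k < j →
      (∀ i, m ≤ i → i < M → ex (lv i) (ind fun p => p.1 ≠ 0 ∧ ¬ G i p.2) ≤ η) →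
      ex (lv M) (ind fun p => p.1 = 0 ∨ ¬ G M p.2) ≤ η →
      ex (levels lv j m) (ind fun p => ¬ G p.1 p.2) ≤ (k + 1) * η := by
  classical
  induction k with
  | zero =>
    intro m j hm hj _ hM
    obtain ⟨j, rfl⟩ : ∃ i, j = i + 1 := ⟨j - 1, by omega⟩
    obtain rfl : m = M := by omega
    rw [levels, ex_bind]
    refine (ex_mono _ fun p => ?_).trans (hM.trans (by simp))
    split_ifs with h
    · rw [ind_of (p := fun p : ℕ × ℕ => p.1 = 0 ∨ ¬ G m p.2) (Or.inl h)]
      exact ex_le_one _ fun _ => ind_le_one _ _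
    · rw [ex_pure, ind_apply, ind_apply]
      split_ifs <;> simp_all
  | succ k ih =>
    intro m j hm hj h hM
    obtain ⟨j, rfl⟩ : ∃ i, j = i + 1 := ⟨j - 1, by omega⟩
    rw [levels, ex_bind]
    have h1 := ih (m + 1) j (by omega) (by omega) (fun i hi => h i (by omega)) hM
    have h2 := h m le_rfl (by omega)
    calc _ ≤ ex (lv m) (fun p => ind (fun p : ℕ × ℕ => p.1 ≠ 0 ∧ ¬ G m p.2) p + (k + 1) * η) := by
          refine ex_mono _ fun p => ?_
          split_ifs with hp
          · exact h1.trans le_add_self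
          · rw [ex_pure]
            refine le_trans ?_ le_self_add
            rw [ind_apply, ind_apply]
            split_ifs <;> simp_all
      _ ≤ η + (k + 1) * η := by rw [ex_add, ex_const]; gcongr
      _ = _ := by push_cast; ring

/-! ### Replacing correct answers by majority answers -/

theorem close_levels {lv lv' : ℕ → PMF (ℕ × ℕ)} {e : ℝ≥0∞} (j : ℕ) :
    ∀ m, (∀ i < m + j, Close e (lv i) (lv' i)) → Close (j * e) (levels lv j m) (levels lv' j m) := by
  induction j with
  | zero => intro m _; exact Close.refl _ _
  | succ j ih =>
    intro m h
    refine (Close.bind (h m (by omega)) (e' := j * e) fun p _ => ?_).mono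
      (by push_cast; ring_nf; rfl)
    split_ifs
    · exact ih _ fun i hi => h i (by omega)
    · exact Close.refl _ _

/-- Each unit of budget pays for one query and contributes one error. The bound on `v` is kept by
`nextNode_lt`, so closeness is needed only at nodes of the tree. -/
theorem close_dfs {q q' : ℕ → PMF Bool} {e : ℝ≥0∞}
    (h : ∀ v, v ≠ 0 → v < 2 ^ (n + 1) → Close e (q v) (q' v)) (φ : ℕ) :
    ∀ v S, v < 2 ^ (n + 1) → Close (φ * e) (dfs n q φ v S) (dfs n q' φ v S) := by
  induction φ with
  | zero => intro v S _; exact Close.refl _ _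
  | succ φ ih =>
    intro v S hv
    rw [dfs, dfs]
    split_ifs with h0
    · exact Close.refl _ _
    · refine (Close.bind (h v h0 hv) (e' := φ * e) fun b _ => ih _ _ (nextNode_lt b hv)).mono ?_
      push_cast; ring_nf; rfl

theorem dfs_fuel_le (q : ℕ → PMF Bool) (φ : ℕ) :
    ∀ v S, ∀ p ∈ (dfs n q φ v S).support, p.1 ≤ φ := by
  induction φ with
  | zero => intro v S p hp; simp only [dfs, PMF.support_pure, Set.mem_singleton_iff] at hp; simp [hp]
  | succ φ ih =>
    intro v S p hp
    rw [dfs] at hp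
    split_ifs at hp
    · simp only [PMF.support_pure, Set.mem_singleton_iff] at hp; simp [hp]
    · obtain ⟨b, -, hb⟩ := (PMF.mem_support_bind_iff _ _ _).1 hp
      exact (ih _ _ p hb).trans (by omega)

/-- Each of the `i` trials is charged the full budget `Φ`. Sharing the budget would save the factor
`i`, but the error of one query is exponentially small and the loss does not matter. -/
theorem close_trials {s m : ℕ} {L₀ : List ℕ} {q q' : List ℕ → ℕ → PMF Bool} {e : ℝ≥0∞} {Φ : ℕ}
    (h : ∀ L ∈ (hash n s m L₀).support, ∀ v, v ≠ 0 → v < 2 ^ (n + 1) → Close e (q L v) (q' L v))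
    (i : ℕ) : ∀ p : ℕ × ℕ, p.1 ≤ Φ →
      Close (i * (Φ * e)) (trials n s m q L₀ i p) (trials n s m q' L₀ i p) := by
  induction i with
  | zero => intro p _; exact Close.refl _ _
  | succ i ih =>
    intro p hp
    rw [trials, trials]
    refine (Close.bind (e := Φ * e) (e' := i * (Φ * e)) ?_ fun p' hp' => ih p' ?_).mono ?_
    · refine Close.bind_right _ fun L hL => ?_
      refine (close_dfs (h L hL) p.1 1 p.2 (Nat.one_lt_two_pow (by omega))).mono ?_
      gcongr
    · obtain ⟨L, -, hL⟩ := (PMF.mem_support_bind_iff _ _ _).1 hp'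
      exact (dfs_fuel_le _ _ _ _ _ hL).trans hp
    · push_cast; ring_nf; rfl

theorem randMask_support {n : ℕ} (hn : 0 < n) (j acc : ℕ) : ∀ M ∈ (randMask n j acc).support,
    ∃ ls : List ℕ, ls.length = j ∧ (∀ l ∈ ls, l < 2 * n) ∧ M = orMask acc ls := by
  induction j generalizing acc with
  | zero =>
    intro M hM
    simp only [randMask, PMF.support_pure, Set.mem_singleton_iff] at hM
    exact ⟨[], rfl, by simp, hM⟩
  | succ j ih =>
    intro M hM
    rw [randMask, PMF.mem_support_bind_iff] at hM
    obtain ⟨l, hl, hM⟩ := hM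
    obtain ⟨ls, h1, h2, rfl⟩ := ih _ M hM
    refine ⟨l :: ls, by simp [h1], ?_, rfl⟩
    simp only [List.mem_cons, forall_eq_or_imp]
    refine ⟨?_, h2⟩
    rw [randLit, PMF.mem_support_bind_iff] at hl
    obtain ⟨x, -, hx⟩ := hl
    rw [PMF.support_map] at hx
    obtain ⟨b, -, rfl⟩ := hx
    have := Nat.mod_lt x hn
    cases b <;> simp <;> omega

/-- A list of distinct clauses with at most `K` literals in `n` variables. -/
def ValidList (n K : ℕ) (L : List ℕ) : Prop := L.Nodup ∧ ∀ M ∈ L, ValidMask n K M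

/-- Without variables there are no literals to draw, so for `n = 0` no clause may be added. The
prefix relation serves the program, which keeps the original clauses at the front of its array. -/
theorem hash_support {s K m : ℕ} (hs : s ≤ K) (h : 0 < n ∨ m = 0) :
    ∀ L₀, ValidList n K L₀ → ∀ L ∈ (hash n s m L₀).support,
      ValidList n K L ∧ L.length ≤ L₀.length + m ∧ L₀ <+: L := by
  induction m with
  | zero =>
    intro L₀ h₀ L hL
    simp only [hash, PMF.support_pure, Set.mem_singleton_iff] at hL
    subst hL; exact ⟨h₀, by simp, List.prefix_rfl⟩
  | succ m ih =>
    intro L₀ h₀ L hL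
    have hn : 0 < n := by simpa using h
    rw [hash, PMF.mem_support_bind_iff] at hL
    obtain ⟨M, hM, hL⟩ := hL
    obtain ⟨ls, h1, h2, rfl⟩ := randMask_support hn s 0 M hM
    have hv : ValidMask n K (orMask 0 ls) := validMask_orMask (by omega) h2
    obtain ⟨h3, h4, h5⟩ := ih (Or.inl hn) (addMask L₀ (orMask 0 ls)) ⟨nodup_addMask h₀.1, by
      intro M hM
      rcases mem_addMask.1 hM with hM | rfl
      exacts [h₀.2 M hM, hv]⟩ L hL
    have h6 := length_addMask L₀ (orMask 0 ls)
    exact ⟨h3, by omega, (prefix_addMask _ _).trans h5⟩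

/-- `O` decides with probability at least `2 / 3` whether a list of clauses is satisfiable. -/
def Decides (n K : ℕ) (O : List ℕ → PMF Bool) : Prop := ∀ L, ValidList n K L →
  ∀ b : Bool, (b = true ↔ ∃ a : Fin n → Bool, Sat L a) → 2 / 3 ≤ O L b

/-- The solutions with prefix `v` are the solutions of the list extended by unit clauses, which have
width `1 ≤ K`; so the oracle applies to this list. -/
theorem close_query {K r : ℕ} {O : List ℕ → PMF Bool} (hO : Decides n K O) (hK : 1 ≤ K)
    {L : List ℕ} (hL : ValidList n K L) {v : ℕ} (hv : v ≠ 0) (hv' : v < 2 ^ (n + 1)) :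
    Close (ENNReal.ofReal ((8 / 9) ^ r)) (query O (2 * r) L v) (PMF.pure (truth n L v)) := by
  classical
  refine close_pure (majority_error _ _ (hO _ ⟨nodup_addPrefix hL.1, ?_⟩ _ ?_) r)
  · exact valid_addPrefix (by have := Nat.log_lt_of_lt_pow hv hv'; omega) hK hL.2
  · have hlog : Nat.log 2 v ≤ n := by have := Nat.log_lt_of_lt_pow hv hv'; omega
    simp only [sat_addPrefix hlog (Nat.pow_log_le_self 2 hv) (Nat.lt_pow_succ_log_self (by norm_num) v)]
    simp [truth, cnt, Finset.card_eq_zero, Finset.filter_eq_empty_iff]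

end SATCount

/-! ### Success probability of the search over all levels -/

namespace SATCount

variable {n : ℕ}

/-- Even at precision `d = 0` an estimate is off by at most a factor `2` upwards, so `S ≤ 2 t μ`. -/
theorem GoodEst.le {d t S : ℕ} {μ : ℝ} (ht : 0 < t) (hμ : μ ≤ 2)
    (h : GoodEst d t μ S) : S ≤ 4 * t := by
  have h1 : |(S : ℝ) - t * μ| * 1 ≤ |(S : ℝ) - t * μ| * 2 ^ d := by
    gcongr; exact one_le_pow₀ (by norm_num)
  have h2 := (le_abs_self _).trans ((mul_one _).symm.le.trans (h1.trans h))
  have ht' : (0 : ℝ) < t := by exact_mod_cast ht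
  have : (S : ℝ) ≤ 4 * t := by nlinarith
  exact_mod_cast this

/-- An unsatisfiable list has no level of mean at least `1`. There `M = 0` works: the expected total
is `0`, so the count is `0` almost surely and the estimate is exact. -/
theorem sums_good_level {γ : ℝ} {s : ℕ} (hs : 1 ≤ s)
    (hwidth : ∀ (m : ℕ) (L : List ℕ), m ≤ n * 2 ^ s → 1 ≤ (solCount n L : ℝ) * satProb s ^ m →
      ex (hash n s m L) (fun L' => (solCount n L' : ℝ≥0∞) ^ 2) ≤
        ENNReal.ofReal (2 * 2 ^ (γ * n) * (solCount n L * satProb s ^ m) ^ 2))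
    {d t : ℕ} (ht : 0 < t) (L : List ℕ) : ∃ M ≤ n * 2 ^ s,
      (solCount n L : ℝ) * satProb s ^ M ≤ 2 ∧ ∀ m ≤ M,
      ex (sums n s m L t (0, 0)) (ind fun c =>
        ¬ GoodEst d t (solCount n L * satProb s ^ m) c.2) ≤
        ENNReal.ofReal (2 * 2 ^ (γ * n) * 4 ^ d / t) := by
  rcases Nat.eq_zero_or_pos (solCount n L) with h0 | hN
  · refine ⟨0, by omega, by simp [h0], fun m hm => ?_⟩
    obtain rfl : m = 0 := by omega
    have e := ex_sums s 0 L (ex_solCount_of (n := n) s 0 L (Or.inr rfl)) t (0, 0)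
    simp only [h0, CharP.cast_eq_zero, zero_mul, ENNReal.ofReal_zero, mul_zero, add_zero] at e
    refine le_trans (le_of_eq_of_le ?_ zero_le) zero_le
    rw [← nonpos_iff_eq_zero, ← e]
    refine ex_mono _ fun c => ?_
    rw [h0, Nat.cast_zero, zero_mul]
    by_cases hc : c.2 = 0
    · rw [ind_of_not (p := fun c : ℕ × ℕ => ¬ GoodEst d t 0 c.2)]
      · exact zero_le
      · simp [GoodEst, hc]
    · refine (ind_le_one _ _).trans ?_
      exact_mod_cast Nat.one_le_iff_ne_zero.2 hc
  · obtain ⟨M, hM, h2, h1⟩ := exists_level (n := n) hs L hN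
    refine ⟨M, hM, h2, fun m hm => ?_⟩
    have hn : 0 < n ∨ m = 0 := by
      rcases Nat.eq_zero_or_pos n with rfl | h
      · right; simp at hM; omega
      · exact Or.inl h
    exact sums_good ht (lt_of_lt_of_le one_pos (h1 m hm)) (by positivity)
      (ex_solCount_of s m L hn) (hwidth m L (hm.trans hM) (h1 m hm))

/-- The failure probability has two parts of `1/6` each: deviations of the counts under correct
answers, over at most `n 2^s + 1` levels (`h₁`), and wrong majority answers anywhere (`h₂`). -/
theorem levels_good {γ : ℝ} {s K : ℕ} (hs : 1 ≤ s) (hsK : s ≤ K)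
    (hwidth : ∀ (m : ℕ) (L : List ℕ), m ≤ n * 2 ^ s → 1 ≤ (solCount n L : ℝ) * satProb s ^ m →
      ex (hash n s m L) (fun L' => (solCount n L' : ℝ≥0∞) ^ 2) ≤
        ENNReal.ofReal (2 * 2 ^ (γ * n) * (solCount n L * satProb s ^ m) ^ 2))
    {O : List ℕ → PMF Bool} (hO : Decides n K O) {d t r : ℕ} (ht : 0 < t)
    {L₀ : List ℕ} (hL₀ : ValidList n K L₀)
    (h₁ : ((n * 2 ^ s + 1 : ℕ) : ℝ) * (2 * 2 ^ (γ * n) * 4 ^ d / t) ≤ 1 / 6)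
    (h₂ : ((n * 2 ^ s + 1 : ℕ) : ℝ) * (t * ((t * (8 * n + 2) : ℕ) * (8 / 9) ^ r)) ≤ 1 / 6) :
    ex (levels (fun m => trials n s m (query O (2 * r)) L₀ t (t * (8 * n + 2), 0))
      (n * 2 ^ s + 1) 0)
      (ind fun p => ¬ GoodEst d t (solCount n L₀ * satProb s ^ p.1) p.2) ≤ 1 / 3 := by
  classical
  set Φ := t * (8 * n + 2)
  set G : ℕ → ℕ → Prop := fun m S => GoodEst d t (solCount n L₀ * satProb s ^ m) S
  obtain ⟨M, hM, hM2, hgood⟩ := sums_good_level (d := d) hs hwidth ht L₀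
  set η := ENNReal.ofReal (2 * 2 ^ (γ * n) * 4 ^ d / t)
  set e := ENNReal.ofReal ((8 / 9) ^ r)
  set N := n * 2 ^ s + 1
  have hclose := close_levels (lv := fun m => trials n s m (query O (2 * r)) L₀ t (Φ, 0))
    (lv' := fun m => idealTrials n s m L₀ t (Φ, 0)) (e := t * (Φ * e)) N 0 (fun m hm =>
      close_trials (Φ := Φ) (fun L hL v hv hv' => close_query hO (hs.trans hsK)
        (hash_support hsK (by
          rcases Nat.eq_zero_or_pos n with rfl | h
          · right; simp [N] at hm; omega
          · exact Or.inl h) L₀ hL₀ L hL).1 hv hv') t (Φ, 0) le_rfl)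
  have hideal : ex (levels (fun m => idealTrials n s m L₀ t (Φ, 0)) N 0)
      (ind fun p => ¬ G p.1 p.2) ≤ (M + 1) * η := by
    refine ex_levels (M := M) (G := G) M 0 N (by omega) (by omega) (fun m _ hm => ?_) ?_
    · have h := ex_idealTrials (n := n) s m Φ L₀ (fun φ S => if φ = 0 then 0 else
        ind (fun S => ¬ G m S) S) (by simp) t (Φ, 0) (0, 0) (by simp) (by simp)
      calc _ ≤ ex (idealTrials n s m L₀ t (Φ, 0)) (fun p => if p.1 = 0 then 0 else
            ind (fun S => ¬ G m S) p.2) := by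
            refine ex_mono _ fun p => ?_
            rw [ind_apply, ind_apply]; split_ifs <;> simp_all
        _ ≤ ex (sums n s m L₀ t (0, 0)) (ind fun c => ¬ G m c.2) := by
            rw [h]
            refine ex_mono _ fun p => ?_
            rw [ind_apply, ind_apply]; split_ifs <;> simp_all
        _ ≤ η := hgood m hm.le
    · have h := ex_idealTrials (n := n) s M Φ L₀ (fun φ S => if φ = 0 then 1 else
        ind (fun S => ¬ G M S) S) (by simp) t (Φ, 0) (0, 0) (by simp) (by simp)
      calc _ ≤ ex (idealTrials n s M L₀ t (Φ, 0)) (fun p => if p.1 = 0 then 1 else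
            ind (fun S => ¬ G M S) p.2) := by
            refine ex_mono _ fun p => ?_
            rw [ind_apply, ind_apply]; split_ifs <;> simp_all
        _ ≤ ex (sums n s M L₀ t (0, 0)) (ind fun c => ¬ G M c.2) := by
            rw [h]
            refine ex_mono_support _ fun c hc => ?_
            have hsup := sums_support s M L₀ t (0, 0) c hc
            by_cases hG : G M c.2
            · have h4 := GoodEst.le ht hM2 hG
              have h5 : n * c.2 ≤ n * (4 * t) := Nat.mul_le_mul_left n h4
              -- A good estimate at level `M` has at most `4 t` solutions, hence costs at most `t +
              -- 2 n * 4 t = t (8 n + 1)`. The budget `t (8 n + 2)` is strictly larger, as required,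
              -- since an exhausted budget counts as failure.
              have h6 : c.1 < Φ := by
                have e1 : Φ = 8 * (n * t) + 2 * t := by simp only [Φ]; ring
                have e2 : n * (4 * t) = 4 * (n * t) := by ring
                simp only [mul_zero, zero_add, add_zero, mul_assoc] at hsup
                omega
              rw [if_neg (by omega), ind_apply, ind_apply]
            · rw [ind_of (p := fun c : ℕ × ℕ => ¬ G M c.2) hG]
              split_ifs
              · rfl
              · exact ind_le_one _ _
        _ ≤ η := hgood M le_rfl
  refine (hclose _ (ind_le_one _)).trans ?_
  have e1 : ((M : ℝ≥0∞) + 1) * η ≤ ENNReal.ofReal (1 / 6) := by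
    refine le_trans ?_ (ENNReal.ofReal_le_ofReal h₁)
    rw [ENNReal.ofReal_mul (by positivity), ENNReal.ofReal_natCast]
    gcongr
    exact_mod_cast (by omega : M + 1 ≤ N)
  have e2 : (N : ℝ≥0∞) * (t * (Φ * e)) ≤ ENNReal.ofReal (1 / 6) := by
    refine le_trans (le_of_eq ?_) (ENNReal.ofReal_le_ofReal h₂)
    rw [ENNReal.ofReal_mul (by positivity), ENNReal.ofReal_natCast,
      ENNReal.ofReal_mul (by positivity), ENNReal.ofReal_natCast,
      ENNReal.ofReal_mul (by positivity), ENNReal.ofReal_natCast]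
  calc _ ≤ ENNReal.ofReal (1 / 6) + ENNReal.ofReal (1 / 6) := add_le_add (hideal.trans e1) e2
    _ = 1 / 3 := by
      rw [← ENNReal.ofReal_add (by norm_num) (by norm_num),
        show (1 / 6 + 1 / 6 : ℝ) = 1 / 3 by norm_num,
        ENNReal.ofReal_div_of_pos (by norm_num)]
      simp

/-! ### Rounding -/

/-- The nearest integer to `S * (2 ^ s) ^ m / (t * (2 ^ s - 1) ^ m)`. -/
def output (s t m S : ℕ) : ℕ :=
  (2 * (S * (2 ^ s) ^ m) + t * (2 ^ s - 1) ^ m) / (2 * (t * (2 ^ s - 1) ^ m))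

/-- Rounding to the nearest integer recovers an integer at distance below `1/2` exactly; otherwise
the distance is at least `1/2`, and rounding moves by no more than that. So rounding at most doubles
the error. -/
theorem abs_round_sub_le {X D N : ℕ} (hD : 0 < D) :
    |(((2 * X + D) / (2 * D) : ℕ) : ℝ) - N| ≤ 2 * |(X : ℝ) / D - N| ∧
      (|(X : ℝ) / D - N| < 1 / 2 → (2 * X + D) / (2 * D) = N) := by
  set w := (2 * X + D) / (2 * D)
  have h1 : 2 * D * w ≤ 2 * X + D := Nat.mul_div_le _ _
  have h2 : 2 * X + D < 2 * D * (w + 1) := Nat.lt_mul_div_succ _ (by omega)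
  have hD' : (0 : ℝ) < D := by exact_mod_cast hD
  have h1' : (2 : ℝ) * D * w ≤ 2 * X + D := by exact_mod_cast h1
  have h2' : (2 : ℝ) * X + D < 2 * D * (w + 1) := by exact_mod_cast h2
  set y := (X : ℝ) / D
  have hX : (X : ℝ) = y * D := by simp only [y]; field_simp
  rw [hX] at h1' h2'
  have h3 : (w : ℝ) ≤ y + 1 / 2 := by
    by_contra hc; push Not at hc; nlinarith
  have h4 : y < w + 1 / 2 := by
    by_contra hc; push Not at hc; nlinarith
  have key : |y - N| < 1 / 2 → w = N := by
    intro h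
    rw [abs_lt] at h
    have h5 : (w : ℝ) < N + 1 := by linarith
    have h6 : (N : ℝ) < w + 1 := by linarith
    have h5' : w < N + 1 := by exact_mod_cast h5
    have h6' : N < w + 1 := by exact_mod_cast h6
    omega
  refine ⟨?_, key⟩
  by_cases h : |y - N| < 1 / 2
  · rw [key h]; simp
  · push Not at h
    have h5 : |(w : ℝ) - y| ≤ 1 / 2 := abs_le.2 ⟨by linarith, by linarith⟩
    calc |(w : ℝ) - N| = |((w : ℝ) - y) + (y - N)| := by ring_nf
      _ ≤ |(w : ℝ) - y| + |y - N| := abs_add_le _ _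
      _ ≤ _ := by linarith

/-- The unrounded estimate is off by at most `N / 2^d`. Either `2 / 2^d ≤ ε`, where the `2` pays for
rounding, or `d ≥ n + 2`, where the error is at most `1/4` because `N ≤ 2^n` and rounding returns
`N` itself. -/
theorem output_good {s t m S d N n : ℕ} {ε : ℝ} (hs : 1 ≤ s) (ht : 0 < t) (hN : N ≤ 2 ^ n)
    (h : GoodEst d t (N * satProb s ^ m) S) (hε : 2 / 2 ^ d ≤ ε ∨ n + 2 ≤ d) (hε0 : 0 ≤ ε) :
    |(output s t m S : ℝ) - N| ≤ ε * N := by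
  have hp := half_le_satProb hs
  have ht' : (0 : ℝ) < t := by exact_mod_cast ht
  have h2s : 1 < 2 ^ s := Nat.one_lt_two_pow (by omega)
  have hD : 0 < t * (2 ^ s - 1) ^ m := Nat.mul_pos ht (pow_pos (by omega) m)
  have hps : satProb s = ((2 ^ s - 1 : ℕ) : ℝ) / ((2 ^ s : ℕ) : ℝ) := by
    rw [Nat.cast_sub h2s.le, satProb]; push_cast
    rw [eq_div_iff (by positivity), sub_mul, inv_pow, inv_mul_cancel₀ (by positivity), one_mul]
  have hpm : 0 < satProb s ^ m := by positivity
  have hy : ((S * (2 ^ s) ^ m : ℕ) : ℝ) / ((t * (2 ^ s - 1) ^ m : ℕ) : ℝ) =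
      S / (t * satProb s ^ m) := by
    rw [hps, div_pow]; push_cast; field_simp
  obtain ⟨h1, h2⟩ := abs_round_sub_le (X := S * (2 ^ s) ^ m) (N := N) hD
  rw [hy] at h1 h2
  have h3 : |(S : ℝ) / (t * satProb s ^ m) - N| * 2 ^ d ≤ N := by
    have e : (S : ℝ) / (t * satProb s ^ m) - N =
        (S - t * (N * satProb s ^ m)) / (t * satProb s ^ m) := by field_simp
    rw [e, abs_div, abs_of_pos (show 0 < t * satProb s ^ m by positivity), div_mul_eq_mul_div,
      div_le_iff₀ (by positivity)]
    refine h.trans (le_of_eq (by ring))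
  have h2d : (0 : ℝ) < 2 ^ d := by positivity
  rcases hε with hε | hε
  · refine h1.trans ?_
    rw [div_le_iff₀ h2d] at hε
    have h4 : |(S : ℝ) / (t * satProb s ^ m) - N| ≤ N / 2 ^ d := by rwa [le_div_iff₀ h2d]
    have h5 : 2 * ((N : ℝ) / 2 ^ d) ≤ ε * N := by
      rw [← mul_div_assoc, div_le_iff₀ h2d]
      nlinarith [(Nat.cast_nonneg N : (0 : ℝ) ≤ N)]
    linarith
  · have h4 : (N : ℝ) ≤ 2 ^ n := by exact_mod_cast hN
    have h5 : (2 : ℝ) ^ n * 4 ≤ 2 ^ d := by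
      calc (2 : ℝ) ^ n * 4 = 2 ^ (n + 2) := by rw [pow_add]; norm_num
        _ ≤ _ := pow_le_pow_right₀ (by norm_num) hε
    have h6 : |(S : ℝ) / (t * satProb s ^ m) - N| < 1 / 2 := by
      by_contra hc
      push Not at hc
      have : (1 / 2 : ℝ) * 2 ^ d ≤ N := le_trans (by gcongr) h3
      have : (0 : ℝ) < 2 ^ n := by positivity
      linarith
    have h7 := h2 h6
    rw [output, h7]; simp; positivity

end SATCount

/-! ### Programs for adding clauses -/

namespace SATCount

open WordRAM

/-- The states agree on the registers below `ρ` and on the memory outside of `[lo, hi)`. -/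
def Frame (ρ lo hi : ℕ) (s s' : State) : Prop :=
  (∀ r < ρ, s'.reg r = s.reg r) ∧ ∀ a, a < lo ∨ hi ≤ a → s'.mem a = s.mem a

theorem Frame.trans {ρ lo hi ρ' lo' hi' : ℕ} {s s' s'' : State} (h : Frame ρ lo hi s s')
    (h' : Frame ρ' lo' hi' s' s'') (hρ : ρ ≤ ρ') (hlo : lo ≤ lo') (hhi : hi' ≤ hi) :
    Frame ρ lo hi s s'' :=
  ⟨fun r hr => (h'.1 r (by omega)).trans (h.1 r hr),
    fun a ha => (h'.2 a (by omega)).trans (h.2 a ha)⟩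

/-- The list `L` stands in the memory from the address `AB` on, and register `39` holds its
length. -/
def Arr (AB : ℕ) (L : List ℕ) (s : State) : Prop :=
  s.reg 39 = L.length ∧ ∀ i < L.length, s.mem (AB + i) = L.getD i 0

/-- Add the mask in register `40` to the list that starts at the address in register `3`. -/
def addMaskP : Prog := block [
  block [.const 41 0, .op .add 42 39 41],
  .loop 42 (block [.op .sub 42 42 13, .op .add 43 3 42, .load 44 43, .op .eq 44 44 40,
    .op .bor 41 41 44]),
  .ite 41 .skip (block [.op .add 43 3 39, .store 43 40, .op .add 39 39 13])]

/-- The list is scanned from its end and comparisons are accumulated by a bitwise or, so the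
invariant speaks of membership in `L.drop j`. The scan costs linear time for each added clause,
which remains polynomial. -/
theorem sim_addMask {M AB cap : ℕ} {L : List ℕ} {s : State} (hb : s.Below M)
    (h13 : s.reg 13 = 1) (h3 : s.reg 3 = AB) (hA : Arr AB L s) (hL : L.length < cap)
    (hM : AB + cap < M) :
    Det M (fun s' => Arr AB (addMask L (s.reg 40)) s' ∧
      Frame 39 (AB + L.length) (AB + cap) s s') (12 * cap + 30) [addMaskP] s := by
  obtain ⟨h39, hmem⟩ := hA
  refine Sim.subConsLine _ hb ?_ fun hb1 => ?_
  · simp [execsOk, execOk, exec, Op.eval, h39]; omega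
  have hl := Sim.loopDet (M := M) (r := 42) (Tb := 11)
    (p := block [.op .sub 42 42 13, .op .add 43 3 42, .load 44 43, .op .eq 44 44 40,
      .op .bor 41 41 44])
    (fun j s' => s'.reg 42 = j ∧ j ≤ L.length ∧
      s'.reg 41 = (if s.reg 40 ∈ L.drop j then 1 else 0) ∧ (∀ r ≤ 40, s'.reg r = s.reg r) ∧
      s'.mem = s.mem) (fun j s' hb' hI => by
        obtain ⟨h42, hj, h41, hr, hm⟩ := hI
        refine ⟨by omega, ?_⟩
        have e3 := hr 3 (by omega)
        have e13 := hr 13 (by omega)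
        have e40 := hr 40 (by omega)
        have hval : s'.mem (AB + j) = L[j] := by
          rw [hm, hmem j (by omega), List.getD_eq_getElem _ _ (by omega)]
        have hf : (if s.reg 40 ∈ L.drop j then 1 else 0) =
            s'.reg 41 ||| (if L[j] = s.reg 40 then 1 else 0) := by
          rw [h41, List.drop_eq_getElem_cons (by omega)]
          simp only [List.mem_cons]
          by_cases c1 : s.reg 40 = L[j] <;> by_cases c2 : s.reg 40 ∈ L.drop (j + 1) <;>
            simp [c1, c2, eq_comm] <;> simp_all
        refine Sim.subLine _ hb' ?_ fun hb2 => ?_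
        · simp [execsOk, execOk, exec, Op.eval, h42, e3, e13, e40, h3, h13, hval]
          rw [← hf]
          refine ⟨by omega, by omega, ?_, ?_⟩ <;> split_ifs <;> omega
        · refine Sim.nil hb2 ?_
          refine ⟨?_, by omega, ?_, ?_, ?_⟩
          · simp [execs, exec, Op.eval, h42, e13, h13]
          · simp [execs, exec, Op.eval, h42, e3, e13, e40, h3, h13, hval, hf]
          · exact fun r hr' => (execs_reg (ρ := 41) s' rfl (by omega)).trans (hr r hr')
          · rw [execs_mem s' rfl, hm])
    (fun s' h => h.1) L.length hb1 (by
      refine ⟨by simp [execs, exec, Op.eval, h39], le_rfl, by simp [execs, exec], ?_, rfl⟩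
      exact fun r hr => execs_reg (ρ := 41) s rfl (by omega))
  refine Sim.subConsDet hl fun s2 hb2 hI => ?_
  obtain ⟨h42, -, h41, hr, hm⟩ := hI
  rw [List.drop_zero] at h41
  have e3 := hr 3 (by omega)
  have e13 := hr 13 (by omega)
  have e39 := hr 39 (by omega)
  have e40 := hr 40 (by omega)
  refine Sim.subConsIte (T₀ := 10) hb2 (fun h0 => Sim.skip hb2 (Sim.subEnd hb2 (Sim.nil hb2 ?_)))
    fun h0 => Sim.subLine _ hb2 ?_ fun hb3 => Sim.subEnd hb3 (Sim.nil hb3 ?_)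
  · have hin : s.reg 40 ∈ L := by by_contra hc; simp [h41, hc] at h0
    rw [addMask, if_pos hin]
    exact ⟨⟨by rw [e39, h39], fun i hi => by rw [hm]; exact hmem i hi⟩,
      fun r hr' => hr r (by omega), fun a _ => by rw [hm]⟩
  · simp [execsOk, execOk, exec, Op.eval, e3, e13, e39, h3, h13, h39]; omega
  · have hin : s.reg 40 ∉ L := by intro hc; simp [h41, hc] at h0
    rw [addMask, if_neg hin]
    refine ⟨⟨by simp [execs, exec, Op.eval, e39, e13, h39, h13], fun i hi => ?_⟩,
      fun r hr' => (execs_reg (ρ := 39) s2 rfl hr').trans (hr r (by omega)), fun a ha => ?_⟩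
    · simp only [List.length_append, List.length_singleton] at hi
      rcases Nat.lt_succ_iff_lt_or_eq.1 hi with hi | rfl
      · simp [execs, exec, Op.eval, e3, e39, h3, h39, hi, hi.ne, hm, hmem i hi, List.getElem?_append_left]
      · simp [execs, exec, Op.eval, e3, e39, h3, h39, e40]
    · rw [← hm]; simp [execs, exec, Op.eval, e3, e39, h3, h39]; omega

/-! ### Programs for random clauses -/

/-- Write a random literal to register `45`. -/
def randLitP : Prog := block [
  block [.const 45 0, .op .add 46 2 45],
  .loop 46 (block [block [.op .sub 46 46 13], .coin 47,
    block [.op .add 45 45 45, .op .add 45 45 47]]),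
  block [.op .mod 45 45 2], .coin 47, block [.op .add 45 45 45, .op .add 45 45 47]]

theorem sim_randLit {M n : ℕ} {s : State} (hb : s.Below M) (hn : 0 < n) (h13 : s.reg 13 = 1)
    (h2 : s.reg 2 = n) (hM : 2 ^ (2 * n) < M) :
    Sim M (fun x s' => s'.reg 45 = x ∧ (∀ r < 45, s'.reg r = s.reg r) ∧ s'.mem = s.mem)
      (14 * n + 40) [randLitP] s (randLit n) := by
  have hM1 : 2 ^ n < M :=
    lt_of_le_of_lt (Nat.pow_le_pow_right (by norm_num) (by omega)) hM
  have hM2 : 2 * n < M := Nat.lt_two_pow_self.trans hM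
  refine Sim.subConsLine _ hb ?_ fun hb1 => ?_
  · simp [execsOk, execOk, exec, Op.eval, h2]; omega
  have hl := Sim.loopCount (M := M) (r := 46) (Tb := 13)
    (p := block [block [.op .sub 46 46 13], .coin 47, block [.op .add 45 45 45, .op .add 45 45 47]])
    (fun j x s' => s'.reg 46 = j ∧ j ≤ n ∧ s'.reg 45 = x ∧ x < 2 ^ (n - j) ∧
      (∀ r < 45, s'.reg r = s.reg r) ∧ s'.mem = s.mem) randBits
    (fun x => (PMF.uniformOfFintype Bool).bind fun b => PMF.pure (2 * x + b.toNat))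
    (fun _ => rfl) (fun j x => by simp [randBits, PMF.bind_bind])
    (fun j x s' hb' hI => by
      obtain ⟨h46, hj, h45, hx, hr, hm⟩ := hI
      refine ⟨by omega, ?_⟩
      have e13 := hr 13 (by omega)
      have hxb : ∀ b : Bool, 2 * x + b.toNat < 2 ^ (n - j) := by
        intro b
        rw [show n - j = n - (j + 1) + 1 by omega, pow_succ]
        cases b <;> simp <;> omega
      have hxM : 2 ^ (n - j) ≤ 2 ^ n := Nat.pow_le_pow_right (by norm_num) (by omega)
      refine Sim.subConsLine _ hb' ?_ fun hb2 => Sim.subConsCoin hb2 (by omega) fun b hb3 =>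
        Sim.subConsLine _ hb3 ?_ fun hb4 => Sim.subEnd hb4 (Sim.nil hb4 ?_)
      · simp [execsOk, execOk, Op.eval, h46, e13, h13]; omega
      · have := hxb b
        simp [execsOk, execOk, execs, exec, Op.eval, h45]; omega
      · refine ⟨?_, by omega, ?_, hxb b, fun r hr' => ?_, ?_⟩
        · simp [execs, exec, Op.eval, h46, e13, h13]
        · simp [execs, exec, Op.eval, h45]; omega
        · rw [execs_reg (ρ := 45) _ rfl hr', State.setReg_reg, if_neg (by omega),
            execs_reg (ρ := 45) _ rfl hr', hr r hr']
        · rw [execs_mem _ rfl, State.setReg_mem, execs_mem _ rfl, hm])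
    (fun x s' h => h.1) n 0 hb1 (by
      refine ⟨by simp [execs, exec, Op.eval, h2], le_rfl, by simp [execs, exec], by positivity, ?_,
        execs_mem _ rfl⟩
      exact fun r hr => execs_reg (ρ := 45) s rfl hr)
  refine Sim.subConsCall hl fun x s2 hb2 hI => ?_
  obtain ⟨-, -, h45, hx, hr, hm⟩ := hI
  have e2 := hr 2 (by omega)
  have hmod := Nat.mod_lt x hn
  rw [← PMF.bind_pure_comp]
  refine Sim.subConsLine _ hb2 ?_ fun hb3 => Sim.subConsCoin hb3 (by omega) fun b hb4 =>
        Sim.subConsLine _ hb4 ?_ fun hb5 => Sim.subEnd hb5 (Sim.nil hb5 ?_)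
  · simp [execsOk, execOk, Op.eval, h45, e2, h2]; omega
  · have : b.toNat ≤ 1 := Bool.toNat_le b
    simp [execsOk, execOk, execs, exec, Op.eval, h45, e2, h2]; omega
  · refine ⟨?_, fun r hr' => ?_, ?_⟩
    · simp [execs, exec, Op.eval, h45, e2, h2]; omega
    · rw [execs_reg (ρ := 45) _ rfl hr', State.setReg_reg, if_neg (by omega),
        execs_reg (ρ := 45) _ rfl hr', hr r hr']
    · rw [execs_mem _ rfl, State.setReg_mem, execs_mem _ rfl, hm]

/-- Write the mask of a random clause with `s` literals to register `40`. -/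
def randMaskP (s : ℕ) : Prog := block [
  block [.const 40 0, .const 41 s],
  .loop 41 (block [randLitP, block [.op .shl 42 13 45, .op .bor 40 40 42, .op .sub 41 41 13]])]

theorem sim_randMask {M n w : ℕ} {s : State} (hb : s.Below M) (hn : 0 < n) (h13 : s.reg 13 = 1)
    (h2 : s.reg 2 = n) (hM : 2 ^ (2 * n) < M) (hw : w < M) :
    Sim M (fun x s' => s'.reg 40 = x ∧ (∀ r < 40, s'.reg r = s.reg r) ∧ s'.mem = s.mem)
      (w * (14 * n + 59 + 1) + 20) [randMaskP w] s (randMask n w 0) := by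
  refine Sim.subConsLine _ hb ?_ fun hb1 => ?_
  · simp [execsOk, execOk]; omega
  have hl := Sim.loopCount (M := M) (r := 41) (Tb := 14 * n + 59)
    (p := block [randLitP, block [.op .shl 42 13 45, .op .bor 40 40 42, .op .sub 41 41 13]])
    (fun j x s' => s'.reg 41 = j ∧ s'.reg 40 = x ∧ x < 2 ^ (2 * n) ∧ j < M ∧
      (∀ r < 40, s'.reg r = s.reg r) ∧ s'.mem = s.mem) (randMask n)
    (fun x => (randLit n).map fun l => x ||| 1 <<< l)
    (fun _ => rfl) (fun j x => by
      rw [randMask, ← PMF.bind_pure_comp, PMF.bind_bind]; simp)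
    (fun j x s' hb' hI => by
      obtain ⟨h41, h40, hx, hj, hr, hm⟩ := hI
      refine ⟨by omega, ?_⟩
      have e13 := hr 13 (by omega)
      have e2 := hr 2 (by omega)
      rw [← PMF.bind_pure_comp]
      refine Sim.subConsCall (sim_randLit hb' hn (by omega) (by omega) hM).support
        fun l s2 hb2 hI2 => Sim.subConsLine _ hb2 ?_ fun hb3 => Sim.subEnd hb3 (Sim.nil hb3 ?_)
      all_goals
        obtain ⟨⟨g45, gr, gm⟩, hl⟩ := hI2
        have g13 := gr 13 (by omega)
        have g40 := gr 40 (by omega)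
        have hsup : l < 2 * n := by
          rw [randLit, PMF.mem_support_bind_iff] at hl
          obtain ⟨y, -, hy⟩ := hl
          rw [PMF.support_map] at hy
          obtain ⟨b, -, rfl⟩ := hy
          have := Nat.mod_lt y hn
          have : b.toNat ≤ 1 := Bool.toNat_le b
          simp only; omega
        have h1 : 2 ^ l < 2 ^ (2 * n) := Nat.pow_lt_pow_right (by omega) hsup
        have h2' : x ||| 2 ^ l < 2 ^ (2 * n) := Nat.or_lt_two_pow hx h1
      · have g41 : s2.reg 41 = j + 1 := (gr 41 (by omega)).trans h41
        simp [execsOk, execOk, exec, Op.eval, g45, g13, e13, h13, g40, h40, Nat.one_shiftLeft, g41]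
        omega
      · refine ⟨?_, ?_, by simpa only [Nat.one_shiftLeft] using h2', by omega, fun r hr' => ?_, ?_⟩
        · have g41 : s2.reg 41 = j + 1 := (gr 41 (by omega)).trans h41
          simp [execs, exec, Op.eval, g41, g13, e13, h13]
        · simp [execs, exec, Op.eval, g45, g13, e13, h13, g40, h40]
        · rw [execs_reg (ρ := 40) _ rfl hr', gr r (by omega), hr r hr']
        · rw [execs_mem _ rfl, gm, hm])
    (fun x s' h => h.1) w 0 hb1 (by
      refine ⟨by simp [execs, exec], by simp [execs, exec], by positivity, hw, ?_,
        execs_mem _ rfl⟩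
      exact fun r hr => execs_reg (ρ := 40) s rfl hr)
  have := Sim.subConsCall (T := w * (14 * n + 59 + 1) + 20 - (2 * 2 + 2)) (g := PMF.pure) (qs := [])
    (L := []) hl fun x s2 hb2 hI =>
    Sim.subEnd hb2 (Sim.nil (R := fun x s' => s'.reg 40 = x ∧ (∀ r < 40, s'.reg r = s.reg r) ∧
      s'.mem = s.mem) hb2 ⟨hI.2.1, hI.2.2.2.2.1, hI.2.2.2.2.2⟩)
  rw [PMF.bind_pure] at this
  exact this

/-- Copy the first masks of the list, as many as register `4` says, and add random clauses, as
many as register `15` says. -/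
def hashP (w : ℕ) : Prog := block [
  block [.op .bor 38 15 15, .op .bor 39 4 4],
  .loop 38 (block [randMaskP w, addMaskP, block [.op .sub 38 38 13]])]

/-- Memory changes only behind the first `L₀.length` entries. Hence the next trial returns to the
original clauses just by resetting the length register. -/
theorem sim_hash {M n w m AB cap : ℕ} {L₀ : List ℕ} {s : State} (hb : s.Below M)
    (hnm : 0 < n ∨ m = 0) (h13 : s.reg 13 = 1) (h2 : s.reg 2 = n) (hM : 2 ^ (2 * n) < M)
    (hw : w < M) (h3 : s.reg 3 = AB) (h4 : s.reg 4 = L₀.length) (h15 : s.reg 15 = m)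
    (hmem : ∀ i < L₀.length, s.mem (AB + i) = L₀.getD i 0) (hcap : L₀.length + m ≤ cap)
    (hMc : AB + cap < M) :
    Sim M (fun L s' => Arr AB L s' ∧ Frame 38 (AB + L₀.length) (AB + cap) s s')
      (m * (w * (14 * n + 59 + 1) + 20 + (12 * cap + 30) + 10 + 1) + 20) [hashP w] s
      (hash n w m L₀) := by
  refine Sim.subConsLine _ hb ?_ fun hb1 => ?_
  · have := hb.1 15
    have := hb.1 4
    simp [execsOk, execOk, exec, Op.eval]; omega
  have hl := Sim.loopCount (M := M) (r := 38)
    (Tb := w * (14 * n + 59 + 1) + 20 + (12 * cap + 30) + 10)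
    (p := block [randMaskP w, addMaskP, block [.op .sub 38 38 13]])
    (fun j L s' => s'.reg 38 = j ∧ j ≤ m ∧ L.length + j ≤ cap ∧ L₀.length ≤ L.length ∧
      Arr AB L s' ∧ Frame 38 (AB + L₀.length) (AB + cap) s s') (hash n w)
    (fun L => (randMask n w 0).map fun x => addMask L x)
    (fun _ => rfl) (fun j x => by
      rw [hash, ← PMF.bind_pure_comp, PMF.bind_bind]; simp)
    (fun j L s' hb' hI => by
      obtain ⟨h38, hj, hc, hlen, hA, hF⟩ := hI
      refine ⟨by omega, ?_⟩
      have e13 := hF.1 13 (by omega)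
      have e2 := hF.1 2 (by omega)
      have e3 := hF.1 3 (by omega)
      rw [← PMF.bind_pure_comp]
      refine Sim.subConsCall (sim_randMask hb' (by omega) (by omega) (by omega) hM hw)
        fun x s2 hb2 hI2 => ?_
      obtain ⟨g40, gr, gm⟩ := hI2
      have hA2 : Arr AB L s2 := ⟨(gr 39 (by omega)).trans hA.1, fun i hi => by
        rw [gm]; exact hA.2 i hi⟩
      have k13 := gr 13 (by omega)
      have k3 := gr 3 (by omega)
      refine Sim.subConsDet (sim_addMask (cap := cap) hb2 (by omega) (k3.trans (e3.trans h3)) hA2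
        (by omega) hMc)
        fun s3 hb3 hI3 => ?_
      obtain ⟨hA3, hF3⟩ := hI3
      rw [g40] at hA3
      have l38 : s3.reg 38 = j + 1 := by rw [hF3.1 38 (by omega), gr 38 (by omega), h38]
      have l13 : s3.reg 13 = 1 := by rw [hF3.1 13 (by omega)]; omega
      have hF2 : Frame 38 (AB + L₀.length) (AB + cap) s s2 :=
        hF.trans (ρ' := 40) (lo' := AB + L₀.length) (hi' := AB + cap)
          ⟨gr, fun a _ => by rw [gm]⟩ (by omega) le_rfl le_rfl
      refine Sim.subConsLine _ hb3 ?_ fun hb4 => Sim.subEnd hb4 (Sim.nil hb4 ?_)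
      · simp [execsOk, execOk, Op.eval, l38, l13]; omega
      · have e39 : (execs [.op .sub 38 38 13] s3).reg 39 = s3.reg 39 := by simp [execs, exec]
        have h1 := length_addMask L x
        have h2 := (prefix_addMask L x).length_le
        refine ⟨by simp [execs, exec, Op.eval, l38, l13], by omega, by simp only; omega,
          by simp only; omega, ⟨e39.trans hA3.1, fun i hi => ?_⟩, ?_⟩
        · rw [execs_mem _ rfl]; exact hA3.2 i hi
        · refine (hF2.trans hF3 (by omega) (by omega) le_rfl).trans (ρ' := 38)
            (lo' := AB + L₀.length) (hi' := AB + cap) ⟨fun r hr => execs_reg (ρ := 38) s3 rfl hr,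
            fun a _ => by rw [execs_mem _ rfl]⟩ le_rfl le_rfl le_rfl)
    (fun x s' h => h.1) m L₀ hb1 (by
      refine ⟨by simp [execs, exec, Op.eval, h15], le_rfl, hcap, le_rfl,
        ⟨by simp [execs, exec, Op.eval, h4], fun i hi => ?_⟩,
        fun r hr => execs_reg (ρ := 38) s rfl hr, fun a _ => by rw [execs_mem _ rfl]⟩
      rw [execs_mem _ rfl]; exact hmem i hi)
  have := Sim.subConsCall (T := m * (w * (14 * n + 59 + 1) + 20 + (12 * cap + 30) + 10 + 1) + 20 -
      (2 * 2 + 2)) (g := PMF.pure) (qs := [])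
    (L := []) hl fun x s2 hb2 hI =>
    Sim.subEnd hb2 (Sim.nil (R := fun L s' => Arr AB L s' ∧
      Frame 38 (AB + L₀.length) (AB + cap) s s') hb2 hI.2.2.2.2)
  rw [PMF.bind_pure] at this
  exact this

/-- Add the clauses that fix the first variables as the node in register `23` says, the depth of
which is in register `24`. -/
def addPrefixP : Prog := block [
  block [.op .bor 36 24 24, .op .bor 37 23 23],
  .loop 36 (block [
    block [.op .sub 36 36 13, .op .band 40 37 13, .op .add 40 40 36, .op .add 40 40 36,
      .op .shl 40 13 40],
    addMaskP, block [.op .shr 37 37 13]])]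

/-- The invariant says that the remaining call of the recursion, on the present list and the
remaining digits, still evaluates to the intended list. -/
theorem sim_addPrefix {M n l v AB cap : ℕ} {L : List ℕ} {s : State} (hb : s.Below M) (hl : l ≤ n)
    (h13 : s.reg 13 = 1) (hM : 2 ^ (2 * n) < M) (h3 : s.reg 3 = AB) (h24 : s.reg 24 = l)
    (h23 : s.reg 23 = v) (hA : Arr AB L s) (hcap : L.length + l ≤ cap) (hMc : AB + cap < M) :
    Det M (fun s' => Arr AB (addPrefix l v L) s' ∧ Frame 36 (AB + L.length) (AB + cap) s s')
      (n * (12 * cap + 50 + 1) + 20) [addPrefixP] s := by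
  refine Sim.subConsLine _ hb ?_ fun hb1 => ?_
  · have := hb.1 24
    have := hb.1 23
    simp [execsOk, execOk, exec, Op.eval]; omega
  have hloop := Sim.loopDet (M := M) (r := 36) (Tb := 12 * cap + 50)
    (p := block [
      block [.op .sub 36 36 13, .op .band 40 37 13, .op .add 40 40 36, .op .add 40 40 36,
        .op .shl 40 13 40],
      addMaskP, block [.op .shr 37 37 13]])
    (fun j s' => ∃ u L', s'.reg 36 = j ∧ j ≤ l ∧ s'.reg 37 = u ∧ Arr AB L' s' ∧
      addPrefix j u L' = addPrefix l v L ∧ L'.length + j ≤ cap ∧ L.length ≤ L'.length ∧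
      Frame 36 (AB + L.length) (AB + cap) s s') (fun j s' hb' hI => by
        obtain ⟨u, L', h36, hj, h37, hA', heq, hc, hlen, hF⟩ := hI
        refine ⟨by omega, ?_⟩
        have e13 := hF.1 13 (by omega)
        have e3 := hF.1 3 (by omega)
        have hu : u &&& 1 = u % 2 := Nat.and_one_is_mod u
        have hp : 2 ^ (u % 2 + j + j) < M := by
          refine lt_of_le_of_lt (Nat.pow_le_pow_right (by norm_num) ?_) hM
          omega
        have hp' : u % 2 + j + j < M := Nat.lt_two_pow_self.trans hp
        refine Sim.subConsLine _ hb' ?_ fun hb2 => ?_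
        · simp [execsOk, execOk, exec, Op.eval, h36, h37, e13, h13, hu, Nat.one_shiftLeft]
          omega
        set s2 := execs [.op .sub 36 36 13, .op .band 40 37 13, .op .add 40 40 36,
          .op .add 40 40 36, .op .shl 40 13 40] s' with hs2
        have k36 : s2.reg 36 = j := by simp [hs2, execs, exec, Op.eval, h36, e13, h13]
        have k37 : s2.reg 37 = u := by simp [hs2, execs, exec, h37]
        have k39 : s2.reg 39 = s'.reg 39 := by simp [hs2, execs, exec]
        have k40 : s2.reg 40 = 1 <<< (2 * j + u % 2) := by
          simp [hs2, execs, exec, Op.eval, h36, h37, e13, h13, hu]; congr 1; omega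
        have kr : ∀ r < 36, s2.reg r = s'.reg r := fun r hr => execs_reg (ρ := 36) s' rfl hr
        have km : s2.mem = s'.mem := execs_mem s' rfl
        have hA2 : Arr AB L' s2 := ⟨k39.trans hA'.1, fun i hi => by rw [km]; exact hA'.2 i hi⟩
        have k13 := kr 13 (by omega)
        have k3 := kr 3 (by omega)
        refine Sim.subConsDet (sim_addMask (cap := cap) hb2 (by omega) (by omega) hA2
          (by omega) hMc) fun s3 hb3 hI3 => ?_
        obtain ⟨hA3, hF3⟩ := hI3
        rw [k40] at hA3
        have g36 := hF3.1 36 (by omega)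
        have g37 := hF3.1 37 (by omega)
        have g13 := hF3.1 13 (by omega)
        have hu2 : u >>> 1 = u / 2 := by simp [Nat.shiftRight_eq_div_pow]
        refine Sim.subConsLine _ hb3 ?_ fun hb4 => Sim.subEnd hb4 (Sim.nil hb4 ?_)
        · have := hb3.1 37
          simp [execsOk, execOk, Op.eval, g37, g13, k37, k13, e13, h13, hu2]; omega
        · have h1 := length_addMask L' (1 <<< (2 * j + u % 2))
          have h2 := (prefix_addMask L' (1 <<< (2 * j + u % 2))).length_le
          refine ⟨u / 2, addMask L' (1 <<< (2 * j + u % 2)), ?_, by omega, ?_, ⟨?_, ?_⟩, heq,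
            by omega, by omega, ?_⟩
          · simp [execs, exec, g36, k36]
          · simp [execs, exec, Op.eval, g37, g13, k37, k13, e13, h13, hu2]
          · simp [execs, exec, hA3.1]
          · intro i hi; rw [execs_mem _ rfl]; exact hA3.2 i hi
          · refine ((hF.trans (ρ' := 36) (lo' := AB + L.length) (hi' := AB + cap)
              ⟨kr, fun a _ => by rw [km]⟩ le_rfl le_rfl le_rfl).trans hF3 (by omega) (by omega)
              le_rfl).trans (ρ' := 36) (lo' := AB + L.length) (hi' := AB + cap)
              ⟨fun r hr => execs_reg (ρ := 36) s3 rfl hr, fun a _ => by rw [execs_mem _ rfl]⟩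
              le_rfl le_rfl le_rfl)
    (fun s' h => by obtain ⟨_, _, h, _⟩ := h; exact h) l hb1 (by
      refine ⟨v, L, by simp [execs, exec, Op.eval, h24], le_rfl,
        by simp [execs, exec, Op.eval, h23], ⟨by simp [execs, exec, hA.1], fun i hi => ?_⟩, rfl,
        hcap, le_rfl, fun r hr => execs_reg (ρ := 36) s rfl hr,
        fun a _ => by rw [execs_mem _ rfl]⟩
      rw [execs_mem _ rfl]; exact hA.2 i hi)
  have hln : l * (12 * cap + 50 + 1) ≤ n * (12 * cap + 50 + 1) := Nat.mul_le_mul_right _ hl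
  refine Sim.subConsDet hloop fun s2 hb2 hI => Sim.subEnd hb2 (Sim.nil hb2 ?_)
  obtain ⟨u, L', h36, -, -, hA', heq, -, -, hF⟩ := hI
  exact ⟨by rwa [← heq], hF⟩

/-! ### The program that writes a formula -/

theorem getD_append_singleton (l : List ℕ) (x i : ℕ) :
    (l ++ [x]).getD i 0 = if i = l.length then x else l.getD i 0 := by
  rcases lt_trichotomy i l.length with h | rfl | h
  · simp [h, h.ne, List.getElem?_append_left]
  · simp
  · simp [h.ne', List.getElem?_eq_none (show (l ++ [x]).length ≤ i by simp; omega),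
      List.getElem?_eq_none h.le]

/-- Used to overwrite a placeholder in the middle of a list that has already been written. -/
theorem getD_append_cons (l m : List ℕ) (x y i : ℕ) :
    (l ++ x :: m).getD i 0 = if i = l.length then x else (l ++ y :: m).getD i 0 := by
  rcases lt_trichotomy i l.length with h | rfl | h
  · simp [h, h.ne, List.getElem?_append_left]
  · simp
  · obtain ⟨j, rfl⟩ := Nat.exists_eq_add_of_lt h
    have h1 : l.length + j + 1 - l.length = j + 1 := by omega
    simp only [List.getD_eq_getElem?_getD, show l.length + j + 1 ≠ l.length by omega, if_false]
    rw [List.getElem?_append_right (by omega), List.getElem?_append_right (by omega), h1,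
      List.getElem?_cons_succ, List.getElem?_cons_succ]

/-- The memory from the address `FP` on consists of the list `l` and zeros; register `49` holds
the address behind the list. -/
def Written (FP : ℕ) (l : List ℕ) (s : State) : Prop :=
  s.reg 49 = FP + l.length ∧ ∀ i, s.mem (FP + i) = l.getD i 0

/-- Write the literals of the mask in register `51` to the memory. -/
def emitLitsP : Prog :=
  .loop 53 (block [block [.op .shr 54 51 56, .op .band 54 54 13],
    .ite 54 (block [.store 49 56, .op .add 49 49 13]) .skip,
    block [.op .add 56 56 13, .op .sub 53 53 13]])

theorem Written.append {FP x : ℕ} {l : List ℕ} {s s' : State} (h : Written FP l s)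
    (h49 : s'.reg 49 = s.reg 49 + 1)
    (hm : ∀ a, s'.mem a = if a = s.reg 49 then x else s.mem a) : Written FP (l ++ [x]) s' := by
  refine ⟨by simp [h49, h.1, add_assoc], fun i => ?_⟩
  rw [hm, h.1, getD_append_singleton, h.2 i]
  exact if_congr (by omega) rfl rfl

theorem sim_emitLits {M n FP x : ℕ} {l : List ℕ} {s : State} (hb : s.Below M)
    (h13 : s.reg 13 = 1) (h51 : s.reg 51 = x) (h53 : s.reg 53 = 2 * n) (h56 : s.reg 56 = 0)
    (hW : Written FP l s) (hM : FP + l.length + 2 * n < M) (hM1 : 1 < M) :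
    Det M (fun s' => Written FP (l ++ maskLits n x) s' ∧
      (∀ r, r ≠ 49 → r ≠ 53 → r ≠ 54 → r ≠ 56 → s'.reg r = s.reg r) ∧
      ∀ a < FP, s'.mem a = s.mem a) (2 * n * (25 + 1) + 1) [emitLitsP] s := by
  refine (Sim.loopDet (M := M) (r := 53) (Tb := 25)
    (fun j s' => s'.reg 53 = j ∧ s'.reg 56 = 2 * n - j ∧ j ≤ 2 * n ∧
      Written FP (l ++ (List.range (2 * n - j)).filter fun i => x.testBit i) s' ∧
      (∀ r, r ≠ 49 → r ≠ 53 → r ≠ 54 → r ≠ 56 → s'.reg r = s.reg r) ∧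
      ∀ a < FP, s'.mem a = s.mem a) (fun j s' hb' hI => ?_) (fun s' h => h.1) (2 * n) hb
      ⟨h53, by simp [h56], le_rfl, by simpa using hW, fun _ _ _ _ _ => rfl, fun _ _ => rfl⟩).conseq
      fun _ s' _ h => ⟨by simpa [maskLits] using h.2.2.2.1, h.2.2.2.2⟩
  obtain ⟨g53, g56, hj, hW', hr, hm⟩ := hI
  refine ⟨by omega, ?_⟩
  have e13 := hr 13 (by omega) (by omega) (by omega) (by omega)
  have e51 := hr 51 (by omega) (by omega) (by omega) (by omega)
  set i := 2 * n - (j + 1) with hi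
  have hbit : (x >>> i) &&& 1 = (x.testBit i).toNat := by
    rw [Nat.and_one_is_mod, Nat.shiftRight_eq_div_pow, Nat.toNat_testBit]
  have hxi : x >>> i < M := by
    have h1 : x < M := by rw [← h51]; exact hb.1 51
    have := Nat.shiftRight_le x i
    omega
  have hlen : ((List.range i).filter fun i => x.testBit i).length ≤ i :=
    (List.length_filter_le _ _).trans (by simp)
  have h49 := hW'.1
  rw [List.length_append] at h49
  refine Sim.subConsLine _ hb' ?_ fun hb2 => ?_
  · simp [execsOk, execOk, exec, Op.eval, g56, e51, h51, e13, h13, hbit, hxi]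
    have := Bool.toNat_le (x.testBit i)
    omega
  set s2 := execs [.op .shr 54 51 56, .op .band 54 54 13] s' with hs2
  have k54 : s2.reg 54 = (x.testBit i).toNat := by
    simp [hs2, execs, exec, Op.eval, g56, e51, h51, e13, h13, hbit]
  have kr : ∀ r, r ≠ 54 → s2.reg r = s'.reg r := by
    intro r hr'; simp [hs2, execs, exec, hr']
  have km : s2.mem = s'.mem := execs_mem s' rfl
  have hnext : 2 * n - j = i + 1 := by omega
  -- The common end of both branches: it requires only that the list written so far is correct up to
  -- the literal `i`.
  have fin : ∀ s3 : State, s3.Below M →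
      Written FP (l ++ (List.range (i + 1)).filter fun i => x.testBit i) s3 →
      (∀ r, r ≠ 49 → r ≠ 54 → s3.reg r = s'.reg r) → (∀ a < FP, s3.mem a = s'.mem a) →
      Sim M (fun _ : Unit => fun s' => s'.reg 53 = j ∧ s'.reg 56 = 2 * n - j ∧ j ≤ 2 * n ∧
        Written FP (l ++ (List.range (2 * n - j)).filter fun i => x.testBit i) s' ∧
        (∀ r, r ≠ 49 → r ≠ 53 → r ≠ 54 → r ≠ 56 → s'.reg r = s.reg r) ∧
        ∀ a < FP, s'.mem a = s.mem a) 8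
        [block [block [.op .add 56 56 13, .op .sub 53 53 13]]] s3 (PMF.pure ()) := by
    intro s3 hb3 hW3 hr3 hm3
    have q56 := hr3 56 (by omega) (by omega)
    have q53 := hr3 53 (by omega) (by omega)
    have q13 := hr3 13 (by omega) (by omega)
    refine Sim.subConsLine _ hb3 ?_ fun hb4 => Sim.subEnd hb4 (Sim.nil hb4 ?_)
    · simp [execsOk, execOk, exec, Op.eval, q56, q53, q13, g56, g53, e13, h13]; omega
    · refine ⟨?_, ?_, by omega, ⟨?_, fun a => ?_⟩, fun r h1 h2 h3 h4 => ?_, fun a ha => ?_⟩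
      · simp [execs, exec, Op.eval, q53, q13, g53, e13, h13]
      · simp [execs, exec, Op.eval, q56, q13, g56, e13, h13]; omega
      · rw [hnext, ← hW3.1]; simp [execs, exec]
      · rw [hnext, ← hW3.2, execs_mem _ rfl]
      · rw [← hr r h1 h2 h3 h4, ← hr3 r h1 h3]; simp [execs, exec, h2, h4]
      · rw [execs_mem _ rfl, hm3 a ha, hm a ha]
  refine Sim.subConsIte (T₀ := 16) hb2 (fun h0 => ?_) fun h0 => ?_
  · have hx : x.testBit i = true := by
      by_contra hc; simp [k54, hc] at h0
    have q49 := kr 49 (by omega)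
    have q56 := kr 56 (by omega)
    have q13 := kr 13 (by omega)
    refine Sim.subLine _ hb2 ?_ fun hb3 => Sim.mono (by simp) (fin _ hb3 ?_ ?_ ?_)
    · simp [execsOk, execOk, exec, Op.eval, q49, q13, h49, e13, h13]; omega
    · rw [List.range_succ, List.filter_append, ← List.append_assoc]
      simp only [List.filter_cons, hx, if_true, List.filter_nil]
      refine hW'.append (x := i) ?_ fun a => ?_
      · simp [execs, exec, Op.eval, q49, q13, e13, h13]
      · simp [execs, exec, q49, q56, g56, km]
    · intro r h1 h2; rw [← kr r h2]; simp [execs, exec, h1]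
    · intro a ha; rw [← km]; simp [execs, exec, q49, h49]; omega
  · have hx : x.testBit i = false := by
      by_contra hc; simp [k54, hc] at h0
    refine (Sim.skip hb2 (fin _ hb2 ?_ (fun r _ h => kr r h) fun a _ => by rw [km])).mono
      (by omega)
    rw [List.range_succ, List.filter_append]
    simp only [List.filter_cons, hx, Bool.false_eq_true, if_false, List.filter_nil, List.append_nil]
    exact ⟨(kr 49 (by omega)).trans hW'.1, fun a => by rw [km]; exact hW'.2 a⟩

/-- Write the list of masks as a formula to the memory from the address in register `28` on. -/
def emitP : Prog := block [
  block [.store 28 2, .op .add 49 28 13, .store 49 39, .op .add 49 49 13, .op .bor 50 39 39,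
    .op .bor 55 3 3],
  .loop 50 (block [
    block [.load 51 55, .op .bor 52 49 49, .op .add 49 49 13, .op .bor 53 11 11, .const 56 0],
    emitLitsP,
    block [.op .sub 54 49 52, .op .sub 54 54 13, .store 52 54, .op .add 55 55 13,
      .op .sub 50 50 13]])]

/-- The conclusion describes all words from `FP` on, including the zeros behind the encoding:
together with cleared registers this is an initial configuration of the decision program. It depends
on `hz`, since nothing is cleared here. -/
theorem sim_emit {M n AB FP cap : ℕ} {L : List ℕ} {s : State} (hb : s.Below M)
    (h2 : s.reg 2 = n) (h13 : s.reg 13 = 1) (h3 : s.reg 3 = AB) (h11 : s.reg 11 = 2 * n)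
    (h28 : s.reg 28 = FP) (hA : Arr AB L s) (hAB : AB + cap ≤ FP) (hL : L.length ≤ cap)
    (hz : ∀ i, s.mem (FP + i) = 0) (hM : FP + (cap * (2 * n + 1) + 2) < M) :
    Det M (fun s' => (∀ i, s'.mem (FP + i) = (encMasks n L).getD i 0) ∧
      (∀ r < 49, s'.reg r = s.reg r) ∧ ∀ a < FP, s'.mem a = s.mem a)
      (cap * (2 * n * (25 + 1) + 1 + 40 + 1) + 40) [emitP] s := by
  obtain ⟨h39, hmem⟩ := hA
  have hb3 := hb.1 3
  have hb39 := hb.1 39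
  refine Sim.subConsLine _ hb ?_ fun hb1 => ?_
  · simp [execsOk, execOk, exec, Op.eval, h28, h13]; omega
  set W := 2 * n + 1 with hW
  have hl := Sim.loopDet (M := M) (r := 50) (Tb := 2 * n * (25 + 1) + 1 + 40)
    (p := block [
      block [.load 51 55, .op .bor 52 49 49, .op .add 49 49 13, .op .bor 53 11 11, .const 56 0],
      emitLitsP,
      block [.op .sub 54 49 52, .op .sub 54 54 13, .store 52 54, .op .add 55 55 13,
        .op .sub 50 50 13]])
    (fun j s' => ∃ l, s'.reg 50 = j ∧ j ≤ L.length ∧ s'.reg 55 = AB + (L.length - j) ∧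
      l = n :: L.length :: (L.take (L.length - j)).flatMap
        (fun M => (maskLits n M).length :: maskLits n M) ∧
      Written FP l s' ∧ l.length + j * W ≤ cap * W + 2 ∧
      (∀ r < 49, s'.reg r = s.reg r) ∧ ∀ a < FP, s'.mem a = s.mem a)
    (fun j s' hb' hI => by
      obtain ⟨l, h50, hj, h55, hl, hWr, hlen, hr, hm⟩ := hI
      refine ⟨by omega, ?_⟩
      have e13 := hr 13 (by omega)
      have e11 := hr 11 (by omega)
      have h49 := hWr.1
      rw [add_mul, one_mul] at hlen
      set x := L[L.length - (j + 1)] with hx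
      have hval : s'.mem (AB + (L.length - (j + 1))) = x := by
        rw [hm _ (by omega), hmem _ (by omega), List.getD_eq_getElem _ _ (by omega)]
      have hxM : x < M := by rw [← hval]; exact hb'.2 _
      have hfp : FP < M := by omega
      refine Sim.subConsLine _ hb' ?_ fun hb2 => ?_
      · simp [execsOk, execOk, exec, Op.eval, h49, e13, h13, e11, h11]; omega
      set s2 := execs [.load 51 55, .op .bor 52 49 49, .op .add 49 49 13, .op .bor 53 11 11,
        .const 56 0] s' with hs2
      have k51 : s2.reg 51 = x := by simp [hs2, execs, exec, h55, hval]
      have k52 : s2.reg 52 = FP + l.length := by simp [hs2, execs, exec, Op.eval, h49]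
      have k53 : s2.reg 53 = 2 * n := by simp [hs2, execs, exec, Op.eval, e11, h11]
      have k56 : s2.reg 56 = 0 := by simp [hs2, execs, exec]
      have k49 : s2.reg 49 = FP + l.length + 1 := by
        simp [hs2, execs, exec, Op.eval, h49, e13, h13]
      have k50 : s2.reg 50 = j + 1 := by simp [hs2, execs, exec, h50]
      have k55 : s2.reg 55 = AB + (L.length - (j + 1)) := by simp [hs2, execs, exec, h55]
      have kr : ∀ r < 49, s2.reg r = s'.reg r := fun r hr => execs_reg (ρ := 49) s' rfl hr
      have km : s2.mem = s'.mem := execs_mem s' rfl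
      have hW2 : Written FP (l ++ [0]) s2 := by
        refine ⟨by simp [k49, add_assoc], fun i => ?_⟩
        rw [km, hWr.2, getD_append_singleton]
        split_ifs with hi
        · rw [List.getD_eq_default _ _ hi.ge]
        · rfl
      refine Sim.subConsDet (sim_emitLits hb2 ((kr 13 (by omega)).trans (e13.trans h13)) k51 k53
        k56 hW2 (by simp; omega) (by omega)) fun s3 hb3 hI3 => ?_
      obtain ⟨hW3, hr3, hm3⟩ := hI3
      have q50 := hr3 50 (by omega) (by omega) (by omega) (by omega)
      have q52 := hr3 52 (by omega) (by omega) (by omega) (by omega)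
      have q55 := hr3 55 (by omega) (by omega) (by omega) (by omega)
      have q13 := (hr3 13 (by omega) (by omega) (by omega) (by omega)).trans (kr 13 (by omega))
      have q49 := hW3.1
      have hlits : (maskLits n x).length ≤ 2 * n :=
        (List.length_filter_le _ _).trans (by simp)
      rw [List.length_append, List.length_append, List.length_singleton] at q49
      have hsub : FP + (l.length + 1 + (maskLits n x).length) - (FP + l.length) - 1 =
        (maskLits n x).length := by omega
      refine Sim.subConsLine _ hb3 ?_ fun hb4 => Sim.subEnd hb4 (Sim.nil hb4 ?_)
      · simp [execsOk, execOk, exec, Op.eval, q49, q52, k52, q13, e13, h13, q55, k55, q50, k50,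
          hsub]
        omega
      · refine ⟨l ++ (maskLits n x).length :: maskLits n x, ?_, by omega, ?_, ?_, ⟨?_, fun i => ?_⟩,
          ?_, fun r hr' => ?_, fun a ha => ?_⟩
        · simp [execs, exec, Op.eval, q50, k50, q13, e13, h13]
        · simp [execs, exec, Op.eval, q55, k55, q13, e13, h13]; omega
        · rw [hl, show L.length - j = L.length - (j + 1) + 1 by omega,
            List.take_succ_eq_append_getElem (by omega), List.flatMap_append,
            List.flatMap_singleton, List.cons_append, List.cons_append]
        · simp [execs, exec, q49]; omega
        · rw [getD_append_cons _ _ _ 0]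
          have := hW3.2 i
          rw [List.append_assoc, List.singleton_append] at this
          rw [← this]
          simp [execs, exec, Op.eval, q49, q52, k52, q13, e13, h13, hsub]
        · simp; omega
        · rw [execs_reg (ρ := 49) _ rfl hr', hr3 r (by omega) (by omega) (by omega) (by omega),
            kr r hr', hr r hr']
        · rw [← hm a ha, ← km, ← hm3 a ha]
          simp [execs, exec, Op.eval, q52, k52]; omega)
    (fun s' h => by obtain ⟨_, h, _⟩ := h; exact h) L.length hb1 (by
      refine ⟨[n, L.length], by simp [execs, exec, Op.eval, h39], le_rfl, ?_, by simp,
        ⟨?_, fun i => ?_⟩, ?_, fun r hr => execs_reg (ρ := 49) s rfl hr, fun a ha => ?_⟩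
      · simp [execs, exec, Op.eval, h3]
      · simp [execs, exec, Op.eval, h28, h13]
      · have := hz i
        rcases i with _ | _ | i
        · simp [execs, exec, Op.eval, h28, h2, h13]
        · simp [execs, exec, Op.eval, h28, h13, h39]
        · simp [execs, exec, Op.eval, h28, h13, this]
      · have := Nat.mul_le_mul_right W hL
        simp; omega
      · simp [execs, exec, Op.eval, h28, h13]
        rw [if_neg (by omega), if_neg (by omega)])
  have hT : L.length * (2 * n * (25 + 1) + 1 + 40 + 1) ≤ cap * (2 * n * (25 + 1) + 1 + 40 + 1) :=
    Nat.mul_le_mul_right _ hL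
  refine Sim.subConsDet hl fun s2 hb2 hI => Sim.subEnd hb2 (Sim.nil hb2 ?_)
  obtain ⟨l, -, -, -, hl, hWr, -, hr, hm⟩ := hI
  refine ⟨fun i => ?_, hr, hm⟩
  rw [hWr.2 i, hl]; simp [encMasks]

/-! ### Oracle calls -/

/-- The answer of the program `P` on the formula with the given masks. -/
noncomputable def oracle (P : Prog) (T n : ℕ) (L : List ℕ) : PMF Bool :=
  (run T (init P (encMasks n L))).map fun d => decide (d.st.reg 0 = 1)

/-- The program `P` halts in time `T` with words below `N` only. -/
def RunsOn (P : Prog) (T N : ℕ) (x : List ℕ) : Prop :=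
  (∀ d ∈ (run T (init P x)).support, d.todo = []) ∧
  ∀ t, ∀ d ∈ (run t (init P x)).support, d.WordsBelow N

/-- The memory from the address in register `28` on is unused. -/
def Fresh (s : State) : Prop := ∀ i, s.mem (s.reg 28 + i) = 0

/-- Between `s` and `s'`, at most `k` words of fresh memory have been used, and registers below
`ρ` and memory words below `hi` have not changed. -/
structure Used (ρ hi k : ℕ) (s s' : State) : Prop where
  reg : ∀ r < ρ, s'.reg r = s.reg r
  mem : ∀ a < hi, s'.mem a = s.mem a
  le : s.reg 28 ≤ s'.reg 28
  ge : s'.reg 28 ≤ s.reg 28 + k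
  fresh : Fresh s'

theorem Used.refl {ρ hi : ℕ} {s : State} (h : Fresh s) : Used ρ hi 0 s s :=
  ⟨fun _ _ => rfl, fun _ _ => rfl, le_rfl, le_rfl, h⟩

theorem Used.trans {ρ ρ' hi hi' k k' l : ℕ} {s s' s'' : State} (h : Used ρ hi k s s')
    (h' : Used ρ' hi' k' s' s'') (hρ : ρ ≤ ρ') (hhi : hi ≤ hi') (hl : k + k' ≤ l) :
    Used ρ hi l s s'' :=
  ⟨fun r hr => (h'.reg r (by omega)).trans (h.reg r hr),
    fun a ha => (h'.mem a (by omega)).trans (h.mem a ha), h.le.trans h'.le,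
    by have := h.ge; have := h'.ge; omega, h'.fresh⟩

theorem Used.of_eq {ρ hi : ℕ} {s s' : State} (h : Fresh s) (hr : ∀ r < ρ, s'.reg r = s.reg r)
    (h28 : s'.reg 28 = s.reg 28) (hm : s'.mem = s.mem) : Used ρ hi 0 s s' :=
  ⟨hr, fun a _ => by rw [hm], h28.ge, h28.le, fun i => by rw [hm, h28, h i]⟩

theorem length_maskLits_le (n x : ℕ) : (maskLits n x).length ≤ 2 * n :=
  (List.length_filter_le _ _).trans (by simp)

theorem length_encMasks_le (n : ℕ) (L : List ℕ) :
    (encMasks n L).length ≤ L.length * (2 * n + 1) + 2 := by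
  suffices h : (L.flatMap fun M => (maskLits n M).length :: maskLits n M).length ≤
      L.length * (2 * n + 1) by simpa [encMasks] using h
  induction L with
  | nil => simp
  | cons x L ih =>
    have := length_maskLits_le n x
    rw [List.flatMap_cons, List.length_append, List.length_cons, List.length_cons, add_mul]
    omega

/-- The time for one oracle call. -/
def callTime (P : Prog) (n cap T : ℕ) : ℕ :=
  cap * (2 * n * (25 + 1) + 1 + 40 + 1) + 40 + (3 * T + (2 * (P.regBound + 1) + 1) + 1) + 30

/-- Count the positive answers of `P` on the formula in the array. -/
def voteP (P : Prog) : Prog := block [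
  block [.const 30 0, .op .bor 29 7 7],
  .loop 29 (block [emitP, block [.op .bor 63 28 28], callProg P,
    block [.op .eq 57 64 13, .op .add 30 30 57, .op .add 28 28 6, .op .sub 29 29 13]])]

/-- Each run gets a new region of `MP` words instead of cleaning the old one. The region covers both
the encoding and all words that the decision program can reach, so everything behind it is still
zero for the next run. The addresses become exponential in `n`, which words of linearly many bits
can hold. -/
theorem sim_vote {M n AB MP R cap T N : ℕ} {P : Prog} {L : List ℕ} {s : State} (hb : s.Below M)
    (h2 : s.reg 2 = n) (h13 : s.reg 13 = 1) (h3 : s.reg 3 = AB) (h11 : s.reg 11 = 2 * n)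
    (h6 : s.reg 6 = MP) (h7 : s.reg 7 = R) (hA : Arr AB L s) (hAB : AB + cap ≤ s.reg 28)
    (hL : L.length ≤ cap) (hf : Fresh s) (hMP : cap * (2 * n + 1) + 2 ≤ MP) (hN : N ≤ MP)
    (hM : s.reg 28 + R * MP < M) (hO : RunsOn P T N (encMasks n L)) :
    Sim M (fun c s' => s'.reg 30 = c ∧ c ≤ R ∧ Arr AB L s' ∧ Used 28 (s.reg 28) (R * MP) s s')
      (R * (callTime P n cap T + 1) + 20) [voteP P] s (vote (oracle P T n L) R 0) := by
  have hR : R < M := h7 ▸ hb.1 7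
  refine Sim.subConsLine _ hb ?_ fun hb1 => ?_
  · simp [execsOk, execOk, exec, Op.eval, h7]; omega
  have hloop := Sim.loopCount (M := M) (r := 29) (Tb := callTime P n cap T)
    (p := block [emitP, block [.op .bor 63 28 28], callProg P,
      block [.op .eq 57 64 13, .op .add 30 30 57, .op .add 28 28 6, .op .sub 29 29 13]])
    (fun j c s' => s'.reg 29 = j ∧ s'.reg 30 = c ∧ c + j ≤ R ∧ Arr AB L s' ∧
      s'.reg 28 + j * MP = s.reg 28 + R * MP ∧
      Used 28 (s.reg 28) (R * MP) s s')
    (vote (oracle P T n L)) (fun c => (oracle P T n L).map fun b => c + b.toNat)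
    (fun _ => rfl) (fun j c => by rw [vote, ← PMF.bind_pure_comp, PMF.bind_bind]; simp)
    (fun j c s' hb' hI => by
      obtain ⟨h29, h30, hc, hA', h28, hU⟩ := hI
      refine ⟨by omega, ?_⟩
      have e13 := (hU.reg 13 (by omega)).trans h13
      have e6 := (hU.reg 6 (by omega)).trans h6
      have hle := hU.le
      rw [add_mul, one_mul] at h28
      set FP := s'.reg 28 with hFP
      refine Sim.subConsDet (T₁ := cap * (2 * n * (25 + 1) + 1 + 40 + 1) + 40)
        (sim_emit (FP := FP) (cap := cap) hb' ((hU.reg 2 (by omega)).trans h2) e13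
        ((hU.reg 3 (by omega)).trans h3) ((hU.reg 11 (by omega)).trans h11) rfl hA' (by omega)
        hL hU.fresh (by omega)) (fun s2 hb2 hI2 => ?_) (by unfold callTime; omega)
      obtain ⟨hx, hr2, hm2⟩ := hI2
      have hT1 : (cap * (2 * n * (25 + 1) + 1 + 40 + 1) + 40 + 1) + 
        ((3 * T + (2 * (P.regBound + 1) + 1) + 1) + 29) = callTime P n cap T := by
        unfold callTime; ring
      have e28 := hr2 28 (by omega)
      rw [← hFP] at e28
      refine Sim.subConsLine _ hb2 ?_ (fun hb3 => ?_)
        (by simp only [List.length_cons, List.length_nil]; omega)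
      · have := hb'.1 28
        simp [execsOk, execOk, Op.eval, e28]; omega
      set s3 := execs [.op .bor 63 28 28] s2 with hs3
      have k63 : s3.reg 63 = FP := by simp [hs3, execs, exec, Op.eval, e28]
      have kr : ∀ r, r ≠ 63 → s3.reg r = s2.reg r := fun r hr => by simp [hs3, execs, exec, hr]
      have km : s3.mem = s2.mem := execs_mem s2 rfl
      rw [oracle, PMF.map_comp, ← PMF.bind_pure_comp]
      have hcall := (sim_callProg (T := T) (N := N) (base := FP) (M := M) (P := P)
        (x := encMasks n L) (by omega) hO.1 hO.2 hb3 k63 (fun a => by rw [km]; exact hx a))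
      rw [← PMF.bind_pure_comp] at hcall
      have := Sim.subConsCall (R' := fun c s' => s'.reg 29 = j ∧ s'.reg 30 = c ∧ c + j ≤ R ∧
          Arr AB L s' ∧ s'.reg 28 + j * MP = s.reg 28 + R * MP ∧
          Used 28 (s.reg 28) (R * MP) s s')
        (qs := [block [.op .eq 57 64 13, .op .add 30 30 57, .op .add 28 28 6,
          .op .sub 29 29 13]]) (L := [])
        (T := callTime P n cap T - (cap * (2 * n * (25 + 1) + 1 + 40 + 1) + 40 + 1) -
          (2 * 1 + 2))
        (g := fun a => PMF.pure (c + (decide (a = 1)).toNat)) hcall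
        (fun a s4 hb4 hI4 => ?_) (by omega)
      · rw [PMF.bind_bind] at this
        simp only [PMF.pure_bind, Function.comp_apply] at this
        exact this
      · obtain ⟨g64, hS⟩ := hI4
        have gr : ∀ r < 49, s4.reg r = s'.reg r := fun r hr => by
          rw [hS.1 r (by omega), kr r (by omega), hr2 r hr]
        have g13 := (gr 13 (by omega)).trans e13
        have g6 := (gr 6 (by omega)).trans e6
        have g28 : s4.reg 28 = FP := gr 28 (by omega)
        have g29 := (gr 29 (by omega)).trans h29
        have g30 := (gr 30 (by omega)).trans h30
        have heq : (if a = 1 then 1 else 0) = (decide (a = 1)).toNat := by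
          by_cases h : a = 1 <;> simp [h]
        have hle1 := Bool.toNat_le (decide (a = 1))
        refine Sim.subConsLine _ hb4 ?_ (fun hb5 => Sim.subEnd hb5 (Sim.nil hb5 ?_)
          (by simp only [List.length_cons, List.length_nil]; omega))
          (by simp only [List.length_cons, List.length_nil]; omega)
        · simp only [execsOk, execOk, exec, Op.eval, State.setReg_reg]
          simp [g64, g13, g6, g28, g29, g30, heq]
          omega
        -- Behind the region the call writes nothing, because `N ≤ MP`, and the encoding does not
        -- extend that far, so the words there are still the zeros of the fresh memory.
        · have hm : ∀ a, a < FP ∨ FP + MP ≤ a → s4.mem a = s'.mem a := fun a ha => by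
            rcases ha with ha | ha
            · rw [hS.2 a (Or.inl ha), km, hm2 a ha]
            · have h1 := length_encMasks_le n L
              have h2 := Nat.mul_le_mul_right (2 * n + 1) hL
              rw [hS.2 a (Or.inr (by omega)), km]
              obtain ⟨i, rfl⟩ := Nat.exists_eq_add_of_le (show FP ≤ a by omega)
              rw [hx i, List.getD_eq_default _ _ (by omega)]
              exact (hU.fresh i).symm
          refine ⟨?_, ?_, by omega, ⟨?_, fun i hi => ?_⟩, ?_, ⟨fun r hr => ?_, fun a ha => ?_, ?_,
            ?_, fun i => ?_⟩⟩
          · simp [execs, exec, Op.eval, g29, g13]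
          · simp only [execs, exec, Op.eval, State.setReg_reg]
            simp [g64, g13, g30, heq]
          · rw [← hA'.1, ← gr 39 (by omega)]; simp [execs, exec]
          · rw [execs_mem _ rfl, hm _ (Or.inl (by omega))]; exact hA'.2 i hi
          · simp [execs, exec, Op.eval, g28, g6]; omega
          · rw [execs_reg (ρ := 28) _ rfl hr, gr r (by omega), hU.reg r hr]
          · rw [execs_mem _ rfl, hm _ (Or.inl (by omega)), hU.mem a ha]
          · simp [execs, exec, Op.eval, g28, g6]; omega
          · simp [execs, exec, Op.eval, g28, g6]; omega
          · have e : (execs [.op .eq 57 64 13, .op .add 30 30 57, .op .add 28 28 6,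
                .op .sub 29 29 13] s4).reg 28 = FP + MP := by
              simp [execs, exec, Op.eval, g28, g6]
            rw [execs_mem _ rfl, e, hm _ (Or.inr (by omega)), add_assoc]
            exact hU.fresh (MP + i))
    (fun c s' h => h.1) R 0 hb1 (by
      refine ⟨by simp [execs, exec, Op.eval, h7], by simp [execs, exec], by omega,
        ⟨by simp [execs, exec, hA.1], fun i hi => ?_⟩, ?_, ⟨fun r hr => execs_reg s rfl hr,
          fun a _ => by rw [execs_mem _ rfl], ?_, ?_, fun i => ?_⟩⟩
      · rw [execs_mem _ rfl]; exact hA.2 i hi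
      · simp [execs, exec]
      · simp [execs, exec]
      · simp [execs, exec]
      · rw [execs_mem _ rfl]; simp [execs, exec, hf i])
  have := Sim.subConsCall (T := R * (callTime P n cap T + 1) + 20 - (2 * 2 + 2))
    (R' := fun c s' => s'.reg 30 = c ∧ c ≤ R ∧ Arr AB L s' ∧
      Used 28 (s.reg 28) (R * MP) s s')
    (g := PMF.pure) (qs := []) (L := []) hloop fun c s2 hb2 hI =>
    Sim.subEnd hb2 (Sim.nil hb2 ⟨hI.2.1, hI.2.2.1, hI.2.2.2.1, hI.2.2.2.2.2⟩)
  rw [PMF.bind_pure] at this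
  exact this

/-- Ask whether there is a solution below the node in register `23`. Register `22` holds the number
of clauses. -/
def queryP (P : Prog) : Prog := block [addPrefixP, voteP P,
  block [.op .add 30 30 30, .op .lt 31 7 30, .op .bor 39 22 22]]

/-- The time for one query. -/
def queryTime (P : Prog) (n cap T R : ℕ) : ℕ :=
  n * (12 * cap + 50 + 1) + 20 + (R * (callTime P n cap T + 1) + 20) + 20

/-- The unit clauses are appended behind `L`, which is a prefix of the extended list, so restoring
the length register restores the array. They remain in memory without effect. The majority is
strict: twice the votes are compared with the number of runs. -/
theorem sim_query {M n AB MP R cap T N v : ℕ} {P : Prog} {L : List ℕ} {s : State}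
    (hb : s.Below M) (h2 : s.reg 2 = n) (h13 : s.reg 13 = 1) (h3 : s.reg 3 = AB)
    (h11 : s.reg 11 = 2 * n) (h6 : s.reg 6 = MP) (h7 : s.reg 7 = R) (h23 : s.reg 23 = v)
    (h24 : s.reg 24 = Nat.log 2 v) (hv : Nat.log 2 v ≤ n) (h22 : s.reg 22 = L.length)
    (hA : Arr AB L s) (hAB : AB + cap ≤ s.reg 28) (hL : L.length + n ≤ cap) (hf : Fresh s)
    (hMP : cap * (2 * n + 1) + 2 ≤ MP) (hN : N ≤ MP) (hM2 : 2 ^ (2 * n) < M) (hR : 2 * R < M)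
    (hM : s.reg 28 + R * MP < M) (hO : RunsOn P T N (encMasks n (addPrefix (Nat.log 2 v) v L))) :
    Sim M (fun b s' => s'.reg 31 = b.toNat ∧ Arr AB L s' ∧
      Used 28 (AB + L.length) (R * MP) s s')
      (queryTime P n cap T R) [queryP P] s (query (oracle P T n) R L v) := by
  have hb28 := hb.1 28
  have hT : (n * (12 * cap + 50 + 1) + 20 + 1) + (R * (callTime P n cap T + 1) + 20 + 19) =
    queryTime P n cap T R := by unfold queryTime; ring
  refine Sim.subConsDet (sim_addPrefix (cap := cap) hb hv h13 hM2 h3 h24 h23 hA (by omega)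
    (by omega)) (fun s2 hb2 hI2 => ?_) (by omega)
  obtain ⟨hA2, hF⟩ := hI2
  have f2 : Used 28 (AB + L.length) 0 s s2 :=
    ⟨fun r hr => hF.1 r (by omega), fun a ha => hF.2 a (by omega), (hF.1 28 (by omega)).ge,
      (hF.1 28 (by omega)).le, fun i => by
        rw [hF.1 28 (by omega), hF.2 _ (by omega)]; exact hf i⟩
  have e28 := hF.1 28 (by omega)
  have hlen := length_addPrefix (Nat.log 2 v) v L
  have hlen2 := (prefix_addPrefix (Nat.log 2 v) v L)
  rw [query, majority, ← PMF.bind_pure_comp]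
  refine Sim.subConsCall (sim_vote (cap := cap) (MP := MP) (R := R) (N := N) (T := T) hb2
    ((f2.reg 2 (by omega)).trans h2)
    ((f2.reg 13 (by omega)).trans h13) ((f2.reg 3 (by omega)).trans h3)
    ((f2.reg 11 (by omega)).trans h11) ((f2.reg 6 (by omega)).trans h6)
    ((f2.reg 7 (by omega)).trans h7) hA2 (by omega) (by omega) f2.fresh hMP hN (by omega) hO)
    (fun c s3 hb3 hI3 => ?_) (by omega)
  obtain ⟨h30, hc, hA3, hU⟩ := hI3
  have hU3 := f2.trans hU le_rfl (by omega) (l := R * MP) (by omega)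
  have e7 := (hU3.reg 7 (by omega)).trans h7
  have e22 := (hU3.reg 22 (by omega)).trans h22
  have hb22 := hb.1 22
  have hd : (if R < c + c then 1 else 0) = (decide (R < 2 * c)).toNat := by
    by_cases h : R < c + c
    · simp [h, two_mul]
    · simp [h, two_mul]
  have hle1 := Bool.toNat_le (decide (R < 2 * c))
  have hM1 : 1 < M := h13 ▸ hb.1 13
  refine Sim.subConsLine _ hb3 ?_ (fun hb4 => Sim.subEnd hb4 (Sim.nil hb4 ?_)
    (by simp only [List.length_cons, List.length_nil]; omega))
    (by simp only [List.length_cons, List.length_nil]; omega)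
  · simp only [execsOk, execOk, exec, Op.eval, State.setReg_reg]
    simp [h30, e7, hd, e22]
    omega
  · refine ⟨?_, ⟨by simp [execs, exec, Op.eval, e22], fun i hi => ?_⟩,
      hU3.trans (Used.of_eq (ρ := 28) (hi := AB + L.length) hU3.fresh
      (fun r hr => execs_reg s3 rfl hr) (by simp [execs, exec]) (execs_mem _ rfl)) le_rfl le_rfl
      (by omega)⟩
    · simp only [execs, exec, Op.eval, State.setReg_reg]
      simp [h30, e7, hd]
    · rw [execs_mem _ rfl, hA3.2 i (by have := hlen2.length_le; omega),
        List.getD_eq_getElem?_getD, List.getD_eq_getElem?_getD]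
      obtain ⟨l, hl⟩ := hlen2
      rw [← hl, List.getElem?_append_left hi]

/-! ### Depth first search by a program -/

/-- Compute the depth of the node in register `23`. -/
def logP : Prog := block [
  block [.const 24 0, .op .shr 26 23 13],
  .loop 26 (block [block [.op .add 24 24 13, .op .shr 26 26 13]])]

theorem sim_log {M n v : ℕ} {s : State} (hb : s.Below M) (h13 : s.reg 13 = 1) (h23 : s.reg 23 = v)
    (hv : Nat.log 2 v ≤ n) :
    Det M (fun s' => s'.reg 24 = Nat.log 2 v ∧
      (∀ r, r ≠ 24 → r ≠ 26 → s'.reg r = s.reg r) ∧ s'.mem = s.mem)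
      (n * (10 + 1) + 20) [logP] s := by
  have hvM : v < M := h23 ▸ hb.1 23
  have hM1 : 1 < M := h13 ▸ hb.1 13
  have hdiv : ∀ k, v / 2 ^ k < M := fun k => lt_of_le_of_lt (Nat.div_le_self _ _) hvM
  refine Sim.subConsLine _ hb ?_ fun hb1 => ?_
  · have := hdiv 1
    simp [execsOk, execOk, exec, Op.eval, h23, h13, Nat.shiftRight_eq_div_pow]
    simp at this; omega
  have hlog : Nat.log 2 v ≤ v := Nat.log_le_self 2 v
  have hloop := Sim.loopDet (M := M) (r := 26) (Tb := 10)
    (p := block [block [.op .add 24 24 13, .op .shr 26 26 13]])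
    (fun j s' => j ≤ Nat.log 2 v ∧ s'.reg 24 = Nat.log 2 v - j ∧
      s'.reg 26 = v / 2 ^ (Nat.log 2 v - j + 1) ∧
      (∀ r, r ≠ 24 → r ≠ 26 → s'.reg r = s.reg r) ∧ s'.mem = s.mem)
    (fun j s' hb' hI => by
      obtain ⟨hj, h24, h26, hr, hm⟩ := hI
      have e13 := (hr 13 (by omega) (by omega)).trans h13
      have hv0 : v ≠ 0 := by rintro rfl; simp at hj
      have hpos : 0 < v / 2 ^ (Nat.log 2 v - (j + 1) + 1) := by
        refine Nat.div_pos ?_ (by positivity)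
        exact (Nat.pow_le_pow_right (by norm_num) (by omega)).trans (Nat.pow_log_le_self 2 hv0)
      refine ⟨by omega, ?_⟩
      have hs : v / 2 ^ (Nat.log 2 v - (j + 1) + 1) / 2 = v / 2 ^ (Nat.log 2 v - j + 1) := by
        rw [Nat.div_div_eq_div_mul, ← pow_succ]; congr 2; omega
      refine Sim.subConsLine _ hb' ?_ fun hb2 => Sim.subEnd hb2 (Sim.nil hb2 ?_)
      · have := hdiv (Nat.log 2 v - j + 1)
        simp [execsOk, execOk, exec, Op.eval, h24, h26, e13, Nat.shiftRight_eq_div_pow]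
        omega
      · refine ⟨by omega, ?_, ?_, fun r h1 h2 => ?_, ?_⟩
        · simp [execs, exec, Op.eval, h24, e13]; omega
        · simp [execs, exec, Op.eval, h26, e13, Nat.shiftRight_eq_div_pow, hs]
        · rw [← hr r h1 h2]; simp [execs, exec, h1, h2]
        · rw [execs_mem _ rfl, hm])
    (fun s' h => by
      rw [h.2.2.1]
      exact Nat.div_eq_of_lt (Nat.lt_pow_succ_log_self (by norm_num) v)) (Nat.log 2 v) hb1 (by
      refine ⟨le_rfl, by simp [execs, exec],
        by simp [execs, exec, Op.eval, h23, h13, Nat.shiftRight_eq_div_pow],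
        fun r h1 h2 => by simp [execs, exec, h1, h2], execs_mem _ rfl⟩)
  have := Nat.mul_le_mul_right (10 + 1) hv
  refine Sim.subConsDet hloop fun s2 hb2 hI => Sim.subEnd hb2 (Sim.nil hb2 ?_)
  exact ⟨by simpa using hI.2.1, hI.2.2.2⟩

theorem strip_two_pow_mul {w : ℕ} (hw : Odd w) (j : ℕ) : strip (2 ^ j * w) = w := by
  induction j with
  | zero => simpa using strip_of_odd (Nat.odd_iff.1 hw)
  | succ j ih =>
    rw [pow_succ', mul_assoc, strip_two_mul (Nat.mul_pos (by positivity) hw.pos), ih]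

/-- Go to the next subtree after the node in register `23`. -/
def advP : Prog := block [
  block [.op .add 23 23 13, .op .band 26 23 13, .op .bxor 26 26 13],
  .loop 26 (block [block [.op .shr 23 23 13, .op .band 26 23 13, .op .bxor 26 26 13]]),
  block [.op .eq 26 23 13, .op .sub 23 23 26]]

/-- Write `v + 1 = 2^k w` with `w` odd; the loop makes exactly `k ≤ n + 1` rounds and leaves `w`.
Subtracting the test `w = 1` sends the end of the search to `0`. -/
theorem sim_adv {M n v : ℕ} {s : State} (hb : s.Below M) (h13 : s.reg 13 = 1)
    (h23 : s.reg 23 = v) (hv : v < 2 ^ (n + 1)) (hM : 2 ^ (n + 1) < M) :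
    Det M (fun s' => s'.reg 23 = adv v ∧
      (∀ r, r ≠ 23 → r ≠ 26 → s'.reg r = s.reg r) ∧ s'.mem = s.mem)
      ((n + 1) * (10 + 1) + 20) [advP] s := by
  have hM1 : 1 < M := h13 ▸ hb.1 13
  obtain ⟨k, w, hw, hkw⟩ := Nat.exists_eq_two_pow_mul_odd (n := v + 1) (by omega)
  have hpar : ∀ j, (2 ^ j * w) % 2 = if j = 0 then 1 else 0 := fun j => by
    rcases j with _ | j
    · simpa using Nat.odd_iff.1 hw
    · rw [pow_succ', mul_assoc]; simp
  have hx : ∀ j, (2 ^ j * w) % 2 ^^^ 1 = if j = 0 then 0 else 1 := fun j => by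
    rw [hpar]; split_ifs <;> rfl
  have hk : k ≤ n + 1 := by
    refine (Nat.pow_le_pow_iff_right (a := 2) (by norm_num)).1 ?_
    have := Nat.mul_le_mul_left (2 ^ k) hw.pos
    omega
  have hle : ∀ j ≤ k, 2 ^ j * w ≤ v + 1 := fun j hj => by
    rw [hkw]; exact Nat.mul_le_mul_right _ (Nat.pow_le_pow_right (by norm_num) hj)
  refine Sim.subConsLine _ hb ?_ fun hb1 => ?_
  · simp [execsOk, execOk, exec, Op.eval, h23, h13, hkw, hx]
    have := hle k le_rfl
    split_ifs <;> omega
  have hloop := Sim.loopDet (M := M) (r := 26) (Tb := 10)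
    (p := block [block [.op .shr 23 23 13, .op .band 26 23 13, .op .bxor 26 26 13]])
    (fun j s' => j ≤ k ∧ s'.reg 23 = 2 ^ j * w ∧ s'.reg 26 = (if j = 0 then 0 else 1) ∧
      (∀ r, r ≠ 23 → r ≠ 26 → s'.reg r = s.reg r) ∧ s'.mem = s.mem)
    (fun j s' hb' hI => by
      obtain ⟨hj, g23, g26, hr, hm⟩ := hI
      have e13 := (hr 13 (by omega) (by omega)).trans h13
      refine ⟨by rw [g26]; simp, ?_⟩
      have hs : 2 ^ (j + 1) * w / 2 = 2 ^ j * w := by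
        rw [pow_succ', mul_assoc]; simp
      refine Sim.subConsLine _ hb' ?_ fun hb2 => Sim.subEnd hb2 (Sim.nil hb2 ?_)
      · simp [execsOk, execOk, exec, Op.eval, g23, e13, Nat.shiftRight_eq_div_pow, hs, hx]
        have := hle j (by omega)
        split_ifs <;> omega
      · refine ⟨by omega, ?_, ?_, fun r h1 h2 => ?_, ?_⟩
        · simp [execs, exec, Op.eval, g23, e13, Nat.shiftRight_eq_div_pow, hs]
        · simp [execs, exec, Op.eval, g23, e13, Nat.shiftRight_eq_div_pow, hs, hx]
        · rw [← hr r h1 h2]; simp [execs, exec, h1, h2]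
        · rw [execs_mem _ rfl, hm])
    (fun s' h => h.2.2.1) k hb1 (by
      refine ⟨le_rfl, by simp [execs, exec, Op.eval, h23, h13, hkw],
        by simp [execs, exec, Op.eval, h23, h13, hkw, hx],
        fun r h1 h2 => by simp [execs, exec, h1, h2], execs_mem _ rfl⟩)
  have := Nat.mul_le_mul_right (10 + 1) hk
  refine Sim.subConsDet hloop fun s2 hb2 hI => ?_
  obtain ⟨-, g23, -, hr, hm⟩ := hI
  rw [pow_zero, one_mul] at g23
  have e13 := (hr 13 (by omega) (by omega)).trans h13
  have hwM : w < M := g23 ▸ hb2.1 23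
  refine Sim.subConsLine _ hb2 ?_ fun hb3 => Sim.subEnd hb3 (Sim.nil hb3 ?_)
  · simp [execsOk, execOk, exec, Op.eval, g23, e13]
    split_ifs <;> omega
  · refine ⟨?_, fun r h1 h2 => ?_, ?_⟩
    · rw [adv, hkw, strip_two_pow_mul hw]
      simp [execs, exec, Op.eval, g23, e13]
      split_ifs <;> omega
    · rw [← hr r h1 h2]; simp [execs, exec, h1, h2]
    · rw [execs_mem _ rfl, hm]

/-! ### One node and the search loop -/

/-- The registers that hold parameters. -/
structure Params (n AB MP R : ℕ) (s : State) : Prop where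
  r2 : s.reg 2 = n
  r3 : s.reg 3 = AB
  r6 : s.reg 6 = MP
  r7 : s.reg 7 = R
  r11 : s.reg 11 = 2 * n
  r12 : s.reg 12 = 2 ^ n
  r13 : s.reg 13 = 1

theorem Params.of_reg {n AB MP R : ℕ} {s s' : State} (h : Params n AB MP R s)
    (hr : ∀ r < 14, s'.reg r = s.reg r) : Params n AB MP R s' :=
  ⟨(hr 2 (by omega)).trans h.r2, (hr 3 (by omega)).trans h.r3, (hr 6 (by omega)).trans h.r6,
    (hr 7 (by omega)).trans h.r7, (hr 11 (by omega)).trans h.r11, (hr 12 (by omega)).trans h.r12,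
    (hr 13 (by omega)).trans h.r13⟩

/-- Inequalities between the parameters. -/
structure Bounds (M n MP R cap N : ℕ) : Prop where
  emit : cap * (2 * n + 1) + 2 ≤ MP
  words : N ≤ MP
  mask : 2 ^ (2 * n) < M
  node : 2 ^ (n + 1) < M
  runs : 2 * R < M

/-- The search at the node in register `23`. -/
def nodeP (P : Prog) : Prog := block [logP, queryP P,
  block [.op .sub 20 20 13, .op .lt 26 23 12, .op .mul 27 31 26, .op .add 19 19 31,
    .op .sub 19 19 27],
  .ite 27 (block [.op .add 23 23 23]) advP,
  block [.op .mul 25 23 20]]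

/-- The time for the search at a node. -/
def nodeTime (P : Prog) (n cap T R : ℕ) : ℕ :=
  n * (10 + 1) + 20 + queryTime P n cap T R + ((n + 1) * (10 + 1) + 20) + 40

theorem log_le_of_lt {n v : ℕ} (hv : v < 2 ^ (n + 1)) : Nat.log 2 v ≤ n := by
  rcases Nat.eq_zero_or_pos v with rfl | h
  · simp
  · have := (Nat.log_lt_iff_lt_pow (b := 2) (by norm_num) h.ne').2 hv
    omega

theorem sim_node {M n AB MP R cap T N v φ S : ℕ} {P : Prog} {L : List ℕ} {s : State}
    (hb : s.Below M) (hp : Params n AB MP R s) (hB : Bounds M n MP R cap N)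
    (h23 : s.reg 23 = v) (hv : v < 2 ^ (n + 1)) (h20 : s.reg 20 = φ + 1) (h19 : s.reg 19 = S)
    (h22 : s.reg 22 = L.length) (hA : Arr AB L s) (hAB : AB + cap ≤ s.reg 28)
    (hL : L.length + n ≤ cap) (hf : Fresh s) (hM : s.reg 28 + R * MP < M) (hS : S + 1 < M)
    (hφ : 2 ^ (n + 1) * (φ + 1) < M)
    (hO : RunsOn P T N (encMasks n (addPrefix (Nat.log 2 v) v L))) :
    Sim M (fun b s' => s'.reg 23 = nextNode n b v ∧ s'.reg 20 = φ ∧ s'.reg 19 = S + leafHit n b v ∧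
      s'.reg 22 = L.length ∧ s'.reg 25 = nextNode n b v * φ ∧ Arr AB L s' ∧
      Used 19 (AB + L.length) (R * MP) s s')
      (nodeTime P n cap T R) [nodeP P] s (query (oracle P T n) R L v) := by
  have hlog := log_le_of_lt hv
  have hT : n * (10 + 1) + 20 + 1 + (queryTime P n cap T R + 1 + ((n + 1) * (10 + 1) + 20 + 38)) =
    nodeTime P n cap T R := by unfold nodeTime; ring
  have hM1 : 1 < M := hp.r13 ▸ hb.1 13
  refine Sim.subConsDet (sim_log hb hp.r13 h23 hlog) (fun s1 hb1 hI1 => ?_) (by omega)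
  obtain ⟨h24, hr1, hm1⟩ := hI1
  have hp1 := hp.of_reg fun r hr => hr1 r (by omega) (by omega)
  have e28 := hr1 28 (by omega) (by omega)
  have hf1 : Fresh s1 := fun i => by rw [hm1, e28]; exact hf i
  have hA1 : Arr AB L s1 := ⟨(hr1 39 (by omega) (by omega)).trans hA.1, fun i hi => by
    rw [hm1]; exact hA.2 i hi⟩
  have h2 := Sim.subConsCall (T := nodeTime P n cap T R - (n * (10 + 1) + 20 + 1)) (L := [])
    (R' := fun b s' => s'.reg 23 = nextNode n b v ∧ s'.reg 20 = φ ∧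
      s'.reg 19 = S + leafHit n b v ∧
      s'.reg 22 = L.length ∧ s'.reg 25 = nextNode n b v * φ ∧ Arr AB L s' ∧
      Used 19 (AB + L.length) (R * MP) s s') (g := PMF.pure) (qs := [
    block [.op .sub 20 20 13, .op .lt 26 23 12, .op .mul 27 31 26, .op .add 19 19 31,
      .op .sub 19 19 27], .ite 27 (block [.op .add 23 23 23]) advP, block [.op .mul 25 23 20]])
    (sim_query (cap := cap) (T := T) (P := P) hb1 hp1.r2 hp1.r13 hp1.r3 hp1.r11 hp1.r6 hp1.r7
    ((hr1 23 (by omega) (by omega)).trans h23) h24 hlog ((hr1 22 (by omega) (by omega)).trans h22)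
    hA1 (by omega) hL hf1 hB.emit hB.words hB.mask hB.runs (by omega) hO)
    (fun b s2 hb2 hI2 => ?_) (by omega)
  · rw [PMF.bind_pure] at h2
    exact h2
  obtain ⟨h31, hA2, hU2⟩ := hI2
  have hp2 := hp1.of_reg fun r hr => hU2.reg r (by omega)
  have k23 := ((hU2.reg 23 (by omega)).trans (hr1 23 (by omega) (by omega))).trans h23
  have k22 := ((hU2.reg 22 (by omega)).trans (hr1 22 (by omega) (by omega))).trans h22
  have k20 := ((hU2.reg 20 (by omega)).trans (hr1 20 (by omega) (by omega))).trans h20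
  have k19 := ((hU2.reg 19 (by omega)).trans (hr1 19 (by omega) (by omega))).trans h19
  have k12 := hp2.r12
  have k13 := hp2.r13
  -- This flag means descent. It is computed as a product, and the answer minus the flag is the
  -- contribution of a leaf, so the count is updated without a branch.
  set c : Bool := decide (b = true ∧ v < 2 ^ n) with hc
  have hlt : b.toNat * (if v < 2 ^ n then 1 else 0) = c.toNat := by
    cases b <;> by_cases h : v < 2 ^ n <;> simp [hc, h]
  have hleaf : S + b.toNat - c.toNat = S + leafHit n b v := by
    cases b <;> by_cases h : v < 2 ^ n <;> simp [hc, leafHit, h, not_le.2, not_lt.1]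
  have hble := Bool.toNat_le b
  have hcle := Bool.toNat_le c
  have hif : (if v < 2 ^ n then 1 else 0) < M := by split_ifs <;> omega
  have hU02 : Used 19 (AB + L.length) (R * MP) s s2 :=
    ⟨fun r hr => (hU2.reg r (by omega)).trans (hr1 r (by omega) (by omega)),
      fun a ha => by rw [hU2.mem a ha, hm1], by have := hU2.le; omega, by have := hU2.ge; omega,
      hU2.fresh⟩
  refine Sim.subConsLine _ hb2 ?_ (fun hb3 => ?_)
    (by simp only [List.length_cons, List.length_nil]; omega)
  · simp only [execsOk, execOk, exec, Op.eval, State.setReg_reg]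
    simp [k23, k20, k19, k12, k13, h31, hlt]
    have := hb2.1 20
    omega
  set s3 := execs [.op .sub 20 20 13, .op .lt 26 23 12, .op .mul 27 31 26, .op .add 19 19 31,
      .op .sub 19 19 27] s2 with hs3
  have l27 : s3.reg 27 = c.toNat := by
    simp only [hs3, execs, exec, Op.eval, State.setReg_reg]
    simp [k23, k12, h31, hlt]
  have l19 : s3.reg 19 = S + leafHit n b v := by
    simp only [hs3, execs, exec, Op.eval, State.setReg_reg]
    simp [k23, k12, k19, h31, hlt, hleaf]
  have l20 : s3.reg 20 = φ := by simp [hs3, execs, exec, Op.eval, k20, k13]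
  have lr : ∀ r, r ≠ 20 → r ≠ 26 → r ≠ 27 → r ≠ 19 → s3.reg r = s2.reg r := by
    intro r h1 h2 h3 h4; simp [hs3, execs, exec, h1, h2, h3, h4]
  have lm : s3.mem = s2.mem := execs_mem s2 rfl
  have hnext := nextNode_lt b hv
  have fin : ∀ (T' : ℕ) (s4 : State), 5 ≤ T' → s4.Below M → s4.reg 23 = nextNode n b v →
      (∀ r, r ≠ 23 → r ≠ 26 → s4.reg r = s3.reg r) → s4.mem = s3.mem →
      Sim M (fun b s' => s'.reg 23 = nextNode n b v ∧ s'.reg 20 = φ ∧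
        s'.reg 19 = S + leafHit n b v ∧
        s'.reg 22 = L.length ∧ s'.reg 25 = nextNode n b v * φ ∧ Arr AB L s' ∧
        Used 19 (AB + L.length) (R * MP) s s') T' [block [block [.op .mul 25 23 20]]] s4
        (PMF.pure b) := by
    intro T' s4 hT' hb4 g23 gr gm
    have g20 := (gr 20 (by omega) (by omega)).trans l20
    have hmul : nextNode n b v * φ < M :=
      lt_of_le_of_lt (Nat.mul_le_mul hnext.le (Nat.le_succ φ)) hφ
    have g28 : s4.reg 28 = s2.reg 28 := (gr 28 (by omega) (by omega)).trans
      (lr 28 (by omega) (by omega) (by omega) (by omega))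
    refine Sim.subConsLine _ hb4 ?_ (fun hb5 => Sim.subEnd hb5 (Sim.nil hb5 ?_)
      (by simp only [List.length_cons, List.length_nil]; omega))
      (by simp only [List.length_cons, List.length_nil]; omega)
    · simp [execsOk, execOk, Op.eval, g23, g20, hmul]
    · have ho : ∀ r, r ≠ 25 → (execs [.op .mul 25 23 20] s4).reg r = s4.reg r := fun r hr => by
        simp [execs, exec, hr]
      refine ⟨by rw [ho 23 (by omega), g23], by rw [ho 20 (by omega), g20],
        by rw [ho 19 (by omega), gr 19 (by omega) (by omega), l19], ?_,
        by simp [execs, exec, Op.eval, g23, g20], ⟨?_, fun i hi => ?_⟩,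
        hU02.trans (Used.of_eq (ρ := 19) (hi := AB + L.length) hU02.fresh (fun r hr => ?_) ?_ ?_)
          le_rfl le_rfl (by omega)⟩
      · rw [ho 22 (by omega), gr 22 (by omega) (by omega),
          lr 22 (by omega) (by omega) (by omega) (by omega), k22]
      · rw [ho 39 (by omega), gr 39 (by omega) (by omega),
          lr 39 (by omega) (by omega) (by omega) (by omega), hA2.1]
      · rw [execs_mem _ rfl, gm, lm]; exact hA2.2 i hi
      · rw [ho r (by omega), gr r (by omega) (by omega),
          lr r (by omega) (by omega) (by omega) (by omega)]
      · rw [ho 28 (by omega), g28]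
      · rw [execs_mem _ rfl, gm, lm]
  have l23 := (lr 23 (by omega) (by omega) (by omega) (by omega)).trans k23
  have l13 := (lr 13 (by omega) (by omega) (by omega) (by omega)).trans k13
  refine Sim.subConsIte (T₀ := (n + 1) * (10 + 1) + 20 + 5) hb3 (fun h0 => ?_) (fun h0 => ?_)
    (by simp only [List.length_cons, List.length_nil]; omega)
  · have hcond : b = true ∧ v < 2 ^ n := by
      by_contra hcon; rw [l27, hc] at h0; simp [hcon] at h0
    have hn : nextNode n b v = v + v := by rw [nextNode, if_pos hcond, two_mul]
    refine Sim.subLine _ hb3 ?_ fun hb4 => fin _ _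
      (by simp only [List.length_cons, List.length_nil]; omega) hb4 ?_ ?_ (execs_mem _ rfl)
    · simp [execsOk, execOk, Op.eval, l23]; have := hB.node; omega
    · simp [execs, exec, Op.eval, l23, hn]
    · intro r h1 _; simp [execs, exec, h1]
  · have hcond : ¬ (b = true ∧ v < 2 ^ n) := by
      intro hcon; rw [l27, hc] at h0; simp [hcon] at h0
    refine Sim.subDet (sim_adv hb3 l13 l23 hv hB.node) fun s4 hb4 hI4 => ?_
    obtain ⟨g23, gr, gm⟩ := hI4
    exact fin _ _ (by omega) hb4 (by rw [g23, nextNode, if_neg hcond]) gr gm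

/-- The statement includes the continuation `K`, because the budget left over is random and its time
and memory must be passed on: `K` may use `T₂` plus the time for `φ'` further nodes. In this way all
trials of a level together pay for `φ` nodes and not for `φ` nodes each. Register `25` holds the
product of node and budget, so one test covers both reasons to stop. -/
theorem sim_dfs {β : Type} {M n AB MP R cap T N T₂ hi : ℕ} {P : Prog} {L : List ℕ}
    {K : List Prog} {R' : β → State → Prop} {g : ℕ × ℕ → PMF β} (hB : Bounds M n MP R cap N)
    (hL : L.length + n ≤ cap) (hhi : hi ≤ AB + L.length)
    (hO : ∀ v < 2 ^ (n + 1), RunsOn P T N (encMasks n (addPrefix (Nat.log 2 v) v L)))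
    (φ v S : ℕ) (s : State) (hb : s.Below M) (hp : Params n AB MP R s)
    (h23 : s.reg 23 = v) (hv : v < 2 ^ (n + 1)) (h20 : s.reg 20 = φ) (h19 : s.reg 19 = S)
    (h22 : s.reg 22 = L.length) (h25 : s.reg 25 = v * φ) (hA : Arr AB L s)
    (hAB : AB + cap ≤ s.reg 28) (hf : Fresh s) (hM : s.reg 28 + φ * (R * MP) < M)
    (hS : S + φ < M) (hφ : 2 ^ (n + 1) * φ < M)
    (hK : ∀ φ' S' s', s'.Below M → s'.reg 20 = φ' → s'.reg 19 = S' → φ' ≤ φ → S' + φ' ≤ S + φ →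
      s'.reg 28 + φ' * (R * MP) ≤ s.reg 28 + φ * (R * MP) →
      Used 19 hi (φ * (R * MP)) s s' →
      Sim M R' (T₂ + φ' * (nodeTime P n cap T R + 1)) K s' (g (φ', S'))) :
    Sim M R' (T₂ + 1 + φ * (nodeTime P n cap T R + 1)) (.loop 25 (nodeP P) :: K) s
      ((dfs n (query (oracle P T n) R L) φ v S).bind g) := by
  induction φ generalizing v S s with
  | zero =>
    rw [dfs, PMF.pure_bind, show T₂ + 1 + 0 * (nodeTime P n cap T R + 1) =
      T₂ + 0 * (nodeTime P n cap T R + 1) + 1 by ring]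
    exact Sim.loop_zero hb (by rw [h25, mul_zero]) (hK 0 S s hb h20 h19 le_rfl le_rfl le_rfl
      ((Used.refl hf).trans (Used.refl hf) le_rfl le_rfl (by omega)))
  | succ φ ih =>
    by_cases h0 : v = 0
    · rw [dfs, if_pos h0, PMF.pure_bind, show T₂ + 1 + (φ + 1) * (nodeTime P n cap T R + 1) =
        T₂ + (φ + 1) * (nodeTime P n cap T R + 1) + 1 by ring]
      exact Sim.loop_zero hb (by rw [h25, h0, zero_mul]) (hK (φ + 1) S s hb h20 h19 le_rfl le_rfl
        le_rfl ((Used.refl hf).trans (Used.refl hf) le_rfl le_rfl (by omega)))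
    · rw [dfs, if_neg h0, PMF.bind_bind, show T₂ + 1 + (φ + 1) * (nodeTime P n cap T R + 1) =
        nodeTime P n cap T R + (T₂ + 1 + φ * (nodeTime P n cap T R + 1)) + 1 by ring]
      have hV : (φ + 1) * (R * MP) = φ * (R * MP) + R * MP := by ring
      rw [hV] at hM
      refine Sim.loop_succ hb (by rw [h25]; positivity) (Sim.call (sim_node hb hp hB h23 hv h20 h19
        h22 hA hAB hL hf (by omega) (by omega) hφ (hO v hv)) fun b s1 hb1 hI1 => ?_)
      obtain ⟨g23, g20, g19, g22, g25, hA1, hU⟩ := hI1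
      have hle := hU.le
      have hge := hU.ge
      have hleaf : leafHit n b v ≤ 1 := by unfold leafHit; split_ifs <;> omega
      have hφ' : 2 ^ (n + 1) * φ ≤ 2 ^ (n + 1) * (φ + 1) := Nat.mul_le_mul_left _ (Nat.le_succ φ)
      refine ih _ _ s1 hb1 (hp.of_reg fun r hr => hU.reg r (by omega)) g23 (nextNode_lt b hv) g20
        g19 g22 g25 hA1 (by omega) hU.fresh (by omega) (by omega) (by omega)
        fun φ' S' s' hb' h1 h2 h3 h4 h5 h6 => hK φ' S' s' hb' h1 h2 (by omega) (by omega)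
          (by omega) ?_
      exact (Used.mk hU.reg (fun a ha => hU.mem a (by omega)) hU.le hU.ge hU.fresh).trans h6 le_rfl
        le_rfl (by omega)

/-! ### The counting algorithm as a program -/

/-- Count the solutions for random hashes, as many as register `18` says. -/
def trialsP (w : ℕ) (P : Prog) : Prog :=
  .loop 18 (block [hashP w,
    block [.op .bor 22 39 39, .const 23 1, .op .bor 25 20 20],
    .loop 25 (nodeP P), block [.op .sub 18 18 13]])

/-- The time for one hash. -/
def hashTime (n w m cap : ℕ) : ℕ :=
  m * (w * (14 * n + 59 + 1) + 20 + (12 * cap + 30) + 10 + 1) + 20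

/-- Time and memory for the searches appear as one term in `φ`, independent of the number of trials;
only hashing is paid for each trial. The bound on count plus remaining budget holds because a query
finds at most one solution, and it limits the counter. -/
theorem sim_trials {M n w m AB MP R cap T N : ℕ} {P : Prog} {L₀ : List ℕ}
    (hB : Bounds M n MP R cap N) (hnm : 0 < n ∨ m = 0) (hw : w < M)
    (hcap : L₀.length + m + n ≤ cap)
    (hO : ∀ L ∈ (hash n w m L₀).support, L.length ≤ L₀.length + m ∧ L₀.length ≤ L.length ∧
      ∀ v < 2 ^ (n + 1), RunsOn P T N (encMasks n (addPrefix (Nat.log 2 v) v L)))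
    (i φ S : ℕ) (s : State) (hb : s.Below M) (hp : Params n AB MP R s)
    (h4 : s.reg 4 = L₀.length) (h15 : s.reg 15 = m) (h18 : s.reg 18 = i) (h20 : s.reg 20 = φ)
    (h19 : s.reg 19 = S) (hmem : ∀ i < L₀.length, s.mem (AB + i) = L₀.getD i 0)
    (hAB : AB + cap ≤ s.reg 28) (hf : Fresh s) (hM : s.reg 28 + φ * (R * MP) < M)
    (hS : S + φ < M) (hφ : 2 ^ (n + 1) * φ < M) :
    Sim M (fun p s' => s'.reg 20 = p.1 ∧ s'.reg 19 = p.2 ∧ p.2 + p.1 ≤ S + φ ∧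
      Used 18 (AB + L₀.length) (φ * (R * MP)) s s')
      (i * (hashTime n w m cap + 40) + φ * (nodeTime P n cap T R + 1) + 1) [trialsP w P] s
      (trials n w m (query (oracle P T n) R) L₀ i (φ, S)) := by
  have hM1 : 1 < M := hp.r13 ▸ hb.1 13
  induction i generalizing φ S s with
  | zero =>
    rw [trials]
    exact (Sim.loop_zero (T := 0) hb h18 (Sim.nil hb ⟨h20, h19, le_rfl,
      (Used.refl hf).trans (Used.refl hf) le_rfl le_rfl (by omega)⟩)).mono (by omega)
  | succ i ih =>
    rw [trials, PMF.bind_bind, show (i + 1) * (hashTime n w m cap + 40) +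
      φ * (nodeTime P n cap T R + 1) + 1 =
      (i * (hashTime n w m cap + 40) + (hashTime n w m cap + 39) +
        φ * (nodeTime P n cap T R + 1) + 1) + 1 by ring]
    refine Sim.loop_succ hb (by omega) ?_
    have hb28 := hb.1 28
    refine Sim.subConsCall (T₁ := hashTime n w m cap) (Sim.support (sim_hash (cap := cap) hb hnm
      hp.r13 hp.r2 hB.mask hw hp.r3 h4
      h15 hmem (by omega) (by omega))) fun L s1 hb1 hI1 => ?_
    obtain ⟨⟨hA1, hF1⟩, hLs⟩ := hI1
    obtain ⟨hLm, hL0, hOL⟩ := hO L hLs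
    have hAB39 := hA1.1
    have e20 := (hF1.1 20 (by omega)).trans h20
    have hφM : φ < M := h20 ▸ hb.1 20
    have hLM : L.length < M := hAB39 ▸ hb1.1 39
    refine Sim.subConsLine _ hb1 ?_ fun hb2 => ?_
    · simp [execsOk, execOk, exec, Op.eval, hAB39, e20]; omega
    set s2 := execs [.op .bor 22 39 39, .const 23 1, .op .bor 25 20 20] s1 with hs2
    have kr : ∀ r, r ≠ 22 → r ≠ 23 → r ≠ 25 → s2.reg r = s1.reg r := fun r h1 h2 h3 => by
      simp [hs2, execs, exec, h1, h2, h3]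
    have km : s2.mem = s1.mem := execs_mem s1 rfl
    have k28 : s2.reg 28 = s.reg 28 := (kr 28 (by omega) (by omega) (by omega)).trans
      (hF1.1 28 (by omega))
    have hU2 : Used 19 (AB + L₀.length) 0 s s2 :=
      ⟨fun r hr => (kr r (by omega) (by omega) (by omega)).trans (hF1.1 r (by omega)),
        fun a ha => by rw [km]; exact hF1.2 a (by omega), k28.ge, k28.le,
        fun i => by rw [km, k28, hF1.2 _ (by omega)]; exact hf i⟩
    have hp2 := hp.of_reg fun r hr => hU2.reg r (by omega)
    refine (Sim.cons (T := (i * (hashTime n w m cap + 40) + 28) + 1 +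
      φ * (nodeTime P n cap T R + 1)) hb2 (sim_dfs (AB := AB) (hi := AB + L₀.length) (cap := cap) (L := L)
      (T := T) (N := N) (R := R) hB (by omega) (by omega) hOL φ 1 S s2 hb2 hp2
      (by simp [hs2, execs, exec]) (by simp) ((kr 20 (by omega) (by omega) (by omega)).trans e20)
      ((kr 19 (by omega) (by omega) (by omega)).trans ((hF1.1 19 (by omega)).trans h19)) (by simp [hs2, execs, exec, Op.eval, hAB39])
      (by simp [hs2, execs, exec, Op.eval, e20])
      ⟨(kr 39 (by omega) (by omega) (by omega)).trans hAB39, fun j hj => by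
        rw [km]; exact hA1.2 j hj⟩ (by omega) hU2.fresh (by omega) hS hφ ?_)).mono
      (by simp only [List.length_cons, List.length_nil]; omega)
    intro φ' S' s3 hb3 g20 g19 hφφ hSS hV hU3
    have hU := hU2.trans hU3 le_rfl le_rfl (l := φ * (R * MP)) (by omega)
    have g18 := (hU.reg 18 (by omega)).trans h18
    have hp3 := hp.of_reg fun r hr => hU.reg r (by omega)
    have g13 := hp3.r13
    refine Sim.subConsLine _ hb3 ?_ fun hb4 => Sim.subEnd hb4 ?_
    · have := hb3.1 18
      simp [execsOk, execOk, Op.eval, g18, g13]; omega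
    set s4 := execs [.op .sub 18 18 13] s3 with hs4
    have lr : ∀ r, r ≠ 18 → s4.reg r = s3.reg r := fun r h1 => by simp [hs4, execs, exec, h1]
    have lm : s4.mem = s3.mem := execs_mem s3 rfl
    have hU4 : Used 18 (AB + L₀.length) (φ * (R * MP)) s s4 :=
      (Used.mk (fun r hr => hU.reg r (by omega)) hU.mem hU.le hU.ge hU.fresh).trans
      (Used.of_eq (ρ := 18) (hi := AB + L₀.length) hU.fresh (fun r hr => lr r (by omega))
        (lr 28 (by omega)) lm) le_rfl le_rfl le_rfl
    have l28 := lr 28 (by omega)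
    have hle := hU.le
    have h2φ : 2 ^ (n + 1) * φ' ≤ 2 ^ (n + 1) * φ := Nat.mul_le_mul_left _ hφφ
    refine ((ih φ' S' s4 hb4 (hp.of_reg fun r hr => hU4.reg r (by omega))
      ((hU4.reg 4 (by omega)).trans h4) ((hU4.reg 15 (by omega)).trans h15)
      (by simp [hs4, execs, exec, Op.eval, g18, g13]) ((lr 20 (by omega)).trans g20)
      ((lr 19 (by omega)).trans g19) (fun j hj => by rw [hU4.mem _ (by omega), hmem j hj])
      (by omega) hU4.fresh (by omega) (by omega) (by omega)).conseq
      fun p s' _ h => ⟨h.1, h.2.1, h.2.2.1.trans hSS, ?_⟩).mono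
      (by simp only [List.length_cons, List.length_nil]; omega)
    have h5 := h.2.2.2
    have h5ge := h5.ge
    have h5le := h5.le
    have h4le := hU4.le
    exact ⟨fun r hr => (h5.reg r hr).trans (hU4.reg r hr),
      fun a ha => (h5.mem a ha).trans (hU4.mem a ha), by omega, by omega, h5.fresh⟩

/-- Try numbers of clauses until the queries suffice. Registers `16` and `17` hold the powers of
`2 ^ w` and `2 ^ w - 1`. -/
def levelsP (w : ℕ) (P : Prog) : Prog := .loop 14 (block [
  block [.op .bor 18 5 5, .op .bor 20 9 9, .const 19 0],
  trialsP w P,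
  .ite 20 (block [.const 14 0]) (block [.op .sub 14 14 13, .op .add 15 15 13, .const 21 (2 ^ w),
    .const 22 (2 ^ w - 1), .op .mul 16 16 21, .op .mul 17 17 22, .const 19 0])])

/-- The time for one number of clauses. -/
def levelTime (P : Prog) (n w cap T R t Φ : ℕ) : ℕ :=
  t * (hashTime n w (n * 2 ^ w) cap + 40) + Φ * (nodeTime P n cap T R + 1) + 50

theorem hashTime_mono {n w m m' cap : ℕ} (h : m ≤ m') :
    hashTime n w m cap ≤ hashTime n w m' cap := by
  unfold hashTime; gcongr

/-- The powers for the scaling factor are maintained next to `m`, so they are available when some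
level succeeds. If no level does, the loop ends with `m = n * 2 ^ w + 1` and count `0`, as in
`levels`. -/
theorem sim_levels {M n w AB MP R cap T N t Φ : ℕ} {P : Prog} {L₀ : List ℕ}
    (hB : Bounds M n MP R cap N) (hw : 2 ^ w < M) (hcap : L₀.length + n * 2 ^ w + n ≤ cap)
    (hO : ∀ m ≤ n * 2 ^ w, ∀ L ∈ (hash n w m L₀).support, L.length ≤ L₀.length + m ∧
      L₀.length ≤ L.length ∧
      ∀ v < 2 ^ (n + 1), RunsOn P T N (encMasks n (addPrefix (Nat.log 2 v) v L)))
    (hφ : 2 ^ (n + 1) * Φ < M) (hpow : (2 ^ w) ^ (n * 2 ^ w + 1) < M)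
    (j m : ℕ) (s : State) (hb : s.Below M) (hp : Params n AB MP R s) (hj : m + j = n * 2 ^ w + 1)
    (h4 : s.reg 4 = L₀.length) (h5 : s.reg 5 = t) (h9 : s.reg 9 = Φ) (h14 : s.reg 14 = j)
    (h15 : s.reg 15 = m) (h16 : s.reg 16 = (2 ^ w) ^ m) (h17 : s.reg 17 = (2 ^ w - 1) ^ m)
    (h19 : s.reg 19 = 0) (hmem : ∀ i < L₀.length, s.mem (AB + i) = L₀.getD i 0)
    (hAB : AB + cap ≤ s.reg 28) (hf : Fresh s) (hM : s.reg 28 + j * (Φ * (R * MP)) < M) :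
    Sim M (fun p s' => p.1 ≤ n * 2 ^ w + 1 ∧ p.2 ≤ Φ ∧ s'.reg 16 = (2 ^ w) ^ p.1 ∧
      s'.reg 17 = (2 ^ w - 1) ^ p.1 ∧ s'.reg 19 = p.2 ∧ s'.reg 5 = t ∧ s'.reg 13 = 1)
      (j * (levelTime P n w cap T R t Φ + 1) + 1) [levelsP w P] s
      (levels (fun m => trials n w m (query (oracle P T n) R) L₀ t (Φ, 0)) j m) := by
  have hM1 : 1 < M := hp.r13 ▸ hb.1 13
  induction j generalizing m s with
  | zero =>
    rw [levels]
    exact (Sim.loop_zero (T := 0) hb h14 (Sim.nil hb ⟨hj.le, Nat.zero_le _, h16, h17, h19, h5,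
      hp.r13⟩)).mono (by omega)
  | succ j ih =>
    rw [levels, show (j + 1) * (levelTime P n w cap T R t Φ + 1) + 1 =
      levelTime P n w cap T R t Φ + (j * (levelTime P n w cap T R t Φ + 1) + 1) + 1 by ring]
    refine Sim.loop_succ hb (by omega) ?_
    have hV : (j + 1) * (Φ * (R * MP)) = j * (Φ * (R * MP)) + Φ * (R * MP) := by ring
    rw [hV] at hM
    have hΦM : Φ < M := h9 ▸ hb.1 9
    have htM : t < M := h5 ▸ hb.1 5
    refine Sim.subConsLine _ hb ?_ (fun hb1 => ?_)
      (by simp only [List.length_cons, List.length_nil]; unfold levelTime; omega)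
    · simp [execsOk, execOk, exec, Op.eval, h5, h9]; omega
    set s1 := execs [.op .bor 18 5 5, .op .bor 20 9 9, .const 19 0] s with hs1
    have kr : ∀ r, r ≠ 18 → r ≠ 20 → r ≠ 19 → s1.reg r = s.reg r := fun r h1 h2 h3 => by
      simp [hs1, execs, exec, h1, h2, h3]
    have km : s1.mem = s.mem := execs_mem s rfl
    have k28 := kr 28 (by omega) (by omega) (by omega)
    have hU1 : Used 18 (AB + L₀.length) 0 s s1 :=
      Used.of_eq hf (fun r hr => kr r (by omega) (by omega) (by omega)) k28 km
    have hn : 0 < n ∨ m = 0 := by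
      rcases Nat.eq_zero_or_pos n with h | h
      · subst h; right; omega
      · exact Or.inl h
    have hT : t * (hashTime n w m cap + 40) + Φ * (nodeTime P n cap T R + 1) + 1 + 49 ≤
        levelTime P n w cap T R t Φ := by
      have := Nat.mul_le_mul_left t (Nat.add_le_add_right (hashTime_mono (n := n) (w := w)
        (cap := cap) (show m ≤ n * 2 ^ w by omega)) 40)
      unfold levelTime; omega
    refine Sim.subConsCall (sim_trials (AB := AB) (MP := MP) (T := T) (N := N) (cap := cap) (P := P)
      (L₀ := L₀) hB hn
      (Nat.lt_two_pow_self.trans hw) (by omega) (hO m (by omega)) t Φ 0 s1 hb1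
      (hp.of_reg fun r hr => hU1.reg r (by omega)) ((hU1.reg 4 (by omega)).trans h4)
      ((hU1.reg 15 (by omega)).trans h15) (by simp [hs1, execs, exec, Op.eval, h5])
      (by simp [hs1, execs, exec, Op.eval, h9]) (by simp [hs1, execs, exec])
      (fun i hi => by rw [km, hmem i hi]) (by omega) hU1.fresh (by omega) (by omega) hφ)
      (fun p s2 hb2 hI2 => ?_)
      (by simp only [List.length_cons, List.length_nil]; omega)
    obtain ⟨g20, g19, hle, hU2⟩ := hI2
    have hU := hU1.trans hU2 le_rfl le_rfl (l := Φ * (R * MP)) (by omega)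
    have hp2 := hp.of_reg fun r hr => hU.reg r (by omega)
    have g13 := hp2.r13
    have g14 := (hU.reg 14 (by omega)).trans h14
    have g15 := (hU.reg 15 (by omega)).trans h15
    have g16 := (hU.reg 16 (by omega)).trans h16
    have g17 := (hU.reg 17 (by omega)).trans h17
    have g5 := (hU.reg 5 (by omega)).trans h5
    refine Sim.subConsIte (T₀ := 20 + (j * (levelTime P n w cap T R t Φ + 1) + 1)) hb2
      (fun h0 => ?_) (fun h0 => ?_)
      (by simp only [List.length_cons, List.length_nil]; omega)
    · rw [if_neg (by omega)]
      refine Sim.subLine _ hb2 ⟨by simp [execOk]; omega, trivial⟩ fun hb3 => Sim.subEnd hb3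
        (Sim.mono (T := 0 + 1) (by simp only [List.length_cons, List.length_nil]; omega)
        (Sim.loop_zero hb3 (by simp [execs, exec]) (Sim.nil hb3 ?_)))
        (by simp only [List.length_cons, List.length_nil]; omega)
      refine ⟨by simp only; omega, by simp only; omega, ?_, ?_, ?_, ?_, ?_⟩ <;>
        simp [execs, exec, g16, g17, g19, g5, g13]
    · rw [if_pos (by omega)]
      have hp1 : (2 ^ w) ^ (m + 1) ≤ (2 ^ w) ^ (n * 2 ^ w + 1) :=
        Nat.pow_le_pow_right (by positivity) (by omega)
      have hp2' : (2 ^ w - 1) ^ (m + 1) ≤ (2 ^ w) ^ (m + 1) :=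
        Nat.pow_le_pow_left (Nat.sub_le _ _) _
      have e1 : (2 ^ w) ^ m * 2 ^ w = (2 ^ w) ^ (m + 1) := (pow_succ _ _).symm
      have e2 : (2 ^ w - 1) ^ m * (2 ^ w - 1) = (2 ^ w - 1) ^ (m + 1) := (pow_succ _ _).symm
      have hmM : m + 1 < M := by
        have h1 : m < 2 ^ m := Nat.lt_two_pow_self
        rcases Nat.eq_zero_or_pos n with h | h
        · subst h; omega
        · rcases Nat.eq_zero_or_pos w with hw0 | hw0
          · subst hw0
            have : m ≤ n := by omega
            have := Nat.lt_two_pow_self (n := n + 1)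
            have := hB.node
            omega
          · have h2 : 2 ^ (m + 1) ≤ (2 ^ w) ^ (m + 1) :=
              Nat.pow_le_pow_left (by simpa using Nat.pow_le_pow_right (n := 2) (by norm_num) hw0) _
            have h3 := Nat.lt_two_pow_self (n := m + 1)
            omega
      refine Sim.subLine _ hb2 ?_ (fun hb3 => Sim.subEnd hb3
        (Sim.mono (T := j * (levelTime P n w cap T R t Φ + 1) + 1)
          (by simp only [List.length_cons, List.length_nil]; omega) ?_)
        (by simp only [List.length_cons, List.length_nil]; omega))
        (by simp only [List.length_cons, List.length_nil]; omega)
      · have := hb2.1 14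
        simp [execsOk, execOk, exec, Op.eval, g14, g13, g15, g16, g17, e1, e2]
        omega
      · set s3 := execs [.op .sub 14 14 13, .op .add 15 15 13, .const 21 (2 ^ w),
          .const 22 (2 ^ w - 1), .op .mul 16 16 21, .op .mul 17 17 22, .const 19 0] s2 with hs3
        have lr : ∀ r < 14, s3.reg r = s2.reg r := fun r hr => execs_reg s2 rfl hr
        have lm : s3.mem = s2.mem := execs_mem s2 rfl
        have l28 : s3.reg 28 = s2.reg 28 := by simp [hs3, execs, exec]
        have hge := hU.ge
        have hle := hU.le
        refine ih (m + 1) s3 hb3 (hp2.of_reg lr) (by omega)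
          ((lr 4 (by omega)).trans ((hU.reg 4 (by omega)).trans h4)) ((lr 5 (by omega)).trans g5)
          ((lr 9 (by omega)).trans ((hU.reg 9 (by omega)).trans h9))
          (by simp [hs3, execs, exec, Op.eval, g14, g13])
          (by simp [hs3, execs, exec, Op.eval, g15, g13])
          (by simp [hs3, execs, exec, Op.eval, g16, e1])
          (by simp [hs3, execs, exec, Op.eval, g17, e2]) (by simp [hs3, execs, exec])
          (fun i hi => by rw [lm, hU.mem _ (by omega), hmem i hi]) (by omega)
          (fun i => by rw [lm, l28]; exact hU.fresh i) (by omega)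

/-- Count the solutions and write the estimate to the registers `0` and `1`. -/
def countP (w : ℕ) (P : Prog) : Prog := block [
  levelsP w P,
  block [.op .mul 20 19 16, .op .add 20 20 20, .op .mul 21 5 17, .op .add 20 20 21,
    .op .add 21 21 21, .op .div 0 20 21, .op .bor 1 13 13]]

theorem sim_count {M n w AB MP R cap T N t Φ : ℕ} {P : Prog} {L₀ : List ℕ}
    (hB : Bounds M n MP R cap N) (hw : 2 ^ w < M) (hcap : L₀.length + n * 2 ^ w + n ≤ cap)
    (hO : ∀ m ≤ n * 2 ^ w, ∀ L ∈ (hash n w m L₀).support, L.length ≤ L₀.length + m ∧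
      L₀.length ≤ L.length ∧
      ∀ v < 2 ^ (n + 1), RunsOn P T N (encMasks n (addPrefix (Nat.log 2 v) v L)))
    (hφ : 2 ^ (n + 1) * Φ < M) (hpow : (2 * Φ + 2 * t + 1) * (2 ^ w) ^ (n * 2 ^ w + 1) < M)
    (s : State) (hb : s.Below M) (hp : Params n AB MP R s)
    (h4 : s.reg 4 = L₀.length) (h5 : s.reg 5 = t) (h9 : s.reg 9 = Φ)
    (h14 : s.reg 14 = n * 2 ^ w + 1)
    (h15 : s.reg 15 = 0) (h16 : s.reg 16 = 1) (h17 : s.reg 17 = 1)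
    (h19 : s.reg 19 = 0) (hmem : ∀ i < L₀.length, s.mem (AB + i) = L₀.getD i 0)
    (hAB : AB + cap ≤ s.reg 28) (hf : Fresh s)
    (hM : s.reg 28 + (n * 2 ^ w + 1) * (Φ * (R * MP)) < M) :
    Sim M (fun p s' => s'.reg 0 = output w t p.1 p.2 ∧ s'.reg 1 = 1)
      ((n * 2 ^ w + 1) * (levelTime P n w cap T R t Φ + 1) + 30) [countP w P] s
      (levels (fun m => trials n w m (query (oracle P T n) R) L₀ t (Φ, 0)) (n * 2 ^ w + 1) 0) := by
  set X := (2 ^ w) ^ (n * 2 ^ w + 1) with hX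
  have hexp : (2 * Φ + 2 * t + 1) * X = 2 * (Φ * X) + 2 * (t * X) + X := by ring
  rw [hexp] at hpow
  have := Sim.subConsCall (T := (n * 2 ^ w + 1) * (levelTime P n w cap T R t Φ + 1) + 30)
    (R' := fun (p : ℕ × ℕ) s' => s'.reg 0 = output w t p.1 p.2 ∧ s'.reg 1 = 1)
    (g := PMF.pure) (L := []) (qs := [
      block [.op .mul 20 19 16, .op .add 20 20 20, .op .mul 21 5 17, .op .add 20 20 21,
        .op .add 21 21 21, .op .div 0 20 21, .op .bor 1 13 13]])
    (sim_levels hB hw hcap hO hφ (by omega) (n * 2 ^ w + 1) 0 s hb hp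
    (by omega) h4 h5 h9 h14 h15 (by simpa using h16) (by simpa using h17) h19 hmem hAB hf hM)
    fun p s1 hb1 hI1 => ?_
  · rw [PMF.bind_pure] at this
    exact this
  · obtain ⟨hp1, hp2, g16, g17, g19, g5, g13⟩ := hI1
    have hM1 : 1 < M := g13 ▸ hb1.1 13
    have e1 : (2 ^ w) ^ p.1 ≤ X := Nat.pow_le_pow_right (by positivity) hp1
    have e2 : (2 ^ w - 1) ^ p.1 ≤ (2 ^ w) ^ p.1 := Nat.pow_le_pow_left (Nat.sub_le _ _) _
    have e3 : p.2 * (2 ^ w) ^ p.1 ≤ Φ * X := Nat.mul_le_mul hp2 e1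
    have e4 : t * (2 ^ w - 1) ^ p.1 ≤ t * X := Nat.mul_le_mul_left _ (e2.trans e1)
    have hout : (p.2 * (2 ^ w) ^ p.1 + p.2 * (2 ^ w) ^ p.1 + t * (2 ^ w - 1) ^ p.1) /
        (t * (2 ^ w - 1) ^ p.1 + t * (2 ^ w - 1) ^ p.1) = output w t p.1 p.2 := by
      rw [output]; congr 1 <;> ring
    have hle := Nat.div_le_self
      (p.2 * (2 ^ w) ^ p.1 + p.2 * (2 ^ w) ^ p.1 + t * (2 ^ w - 1) ^ p.1)
      (t * (2 ^ w - 1) ^ p.1 + t * (2 ^ w - 1) ^ p.1)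
    refine Sim.subConsLine _ hb1 ?_ fun hb2 => Sim.subEnd hb2 (Sim.nil hb2 ⟨?_, ?_⟩)
    · simp [execsOk, execOk, exec, Op.eval, g16, g17, g19, g5, g13]
      omega
    · simp [execs, exec, Op.eval, g16, g17, g19, g5, g13, hout]
    · simp [execs, exec, Op.eval, g16, g17, g19, g5, g13]

/-! ### Reading the input -/

/-- The list stands in the memory from the address `p` on. -/
def Reads (p : ℕ) (l : List ℕ) (s : State) : Prop := ∀ i < l.length, s.mem (p + i) = l.getD i 0

theorem reads_cons {p x : ℕ} {l : List ℕ} {s : State} :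
    Reads p (x :: l) s ↔ s.mem p = x ∧ Reads (p + 1) l s := by
  constructor
  · refine fun h => ⟨by simpa using h 0 (by simp), fun i hi => ?_⟩
    have := h (i + 1) (by simpa using hi)
    rw [add_assoc, add_comm 1 i]; simpa using this
  · rintro ⟨h0, h⟩ (_ | i) hi
    · simpa using h0
    · have := h i (by simpa using hi)
      rw [add_assoc, add_comm 1 i] at this; simpa using this

theorem reads_append {p : ℕ} {l m : List ℕ} {s : State} :
    Reads p (l ++ m) s ↔ Reads p l s ∧ Reads (p + l.length) m s := by
  induction l generalizing p with
  | nil => simp [Reads]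
  | cons x l ih =>
    rw [List.cons_append, reads_cons, reads_cons, ih, and_assoc, List.length_cons,
      show p + 1 + l.length = p + (l.length + 1) by ring]

theorem Reads.of_mem {p : ℕ} {l : List ℕ} {s s' : State} (h : Reads p l s)
    (hm : ∀ a, p ≤ a → a < p + l.length → s'.mem a = s.mem a) : Reads p l s' := fun i hi => by
  rw [hm _ (by omega) (by omega), h i hi]

/-- Read the literals of a clause. -/
def readLitsP : Prog := .loop 23 (block [block [.load 24 21, .op .shl 24 13 24,
  .op .bor 40 40 24, .op .add 21 21 13, .op .sub 23 23 13]])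

theorem sim_readLits {M n : ℕ} (hM : 2 ^ (2 * n) < M) (ls : List ℕ) (hls : ∀ l ∈ ls, l < 2 * n)
    (acc p : ℕ) (s : State) (hb : s.Below M) (h13 : s.reg 13 = 1) (h23 : s.reg 23 = ls.length)
    (h21 : s.reg 21 = p) (h40 : s.reg 40 = acc) (hacc : acc < 2 ^ (2 * n))
    (hr : Reads p ls s) (hp : p + ls.length < M) :
    Det M (fun s' => s'.reg 40 = orMask acc ls ∧ s'.reg 21 = p + ls.length ∧
      (∀ r, r ≠ 21 → r ≠ 23 → r ≠ 24 → r ≠ 40 → s'.reg r = s.reg r) ∧ s'.mem = s.mem)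
      (ls.length * 16 + 1) [readLitsP] s := by
  induction ls generalizing acc p s with
  | nil =>
    exact Sim.loop_zero (T := 0) hb h23 (Sim.nil hb ⟨h40, by simpa using h21,
      fun _ _ _ _ _ => rfl, rfl⟩)
  | cons l ls ih =>
    obtain ⟨hr0, hr1⟩ := reads_cons.1 hr
    have hl := hls l (by simp)
    have hpow : 2 ^ l < 2 ^ (2 * n) := Nat.pow_lt_pow_right (by omega) hl
    have hor := Nat.or_lt_two_pow hacc hpow
    simp only [List.length_cons] at h23 hp ⊢
    refine Sim.mono (T := ls.length * 16 + 1 + 15 + 1) (by omega) (Sim.loop_succ hb (by omega) ?_)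
    refine Sim.subConsLine _ hb ?_ fun hb1 => Sim.subEnd hb1 ?_
    · have := hb.1 23
      simp [execsOk, execOk, exec, Op.eval, h21, hr0, h13, h40, h23, Nat.one_shiftLeft]
      omega
    · refine ((ih (fun l' h => hls l' (by simp [h])) (acc ||| 1 <<< l) (p + 1) _ hb1
        (by simp [execs, exec, h13]) (by simp [execs, exec, Op.eval, h23, h13])
        (by simp [execs, exec, Op.eval, h21, h13])
        (by simp [execs, exec, Op.eval, h21, hr0, h13, h40])
        (by rwa [Nat.one_shiftLeft]) (hr1.of_mem fun _ _ _ => by rw [execs_mem _ rfl])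
        (by omega)).conseq fun _ s' _ h => ⟨h.1, by rw [h.2.1]; omega, fun r h1 h2 h3 h4 => ?_,
        ?_⟩).mono (by simp only [List.length_cons, List.length_nil]; omega)
      · rw [h.2.2.1 r h1 h2 h3 h4]; simp [execs, exec, h1, h2, h3, h4]
      · rw [h.2.2.2, execs_mem _ rfl]

/-- Read the clauses and write their masks to the array. -/
def readP : Prog := .loop 22 (block [
  block [.load 23 21, .op .add 21 21 13, .const 40 0], readLitsP, addMaskP,
  block [.op .sub 22 22 13]])

/-- The array starts behind the whole input, so writing masks never destroys clauses that are still
to be read; this is the role of `hp`. -/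
theorem sim_read {M n k AB cap : ℕ} (hM : 2 ^ (2 * n) < M) (hMc : AB + cap < M)
    (Cs : List (List ℕ)) (hk : ∀ C ∈ Cs, C.length ≤ k) (hls : ∀ C ∈ Cs, ∀ l ∈ C, l < 2 * n)
    (L : List ℕ) (p : ℕ) (s : State) (hb : s.Below M) (h13 : s.reg 13 = 1) (h3 : s.reg 3 = AB)
    (h22 : s.reg 22 = Cs.length) (h21 : s.reg 21 = p) (hA : Arr AB L s)
    (hcap : L.length + Cs.length ≤ cap) (hr : Reads p (Cs.flatMap fun C => C.length :: C) s)
    (hp : p + (Cs.flatMap fun C => C.length :: C).length ≤ AB) :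
    Det M (fun s' => Arr AB ((Cs.map (orMask 0)).foldl addMask L) s' ∧
      (∀ r < 39, r ≠ 21 → r ≠ 22 → r ≠ 23 → r ≠ 24 → s'.reg r = s.reg r) ∧
      ∀ a, AB + cap ≤ a → s'.mem a = s.mem a)
      (Cs.length * (k * 16 + 12 * cap + 60) + 1) [readP] s := by
  induction Cs generalizing L p s with
  | nil =>
    exact Sim.mono (T := 0 + 1) (by simp) (Sim.loop_zero (T := 0) hb h22
      (Sim.nil hb ⟨hA, fun _ _ _ _ _ _ => rfl, fun _ _ => rfl⟩))
  | cons C Cs ih =>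
    rw [List.flatMap_cons, List.cons_append] at hr hp
    obtain ⟨hr0, hr1⟩ := reads_cons.1 hr
    obtain ⟨hr1, hr2⟩ := reads_append.1 hr1
    have hCk := hk C (by simp)
    simp only [List.length_cons, List.length_append] at h22 hp hcap ⊢
    refine Sim.mono (T := Cs.length * (k * 16 + 12 * cap + 60) + 1 + (k * 16 + 12 * cap + 59) + 1)
      (by rw [add_mul]; omega) (Sim.loop_succ hb (by omega) ?_)
    refine Sim.subConsLine _ hb ?_ fun hb1 => ?_
    · have := hb.2 p
      simp [execsOk, execOk, exec, Op.eval, h21, hr0, h13]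
      omega
    set s1 := execs [.load 23 21, .op .add 21 21 13, .const 40 0] s with hs1
    have kr : ∀ r, r ≠ 21 → r ≠ 23 → r ≠ 40 → s1.reg r = s.reg r := fun r h1 h2 h3 => by
      simp [hs1, execs, exec, h1, h2, h3]
    have km : s1.mem = s.mem := execs_mem s rfl
    refine Sim.subConsDet (sim_readLits hM C (hls C (by simp)) 0 (p + 1) s1 hb1
      ((kr 13 (by omega) (by omega) (by omega)).trans h13) (by simp [hs1, execs, exec, h21, hr0])
      (by simp [hs1, execs, exec, Op.eval, h21, h13]) (by simp [hs1, execs, exec]) (by positivity)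
      (hr1.of_mem fun _ _ _ => by rw [km]) (by omega)) (fun s2 hb2 hI2 => ?_)
      (by simp only [List.length_cons, List.length_nil]; omega)
    obtain ⟨g40, g21, gr, gm⟩ := hI2
    have gr' : ∀ r, r ≠ 21 → r ≠ 23 → r ≠ 24 → r ≠ 40 → s2.reg r = s.reg r := fun r h1 h2 h3 h4 =>
      (gr r h1 h2 h3 h4).trans (kr r h1 h2 h4)
    have e13 := (gr' 13 (by omega) (by omega) (by omega) (by omega)).trans h13
    refine Sim.subConsDet (sim_addMask (cap := cap) hb2 e13
      ((gr' 3 (by omega) (by omega) (by omega) (by omega)).trans h3)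
      (L := L) ⟨(gr' 39 (by omega) (by omega) (by omega) (by omega)).trans hA.1, fun i hi => by
        rw [gm, km]; exact hA.2 i hi⟩ (by omega) hMc) (fun s3 hb3 hI3 => ?_)
      (by simp only [List.length_cons, List.length_nil]; omega)
    obtain ⟨hA3, hF3⟩ := hI3
    rw [g40] at hA3
    have e3 : ∀ r < 39, r ≠ 21 → r ≠ 23 → r ≠ 24 → s3.reg r = s.reg r := fun r h h1 h2 h3 =>
      (hF3.1 r h).trans (gr' r h1 h2 h3 (by omega))
    have m3 : ∀ a, a < AB ∨ AB + cap ≤ a → s3.mem a = s.mem a := fun a ha => by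
      rw [hF3.2 a (by omega), gm, km]
    have k13 := (e3 13 (by omega) (by omega) (by omega) (by omega)).trans h13
    have k22 := (e3 22 (by omega) (by omega) (by omega) (by omega)).trans h22
    refine Sim.subConsLine _ hb3 ?_ (fun hb4 => Sim.subEnd hb4 ?_
      (by simp only [List.length_cons, List.length_nil]; omega))
      (by simp only [List.length_cons, List.length_nil]; omega)
    · have := hb.1 22
      simp [execsOk, execOk, Op.eval, k13, k22]; omega
    · set s4 := execs [.op .sub 22 22 13] s3 with hs4
      have lr : ∀ r, r ≠ 22 → s4.reg r = s3.reg r := fun r h => by simp [hs4, execs, exec, h]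
      have lm : s4.mem = s3.mem := execs_mem s3 rfl
      have hlen := length_addMask L (orMask 0 C)
      refine ((ih (fun C h => hk C (by simp [h])) (fun C h => hls C (by simp [h]))
        (addMask L (orMask 0 C)) (p + 1 + C.length) s4 hb4 ((lr 13 (by omega)).trans k13)
        ((lr 3 (by omega)).trans ((e3 3 (by omega) (by omega) (by omega) (by omega)).trans h3))
        (by simp [hs4, execs, exec, Op.eval, k13, k22])
        ((lr 21 (by omega)).trans ((hF3.1 21 (by omega)).trans g21))
        ⟨(lr 39 (by omega)).trans hA3.1, fun i hi => by rw [lm]; exact hA3.2 i hi⟩ (by omega)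
        (hr2.of_mem fun a h1 h2 => by rw [lm, m3 a (by omega)]) (by omega)).conseq
        fun _ s' _ h => ⟨?_, fun r h0 h1 h2 h3 h4 => ?_, fun a ha => ?_⟩).mono
        (by simp only [List.length_cons, List.length_nil]; omega)
      · simpa using h.1
      · rw [h.2.1 r h0 h1 h2 h3 h4, lr r h2, e3 r h0 h1 h3 h4]
      · rw [h.2.2 a ha, lm, m3 a (Or.inr ha)]

theorem execs_replicate_mul (x y k : ℕ) (hxy : x ≠ y) (s : State) :
    (∀ r, r ≠ x → (execs (List.replicate k (.op .mul x x y)) s).reg r = s.reg r) ∧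
    (execs (List.replicate k (.op .mul x x y)) s).reg x = s.reg x * s.reg y ^ k ∧
    (execs (List.replicate k (.op .mul x x y)) s).mem = s.mem := by
  induction k generalizing s with
  | zero => simp [execs]
  | succ k ih =>
    obtain ⟨h1, h2, h3⟩ := ih (s.setReg x (s.reg x * s.reg y))
    refine ⟨fun r hr => ?_, ?_, h3⟩
    · exact (h1 r hr).trans (by simp [hr])
    · refine h2.trans ?_
      simp [hxy.symm, pow_succ']; ring

theorem execsOk_replicate_mul {M : ℕ} (x y k : ℕ) (hxy : x ≠ y) (s : State) (hy : 0 < s.reg y)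
    (hM : s.reg x * s.reg y ^ k < M) : execsOk M (List.replicate k (.op .mul x x y)) s := by
  induction k generalizing s with
  | zero => trivial
  | succ k ih =>
    rw [pow_succ', ← mul_assoc] at hM
    refine ⟨lt_of_le_of_lt (Nat.le_mul_of_pos_right _ (pow_pos hy k)) hM, ih _ ?_ ?_⟩
    · simpa [exec, hxy.symm] using hy
    · simpa [exec, Op.eval, hxy.symm] using hM

/-! ### The parameters -/

/-- The size of the array of masks. -/
def arraySize (k w n : ℕ) : ℕ := (2 * n + 1) ^ k + n * 2 ^ w + n + 1

/-- The number of memory words for one oracle call. -/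
def regionSize (k w c C n : ℕ) : ℕ := (2 * (arraySize k w n * (2 * n + 1)) + C * 2 ^ n) ^ (c + 1)

/-- The number of binary digits of the precision, where `l₁` and `l₂` are the numbers of binary
digits of the numerator and the denominator of the error bound. -/
def precision (l₁ l₂ n : ℕ) : ℕ := min (l₂ + 2 - l₁) (n + 2)

/-- The number of trials. -/
def numTrials (g e d n : ℕ) : ℕ := 2 ^ (2 * d + (n / g + e))

/-- The number of queries. -/
def fuel (g e d n : ℕ) : ℕ := numTrials g e d n * (8 * n + 2)

/-- The number of oracle calls for one query. -/
def numRuns (r n : ℕ) : ℕ := 2 * (48 * n + r)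

/-- Compute the number of variables and the sizes that depend on it. -/
def headerP : List Prog := [.const 13 1, .load 25 20, .load 26 13, .op .add 21 25 26,
  .op .add 21 21 13, .op .add 21 21 13, .load 2 21, .op .add 21 21 13, .load 22 21,
  .op .add 21 21 13, .op .add 11 2 2, .op .shl 12 13 2, .op .add 31 11 13, .const 30 1]

/-- Compute the layout of the memory. -/
def layoutP (k w C : ℕ) : List Prog := [.const 32 (k + 1), .op .mul 32 32 30, .op .add 3 21 32,
  .const 33 (2 ^ w), .op .mul 33 33 2, .op .add 14 33 13, .op .add 27 30 33, .op .add 27 27 2,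
  .op .add 27 27 13, .op .add 28 3 27, .op .mul 34 27 31, .op .add 34 34 34, .const 35 C,
  .op .mul 35 35 12, .op .add 34 34 35, .const 6 1]

/-- Compute the numbers of trials, queries and runs. -/
def numbersP (g e r : ℕ) : List Prog := [.op .add 36 26 13, .op .add 36 36 13, .op .sub 36 36 25,
  .const 37 2, .op .add 37 37 2, .op .sub 38 36 37, .op .sub 36 36 38, .op .add 36 36 36,
  .const 37 g, .op .div 37 2 37, .op .add 36 36 37, .const 37 e, .op .add 36 36 37,
  .op .shl 5 13 36, .op .add 37 11 11, .op .add 37 37 37, .op .add 37 37 13, .op .add 37 37 13,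
  .op .mul 9 5 37, .const 37 96, .op .mul 37 37 2, .const 38 (2 * r), .op .add 7 37 38]

/-- Read the input and compute all parameters. -/
def initP (k w c C g e r : ℕ) : List Prog := [
  block headerP, block (List.replicate k (.op .mul 30 30 31)),
  block (layoutP k w C), block (List.replicate (c + 1) (.op .mul 6 6 34)),
  block (numbersP g e r), readP,
  block [.op .bor 4 39 39, .const 15 0, .const 16 1, .const 17 1, .const 19 0]]

/-- The address of the array. -/
def arrayBase (k l₁ l₂ n : ℕ) : ℕ := l₁ + l₂ + 4 + (k + 1) * (2 * n + 1) ^ k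

/-- The initial values of the registers and the memory. -/
structure Ready (AB cap MP R t Φ n w : ℕ) (L₀ : List ℕ) (s : State) : Prop where
  params : Params n AB MP R s
  r4 : s.reg 4 = L₀.length
  r5 : s.reg 5 = t
  r9 : s.reg 9 = Φ
  r14 : s.reg 14 = n * 2 ^ w + 1
  r15 : s.reg 15 = 0
  r16 : s.reg 16 = 1
  r17 : s.reg 17 = 1
  r19 : s.reg 19 = 0
  array : ∀ i < L₀.length, s.mem (AB + i) = L₀.getD i 0
  r28 : s.reg 28 = AB + cap
  fresh : Fresh s

/-- Two truncated subtractions `x - (x - y)` compute the minimum that caps the precision, and the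
number of trials is a power of two obtained by one shift. Intermediate words are bounded by the
final ones, since `t` exceeds its own exponent. -/
theorem numbersP_spec {M n l₁ l₂ g e r d t Φ Rn : ℕ} {s : State} (h2 : s.reg 2 = n)
    (h11 : s.reg 11 = 2 * n) (h13 : s.reg 13 = 1) (h25 : s.reg 25 = l₁) (h26 : s.reg 26 = l₂)
    (hd : l₂ + 1 + 1 - l₁ - (l₂ + 1 + 1 - l₁ - (2 + n)) = d) (ht : 2 ^ (d + d + n / g + e) = t)
    (hΦ : t * (2 * n + 2 * n + (2 * n + 2 * n) + 1 + 1) = Φ) (hR : 96 * n + 2 * r = Rn)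
    (hl : l₂ + 2 < M) (hg : g < M) (hΦM : Φ < M) (hRM : Rn < M) (h96 : 96 < M) :
    execsOk M (numbersP g e r) s ∧ (execs (numbersP g e r) s).reg 5 = t ∧
      (execs (numbersP g e r) s).reg 9 = Φ ∧ (execs (numbersP g e r) s).reg 7 = Rn := by
  have hz := Nat.div_le_self n g
  obtain ⟨z, hzn⟩ : ∃ z, n / g = z := ⟨_, rfl⟩
  rw [← Nat.one_shiftLeft, hzn] at ht
  rw [hzn] at hz
  have hEt : d + d + z + e < t := by rw [← ht, Nat.one_shiftLeft]; exact Nat.lt_two_pow_self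
  obtain ⟨u, hu⟩ := Nat.exists_eq_add_of_le (show 1 ≤ t by omega)
  have htΦ : t + (2 * n + 2 * n + (2 * n + 2 * n) + 1 + 1) ≤ Φ + 1 := by
    rw [← hΦ, hu]; nlinarith [Nat.zero_le (u * n)]
  refine ⟨?_, ?_, ?_, ?_⟩
  · simp [numbersP, execsOk, execOk, exec, Op.eval, h2, h11, h13, h25, h26, hd, hzn, ht, hΦ, hR]
    omega
  · simp [numbersP, execs, exec, Op.eval, h2, h13, h25, h26, hd, hzn, ht]
  · simp [numbersP, execs, exec, Op.eval, h2, h11, h13, h25, h26, hd, hzn, ht, hΦ]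
  · simp [numbersP, execs, exec, Op.eval, h2, hR]

theorem layoutP_spec {M n k w C q b cap AB Y : ℕ} {s : State} (h30 : s.reg 30 = q)
    (h2 : s.reg 2 = n) (h13 : s.reg 13 = 1) (h12 : s.reg 12 = 2 ^ n) (h21 : s.reg 21 = b)
    (h31 : s.reg 31 = 2 * n + 1) (hAB : b + (k + 1) * q = AB)
    (hcap : q + n * 2 ^ w + n + 1 = cap)
    (hY : cap * (2 * n + 1) + cap * (2 * n + 1) + C * 2 ^ n = Y) (hq : 1 ≤ q)
    (hM : AB + cap < M) (hw : 2 ^ w < M) (hYM : Y < M) :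
    execsOk M (layoutP k w C) s ∧ (execs (layoutP k w C) s).reg 3 = AB ∧
      (execs (layoutP k w C) s).reg 14 = n * 2 ^ w + 1 ∧
      (execs (layoutP k w C) s).reg 28 = AB + cap ∧
      (execs (layoutP k w C) s).reg 34 = Y ∧ (execs (layoutP k w C) s).reg 6 = 1 := by
  have e2w : 2 ^ w * n = n * 2 ^ w := mul_comm _ _
  have ekq : k + 1 ≤ (k + 1) * q := Nat.le_mul_of_pos_right _ hq
  have hC : C ≤ C * 2 ^ n := Nat.le_mul_of_pos_right _ (by positivity)
  refine ⟨?_, ?_, ?_, ?_, ?_, ?_⟩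
  · simp [layoutP, execsOk, execOk, exec, Op.eval, h30, h2, h13, h12, h21, h31, e2w, hAB, hcap, hY]
    omega
  · simp [layoutP, execs, exec, Op.eval, h30, h21, hAB]
  · simp [layoutP, execs, exec, Op.eval, h2, h13, e2w]
  · simp [layoutP, execs, exec, Op.eval, h30, h2, h13, h21, e2w, hAB, hcap]
  · simp [layoutP, execs, exec, Op.eval, h30, h2, h13, h12, h31, e2w, hcap, hY]
  · simp [layoutP, execs, exec]

-- Only the lengths of the numerator and denominator of `ε` are read; the digits are skipped, so the
-- time of this part does not depend on `ε`. The array is placed behind the largest possible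
-- formula, and all memory behind the array is still zero.
set_option maxHeartbeats 1000000 in
theorem sim_init {α : Type} {M T n k w c C g e r l₁ l₂ : ℕ} {ds : List ℕ} {Cs : List (List ℕ)}
    {R : α → State → Prop} {f : PMF α} {ps : List Prog} {x : List ℕ} {s : State}
    (hx : x = l₁ :: l₂ :: (ds ++ n :: Cs.length :: Cs.flatMap fun C => C.length :: C))
    (hds : ds.length = l₁ + l₂) (hk : ∀ C ∈ Cs, C.length ≤ k)
    (hls : ∀ C ∈ Cs, ∀ l ∈ C, l < 2 * n) (hCs : Cs.length ≤ (2 * n + 1) ^ k)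
    (hb : s.Below M) (hreg : ∀ r, s.reg r = 0) (hmem : ∀ a, s.mem a = x.getD a 0)
    (hM0 : 2 ^ (2 * n) + n + n < M) (hMc : arrayBase k l₁ l₂ n + arraySize k w n < M)
    (hMP : regionSize k w c C n < M) (hMw : 2 ^ w < M) (hMg : g < M)
    (hMt : fuel g e (precision l₁ l₂ n) n < M) (hMr : numRuns r n < M) (h96 : 96 < M)
    (h : ∀ s', s'.Below M →
      Ready (arrayBase k l₁ l₂ n) (arraySize k w n) (regionSize k w c C n) (numRuns r n)
        (numTrials g e (precision l₁ l₂ n) n) (fuel g e (precision l₁ l₂ n) n) n w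
        ((Cs.map (orMask 0)).foldl addMask []) s' → Sim M R T (block ps :: []) s' f) :
    Sim M R (T + ((2 * n + 1) ^ k * (k * 16 + 12 * arraySize k w n + 60) + 2 * k + 2 * c + 200))
      [block (initP k w c C g e r ++ ps)] s f := by
  obtain ⟨Y, hY⟩ : ∃ Y, Y = 2 * (arraySize k w n * (2 * n + 1)) + C * 2 ^ n := ⟨_, rfl⟩
  have hMM : regionSize k w c C n = Y ^ (c + 1) := by rw [hY, regionSize]
  obtain ⟨d, hd⟩ : ∃ d, d = precision l₁ l₂ n := ⟨_, rfl⟩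
  have hΦ : fuel g e d n = numTrials g e d n * (8 * n + 2) := rfl
  have ht : 2 ^ (d + d + n / g + e) = numTrials g e d n := by rw [numTrials]; congr 1; ring
  have hd' : l₂ + 1 + 1 - l₁ - (l₂ + 1 + 1 - l₁ - (2 + n)) = d := by
    rw [hd]; unfold precision; omega
  rw [← hd] at hMt h
  have hcap : arraySize k w n = (2 * n + 1) ^ k + n * 2 ^ w + n + 1 := rfl
  have hAB : arrayBase k l₁ l₂ n = l₁ + l₂ + 4 + (k + 1) * (2 * n + 1) ^ k := rfl
  have hRn : 96 * n + 2 * r = numRuns r n := by unfold numRuns; ring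
  generalize numRuns r n = Rn at *
  generalize fuel g e d n = Φ at *
  generalize numTrials g e d n = t at *
  generalize regionSize k w c C n = MP at *
  generalize arraySize k w n = cap at *
  generalize arrayBase k l₁ l₂ n = AB at *
  have hq1 : 1 ≤ (2 * n + 1) ^ k := Nat.one_le_pow _ _ (by omega)
  obtain ⟨q, hq⟩ : ∃ q, (2 * n + 1) ^ k = q := ⟨_, rfl⟩
  rw [hq] at hCs hAB hcap hq1 ⊢
  have hRead : Reads 0 x s := fun i _ => by rw [zero_add, hmem]
  have hzero : ∀ a, x.length ≤ a → s.mem a = 0 := fun a ha => by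
    rw [hmem, List.getD_eq_default _ _ ha]
  rw [hx, reads_cons, reads_cons, reads_append, reads_cons, reads_cons, hds] at hRead
  obtain ⟨m0, m1, -, mn, mc, hflat⟩ := hRead
  have hlen : (Cs.flatMap fun C => C.length :: C).length ≤ (k + 1) * q := by
    rw [List.length_flatMap]
    refine (List.sum_le_card_nsmul _ (k + 1) ?_).trans ?_
    · intro y hy
      obtain ⟨C, hC, rfl⟩ := List.mem_map.1 hy
      have := hk C hC
      simp; omega
    · rw [List.length_map, smul_eq_mul, mul_comm]
      exact Nat.mul_le_mul_left _ hCs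
  have hxlen : x.length ≤ AB := by
    rw [hx]; simp only [List.length_cons, List.length_append, hds]; omega
  have hYpos : 0 < Y := by
    have : 0 < cap * (2 * n + 1) := Nat.mul_pos (by omega) (by omega)
    omega
  have hYMP : Y ≤ MP := by rw [hMM]; exact Nat.le_self_pow (by omega) Y
  have hM1 : 1 < M := by omega
  have h2n : n < 2 ^ n := Nat.lt_two_pow_self
  have h2nn : 2 ^ n ≤ 2 ^ (2 * n) := Nat.pow_le_pow_right (by norm_num) (by omega)
  have ekq : (k + 1) * q = k * q + q := by ring
  have hkq : k ≤ k * q := Nat.le_mul_of_pos_right _ hq1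
  have hn2w : n * 2 ^ w + 1 < M := by omega
  unfold initP
  rw [List.cons_append, List.cons_append, List.cons_append, List.cons_append, List.cons_append,
    List.cons_append, List.cons_append, List.nil_append]
  have z0 := hreg 20
  have m1' : s.mem 1 = l₂ := m1
  have mn' : s.mem (l₁ + l₂ + 1 + 1) = n := by rw [← mn]; congr 1; omega
  have mc' : s.mem (l₁ + l₂ + 1 + 1 + 1) = Cs.length := by rw [← mc]; congr 1; omega
  refine Sim.subConsLine _ hb ?_ (fun hb1 => ?_)
    (by simp only [headerP, List.length_cons, List.length_nil]; omega)
  · simp [headerP, execsOk, execOk, exec, Op.eval, z0, m0, m1', mn', mc', Nat.one_shiftLeft]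
    omega
  set s1 := execs headerP s with hs1
  have a2 : s1.reg 2 = n := by simp [hs1, headerP, execs, exec, Op.eval, z0, m0, m1', mn']
  have a11 : s1.reg 11 = 2 * n := by
    simp [hs1, headerP, execs, exec, Op.eval, z0, m0, m1', mn', two_mul]
  have a12 : s1.reg 12 = 2 ^ n := by
    simp [hs1, headerP, execs, exec, Op.eval, z0, m0, m1', mn', Nat.one_shiftLeft]
  have a13 : s1.reg 13 = 1 := by simp [hs1, headerP, execs, exec]
  have a21 : s1.reg 21 = l₁ + l₂ + 4 := by
    simp [hs1, headerP, execs, exec, Op.eval, z0, m0, m1']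
  have a22 : s1.reg 22 = Cs.length := by
    simp [hs1, headerP, execs, exec, Op.eval, z0, m0, m1', mc']
  have a25 : s1.reg 25 = l₁ := by simp [hs1, headerP, execs, exec, z0, m0]
  have a26 : s1.reg 26 = l₂ := by simp [hs1, headerP, execs, exec, m1']
  have a30 : s1.reg 30 = 1 := by simp [hs1, headerP, execs, exec]
  have a31 : s1.reg 31 = 2 * n + 1 := by
    simp [hs1, headerP, execs, exec, Op.eval, z0, m0, m1', mn', two_mul]
  have a39 : s1.reg 39 = 0 := by simp [hs1, headerP, execs, exec, hreg]
  have am : s1.mem = s.mem := execs_mem s rfl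
  clear_value s1
  obtain ⟨b1, b2, b3⟩ := execs_replicate_mul 30 31 k (by norm_num) s1
  rw [a30, a31, one_mul, hq] at b2
  refine Sim.subConsLine _ hb1 (execsOk_replicate_mul 30 31 k (by norm_num) s1 (by omega)
    (by rw [a30, a31, one_mul, hq]; omega)) (fun hb2 => ?_)
    (by simp only [headerP, List.length_cons, List.length_nil, List.length_replicate]; omega)
  set s2 := execs (List.replicate k (.op .mul 30 30 31)) s1 with hs2
  have c2 := (b1 2 (by omega)).trans a2
  have c13 := (b1 13 (by omega)).trans a13
  have c12 := (b1 12 (by omega)).trans a12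
  have c21 := (b1 21 (by omega)).trans a21
  have c31 := (b1 31 (by omega)).trans a31
  clear_value s2
  obtain ⟨d0, d3, d14, d28, d34, d6⟩ := layoutP_spec (M := M) (k := k) (w := w) (C := C) (Y := Y) b2 c2 c13
    c12 c21 c31 hAB.symm hcap.symm (by rw [hY]; ring) hq1 hMc hMw (by omega)
  refine Sim.subConsLine _ hb2 d0 (fun hb3 => ?_)
    (by simp only [headerP, layoutP, List.length_cons, List.length_nil, List.length_replicate]; omega)
  set s3 := execs (layoutP k w C) s2 with hs3
  have dr : ∀ r, r = 2 ∨ r = 11 ∨ r = 12 ∨ r = 13 ∨ r = 21 ∨ r = 22 ∨ r = 25 ∨ r = 26 ∨ r = 39 →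
      s3.reg r = s1.reg r := by
    intro r hr
    rw [← b1 r (by omega)]
    rcases hr with rfl | rfl | rfl | rfl | rfl | rfl | rfl | rfl | rfl <;>
      simp [hs3, layoutP, execs, exec]
  have dm : s3.mem = s.mem := (execs_mem s2 rfl).trans (b3.trans am)
  clear_value s3
  obtain ⟨f1, f2, f3⟩ := execs_replicate_mul 6 34 (c + 1) (by norm_num) s3
  rw [d6, d34, one_mul, ← hMM] at f2
  refine Sim.subConsLine _ hb3 (execsOk_replicate_mul 6 34 (c + 1) (by norm_num) s3 (by omega)
    (by rw [d6, d34, one_mul, ← hMM]; omega)) (fun hb4 => ?_)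
    (by simp only [headerP, layoutP, List.length_cons, List.length_nil, List.length_replicate]; omega)
  set s4 := execs (List.replicate (c + 1) (.op .mul 6 6 34)) s3 with hs4
  have fr : ∀ r, r = 2 ∨ r = 11 ∨ r = 12 ∨ r = 13 ∨ r = 21 ∨ r = 22 ∨ r = 25 ∨ r = 26 ∨ r = 39 →
      s4.reg r = s1.reg r := fun r hr => (f1 r (by omega)).trans (dr r hr)
  have h2 := (fr 2 (by simp)).trans a2
  have h11 := (fr 11 (by simp)).trans a11
  have h13 := (fr 13 (by simp)).trans a13
  have h25 := (fr 25 (by simp)).trans a25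
  have h26 := (fr 26 (by simp)).trans a26
  clear_value s4
  obtain ⟨g0, g5, g9, g7⟩ := numbersP_spec (M := M) h2 h11 h13 h25 h26 hd' ht
    (by rw [hΦ]; ring) hRn (by omega) hMg hMt hMr h96
  refine Sim.subConsLine _ hb4 g0 (fun hb5 => ?_)
    (by simp only [headerP, layoutP, numbersP, List.length_cons, List.length_nil,
      List.length_replicate]; omega)
  set s5 := execs (numbersP g e r) s4 with hs5
  have gr : ∀ r, r = 2 ∨ r = 11 ∨ r = 12 ∨ r = 13 ∨ r = 21 ∨ r = 22 ∨ r = 3 ∨ r = 14 ∨ r = 28 ∨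
      r = 6 ∨ r = 39 → s5.reg r = s4.reg r := by
    intro r hr
    rcases hr with rfl | rfl | rfl | rfl | rfl | rfl | rfl | rfl | rfl | rfl | rfl <;>
      simp [hs5, numbersP, execs, exec]
  have gm : s5.mem = s.mem := (execs_mem s4 rfl).trans (f3.trans dm)
  clear_value s5
  have g13 := (gr 13 (by simp)).trans h13
  have g3 := (gr 3 (by simp)).trans ((f1 3 (by omega)).trans d3)
  have g14 := (gr 14 (by simp)).trans ((f1 14 (by omega)).trans d14)
  have g28 := (gr 28 (by simp)).trans ((f1 28 (by omega)).trans d28)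
  have g6 := (gr 6 (by simp)).trans f2
  have g12 := (gr 12 (by simp)).trans ((fr 12 (by simp)).trans a12)
  have g21 := (gr 21 (by simp)).trans ((fr 21 (by simp)).trans a21)
  have g22 := (gr 22 (by simp)).trans ((fr 22 (by simp)).trans a22)
  have g39 := (gr 39 (by simp)).trans ((fr 39 (by simp)).trans a39)
  have hT : Cs.length * (k * 16 + 12 * cap + 60) ≤ q * (k * 16 + 12 * cap + 60) :=
    Nat.mul_le_mul_right _ hCs
  refine Sim.subConsDet (sim_read (cap := cap) (by omega) hMc Cs hk hls [] (l₁ + l₂ + 4) s5 hb5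
    g13 g3 g22 g21 ⟨g39, fun i hi => by simp at hi⟩ (by simp only [List.length_nil]; omega)
    (fun i hi => by
      rw [gm, ← hflat i hi]; congr 1; omega) (by omega)) (fun s6 hb6 hI6 => ?_)
    (by simp only [headerP, layoutP, numbersP, List.length_cons, List.length_nil,
      List.length_replicate]; omega)
  obtain ⟨hA, kr, km⟩ := hI6
  have kr' : ∀ r < 39, r = 2 ∨ r = 11 ∨ r = 12 ∨ r = 13 ∨ r = 3 ∨ r = 14 ∨ r = 28 ∨ r = 6 ∨ r = 5 ∨
      r = 7 ∨ r = 9 → s6.reg r = s5.reg r := fun r h1 h2 =>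
    kr r h1 (by omega) (by omega) (by omega) (by omega)
  have hL39 := hb6.1 39
  refine Sim.subConsLine _ hb6 ?_ (fun hb7 => ?_)
    (by simp only [headerP, layoutP, numbersP, List.length_cons, List.length_nil,
      List.length_replicate]; omega)
  · simp [execsOk, execOk, Op.eval]; omega
  refine (h _ hb7 ?_).mono
    (by simp only [headerP, layoutP, numbersP, List.length_cons, List.length_nil,
      List.length_replicate]; omega)
  set s7 := execs [.op .bor 4 39 39, .const 15 0, .const 16 1, .const 17 1, .const 19 0] s6 with hs7
  have lr : ∀ r, r ≠ 4 → r ≠ 15 → r ≠ 16 → r ≠ 17 → r ≠ 19 → s7.reg r = s6.reg r :=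
    fun r h1 h2 h3 h4 h5 => by simp [hs7, execs, exec, h1, h2, h3, h4, h5]
  have lm : s7.mem = s6.mem := execs_mem s6 rfl
  have lr' : ∀ r < 39, r = 2 ∨ r = 11 ∨ r = 12 ∨ r = 13 ∨ r = 3 ∨ r = 14 ∨ r = 28 ∨ r = 6 ∨ r = 5 ∨
      r = 7 ∨ r = 9 → s7.reg r = s5.reg r := fun r h1 h2 =>
    (lr r (by omega) (by omega) (by omega) (by omega) (by omega)).trans (kr' r h1 h2)
  have l28 := (lr' 28 (by omega) (by simp)).trans g28
  exact {
    params := ⟨(lr' 2 (by omega) (by simp)).trans ((gr 2 (by simp)).trans h2),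
      (lr' 3 (by omega) (by simp)).trans g3, (lr' 6 (by omega) (by simp)).trans g6,
      (lr' 7 (by omega) (by simp)).trans g7,
      (lr' 11 (by omega) (by simp)).trans ((gr 11 (by simp)).trans h11),
      (lr' 12 (by omega) (by simp)).trans g12, (lr' 13 (by omega) (by simp)).trans g13⟩
    r4 := by simp [hs7, execs, exec, Op.eval, hA.1]
    r5 := (lr' 5 (by omega) (by simp)).trans g5
    r9 := (lr' 9 (by omega) (by simp)).trans g9
    r14 := (lr' 14 (by omega) (by simp)).trans g14
    r15 := by simp [hs7, execs, exec]
    r16 := by simp [hs7, execs, exec]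
    r17 := by simp [hs7, execs, exec]
    r19 := by simp [hs7, execs, exec]
    array := fun i hi => by rw [lm]; exact hA.2 i hi
    r28 := l28
    fresh := fun i => by rw [lm, l28, km _ (by omega), gm, hzero _ (by omega)] }

/-! ### Growth of functions -/

/-- Polynomially bounded functions. -/
def PolyBound (f : ℕ → ℕ) : Prop := ∃ C k : ℕ, ∀ n, f n ≤ C * (n + 1) ^ k

namespace PolyBound

variable {f g : ℕ → ℕ}

theorem const (c : ℕ) : PolyBound fun _ => c := ⟨c, 0, fun n => by simp⟩

theorem id : PolyBound fun n => n := ⟨1, 1, fun n => by simp⟩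

theorem add (hf : PolyBound f) (hg : PolyBound g) : PolyBound fun n => f n + g n := by
  obtain ⟨C, k, h⟩ := hf
  obtain ⟨D, l, h'⟩ := hg
  refine ⟨C + D, k + l, fun n => ?_⟩
  rw [add_mul]
  exact Nat.add_le_add
    ((h n).trans (Nat.mul_le_mul_left _ (Nat.pow_le_pow_right (by omega) (by omega))))
    ((h' n).trans (Nat.mul_le_mul_left _ (Nat.pow_le_pow_right (by omega) (by omega))))

theorem mul (hf : PolyBound f) (hg : PolyBound g) : PolyBound fun n => f n * g n := by
  obtain ⟨C, k, h⟩ := hf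
  obtain ⟨D, l, h'⟩ := hg
  refine ⟨C * D, k + l, fun n => (Nat.mul_le_mul (h n) (h' n)).trans (le_of_eq ?_)⟩
  rw [pow_add]; ring

theorem pow (hf : PolyBound f) (k : ℕ) : PolyBound fun n => f n ^ k := by
  induction k with
  | zero => simpa using const 1
  | succ k ih => simpa only [pow_succ] using ih.mul hf

/-- With `y = η log 2 / (k + 1)`, the bound `y n ≤ exp (y n)` makes `n + 1` at most a constant times
`exp (y n)`, and the power `k + 1` of this exponential is `2^(η n)`. -/
theorem le_rpow (hf : PolyBound f) {η : ℝ} (hη : 0 < η) :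
    ∃ C : ℝ, 1 ≤ C ∧ ∀ n : ℕ, (f n : ℝ) ≤ C * 2 ^ (η * n) := by
  obtain ⟨C, k, h⟩ := hf
  have hl : 0 < Real.log 2 := Real.log_pos (by norm_num)
  set y : ℝ := η * Real.log 2 / (k + 1) with hy
  have hy0 : 0 < y := by positivity
  have hD : 1 ≤ 1 + 1 / y := by have : 0 < 1 / y := by positivity
                                linarith
  refine ⟨(C + 1) * (1 + 1 / y) ^ (k + 1), ?_, fun n => ?_⟩
  · exact one_le_mul_of_one_le_of_one_le (by simp) (one_le_pow₀ hD)
  have h1 : ((n : ℝ) + 1) ≤ (1 + 1 / y) * Real.exp (y * n) := by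
    have e1 : 1 ≤ Real.exp (y * n) := Real.one_le_exp (by positivity)
    have e2 : y * n ≤ Real.exp (y * n) := by linarith [Real.add_one_le_exp (y * n)]
    have e3 : (n : ℝ) ≤ 1 / y * Real.exp (y * n) := by
      rw [div_mul_eq_mul_div, one_mul, le_div_iff₀ hy0, mul_comm]; exact e2
    rw [add_mul, one_mul]; linarith
  have h2 : Real.exp (y * n) ^ (k + 1) = 2 ^ (η * n) := by
    rw [← Real.exp_nat_mul, Real.rpow_def_of_pos (by norm_num), hy]
    congr 1; push_cast; field_simp
  calc (f n : ℝ) ≤ C * ((n : ℝ) + 1) ^ k := by exact_mod_cast h n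
    _ ≤ (C + 1) * ((n : ℝ) + 1) ^ (k + 1) := by
        gcongr
        · linarith
        · have : (0 : ℝ) ≤ n := by positivity
          linarith
        · omega
    _ ≤ (C + 1) * ((1 + 1 / y) * Real.exp (y * n)) ^ (k + 1) := by gcongr
    _ = _ := by rw [mul_pow, h2]; ring

end PolyBound

/-- Functions that are at most exponential. -/
def ExpBound (f : ℕ → ℕ) : Prop := ∃ B D : ℕ, ∀ n, f n ≤ B * 2 ^ (D * n)

namespace ExpBound

variable {f g : ℕ → ℕ}

theorem const (c : ℕ) : ExpBound fun _ => c := ⟨c, 0, fun n => by simp⟩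

theorem id : ExpBound fun n => n := ⟨1, 1, fun n => by simpa using Nat.lt_two_pow_self.le⟩

theorem add (hf : ExpBound f) (hg : ExpBound g) : ExpBound fun n => f n + g n := by
  obtain ⟨B, D, h⟩ := hf
  obtain ⟨B', D', h'⟩ := hg
  refine ⟨B + B', D + D', fun n => ?_⟩
  rw [add_mul]
  refine Nat.add_le_add ((h n).trans ?_) ((h' n).trans ?_) <;>
    exact Nat.mul_le_mul_left _ (Nat.pow_le_pow_right (by omega) (Nat.mul_le_mul_right _ (by omega)))

theorem mul (hf : ExpBound f) (hg : ExpBound g) : ExpBound fun n => f n * g n := by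
  obtain ⟨B, D, h⟩ := hf
  obtain ⟨B', D', h'⟩ := hg
  refine ⟨B * B', D + D', fun n => (Nat.mul_le_mul (h n) (h' n)).trans (le_of_eq ?_)⟩
  rw [add_mul, pow_add]; ring

theorem pow (hf : ExpBound f) (k : ℕ) : ExpBound fun n => f n ^ k := by
  induction k with
  | zero => simpa using const 1
  | succ k ih => simpa only [pow_succ] using ih.mul hf

theorem two_pow (a : ℕ) : ExpBound fun n => 2 ^ (a * n) := ⟨1, a, fun n => by simp⟩

/-- A number that is at least exponential exceeds an exponential function times itself when it is
raised to a sufficiently high power. -/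
theorem mul_le_pow (hf : ExpBound f) {κ : ℝ} (hκ : 0 < κ) :
    ∃ c : ℕ, ∀ n Z : ℕ, 2 ≤ Z → (2 : ℝ) ^ (κ * n) ≤ Z → Z * f n ≤ Z ^ c := by
  obtain ⟨B, D, h⟩ := hf
  obtain ⟨j, hj⟩ := exists_nat_gt (D / κ)
  -- One factor `Z` is kept, `Z ^ B ≥ 2 ^ B` absorbs the constant, and `Z ^ j ≥ 2 ^ (κ j n)` with `κ
  -- j > D` absorbs the exponential.
  refine ⟨1 + B + j, fun n Z hZ hZκ => ?_⟩
  rw [pow_add, pow_add, pow_one, mul_assoc]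
  refine Nat.mul_le_mul_left _ ((h n).trans (Nat.mul_le_mul ?_ ?_))
  · exact Nat.lt_two_pow_self.le.trans (Nat.pow_le_pow_left hZ _)
  · have : ((2 : ℝ) ^ (κ * n)) ^ j ≤ (Z : ℝ) ^ j := by gcongr
    rw [← Real.rpow_natCast, ← Real.rpow_mul (by norm_num)] at this
    have h2 : ((2 ^ (D * n) : ℕ) : ℝ) ≤ (Z : ℝ) ^ j := by
      refine le_trans ?_ this
      push_cast
      rw [← Real.rpow_natCast]
      refine Real.rpow_le_rpow_of_exponent_le (by norm_num) ?_
      rw [div_lt_iff₀ hκ] at hj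
      push_cast
      nlinarith [(Nat.cast_nonneg n : (0 : ℝ) ≤ n)]
    exact_mod_cast h2

end ExpBound

/-! ### The precision -/

theorem pow_size_le {m : ℕ} (hm : 0 < m) : 2 ^ m.size ≤ 2 * m := by
  have h : 0 < m.size := Nat.size_pos.2 hm
  have h1 : 2 ^ (m.size - 1) ≤ m := Nat.lt_size.1 (by omega)
  calc 2 ^ m.size = 2 * 2 ^ (m.size - 1) := by rw [← pow_succ']; congr 1; omega
    _ ≤ _ := by omega

/-- Binary lengths determine numbers up to a factor `2`, since `m < 2 ^ m.size ≤ 2 m`. So `2^d`,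
with two bits added to the difference of the lengths, lies between `2 / ε` and `8 / ε`. As `ε < 1`,
the subtraction does not truncate. -/
theorem two_div_pow_le {ε : ℚ} (h0 : 0 < ε) (h1 : ε < 1) :
    2 / 2 ^ (ε.den.size + 2 - ε.num.toNat.size) ≤ (ε : ℝ) ∧
      (ε : ℝ) * 2 ^ (ε.den.size + 2 - ε.num.toNat.size) ≤ 8 := by
  have hnum : 0 < ε.num := Rat.num_pos.2 h0
  obtain ⟨a, ha⟩ := Int.eq_ofNat_of_zero_le hnum.le
  have ha0 : 0 < a := by omega
  have hden := ε.den_pos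
  have hεr : (ε : ℝ) = a / ε.den := by
    have := Rat.num_div_den ε
    rw [ha] at this
    have h2 : ((a : ℚ) / ε.den : ℚ) = ε := by simpa using this
    rw [← h2]; push_cast; rw [h2]
  rw [ha]
  simp only [Int.toNat_natCast]
  set b := ε.den with hb
  have hb' : (0 : ℝ) < b := by exact_mod_cast hden
  have hab : a < b := by
    have : (ε : ℝ) < 1 := by exact_mod_cast h1
    rw [hεr, div_lt_one hb'] at this
    exact_mod_cast this
  have hs : a.size ≤ b.size := Nat.size_le_size hab.le
  have e : 2 ^ (b.size + 2 - a.size) * 2 ^ a.size = 4 * 2 ^ b.size := by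
    rw [← pow_add, show 4 = 2 ^ 2 by norm_num, ← pow_add]; congr 1; omega
  have l1 := pow_size_le ha0
  have l2 := pow_size_le hden
  have u1 := Nat.lt_size_self a
  have u2 := Nat.lt_size_self b
  have n1 : 2 * b ≤ 2 ^ (b.size + 2 - a.size) * a := by
    have := Nat.mul_le_mul_left (2 ^ (b.size + 2 - a.size)) l1
    have e2 : 2 ^ (b.size + 2 - a.size) * (2 * a) = 2 * (2 ^ (b.size + 2 - a.size) * a) := by ring
    omega
  have n2 : 2 ^ (b.size + 2 - a.size) * a ≤ 8 * b := by
    have := Nat.mul_le_mul_left (2 ^ (b.size + 2 - a.size)) u1.le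
    omega
  rw [hεr]
  constructor
  · rw [div_le_div_iff₀ (by positivity) hb']
    rw [mul_comm (a : ℝ)]; exact_mod_cast n1
  · rw [div_mul_eq_mul_div, div_le_iff₀ hb', mul_comm]; exact_mod_cast n2

/-- The disjunction is the one required by `output_good`, according to whether the cap is active;
the second part turns the `4^d` in the number of trials into `64 ε⁻²`, and the cap can only help
there. -/
theorem precision_good {ε : ℚ} (h0 : 0 < ε) (h1 : ε < 1) (n : ℕ) :
    (2 / 2 ^ precision ε.num.toNat.size ε.den.size n ≤ (ε : ℝ) ∨
      n + 2 ≤ precision ε.num.toNat.size ε.den.size n) ∧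
      (4 : ℝ) ^ precision ε.num.toNat.size ε.den.size n ≤ 64 * ((ε : ℝ) ^ 2)⁻¹ := by
  obtain ⟨h2, h3⟩ := two_div_pow_le h0 h1
  have hε : (0 : ℝ) < ε := by exact_mod_cast h0
  unfold precision
  constructor
  · rcases le_total (ε.den.size + 2 - ε.num.toNat.size) (n + 2) with h | h
    · left; rwa [min_eq_left h]
    · right; rw [min_eq_right h]
  · calc (4 : ℝ) ^ min (ε.den.size + 2 - ε.num.toNat.size) (n + 2)
        ≤ 4 ^ (ε.den.size + 2 - ε.num.toNat.size) :=
          pow_le_pow_right₀ (by norm_num) (min_le_left _ _)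
      _ = (2 ^ (ε.den.size + 2 - ε.num.toNat.size)) ^ 2 := by
          rw [← pow_mul, mul_comm, pow_mul]; norm_num
      _ ≤ _ := by
          rw [← div_eq_mul_inv, le_div_iff₀ (by positivity), ← mul_pow, mul_comm]
          calc _ ≤ (8 : ℝ) ^ 2 := by gcongr
            _ = 64 := by norm_num

/-! ### The oracle -/

theorem foldr_max_le {l : List ℕ} {b : ℕ} (h : ∀ x ∈ l, x ≤ b) : l.foldr max 0 ≤ b := by
  induction l with
  | nil => simp
  | cons x l ih =>
    simp only [List.foldr_cons]
    exact max_le (h x (by simp)) (ih fun y hy => h y (by simp [hy]))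

theorem le_foldr_max {l : List ℕ} {x : ℕ} (h : x ∈ l) : x ≤ l.foldr max 0 := by
  induction l with
  | nil => simp at h
  | cons y l ih =>
    simp only [List.foldr_cons]
    rcases List.mem_cons.1 h with rfl | h
    · exact le_max_left _ _
    · exact (ih h).trans (le_max_right _ _)

theorem sizeBound_encMasks_le {n cap T : ℕ} {L : List ℕ} (hL : L.length ≤ cap) (hn : n ≤ cap)
    (hc : 0 < cap) :
    sizeBound (encMasks n L) T ≤ 2 * (cap * (2 * n + 1)) + (T + 4) := by
  have h1 := length_encMasks_le n L
  have h2 := Nat.mul_le_mul_right (2 * n + 1) hL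
  have h3 : cap ≤ cap * (2 * n + 1) := Nat.le_mul_of_pos_right _ (by omega)
  have h4 : 2 * n + 1 ≤ cap * (2 * n + 1) := Nat.le_mul_of_pos_left _ hc
  have h5 : (encMasks n L).foldr max 0 ≤ cap * (2 * n + 1) := by
    refine foldr_max_le fun x hx => ?_
    simp only [encMasks, List.mem_cons, List.mem_flatMap] at hx
    rcases hx with rfl | rfl | ⟨M, -, rfl | hx⟩
    · omega
    · omega
    · have := length_maskLits_le n M; omega
    · have := (mem_maskLits.1 hx).1; omega
  unfold sizeBound
  omega

/-- The program `P` decides the satisfiability of `n`-variable `K`-CNF formulas in time `T`. -/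
def DecidesSAT (P : Prog) (K n T c : ℕ) : Prop := ∀ F : KCNF K n, P.Solves F.encode T c
  fun r => (F.Satisfiable ∧ r 0 = 1) ∨ (¬ F.Satisfiable ∧ r 0 = 0)

/-- The hypothesis bounds words in terms of the size of each instance; here one bound `N` is
extracted that serves all formulas of the reduction, so all regions can have the same size. -/
theorem DecidesSAT.runsOn {P : Prog} {K n T c cap N : ℕ} (h : DecidesSAT P K n T c) {L : List ℕ}
    (hL : ValidList n K L) (hcap : L.length ≤ cap) (hn : n ≤ cap) (hc : 0 < cap)
    (hN : (2 * (cap * (2 * n + 1)) + (T + 4)) ^ c ≤ N) : RunsOn P T N (encMasks n L) := by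
  obtain ⟨F, hF, -⟩ := exists_kcnf L hL.1 hL.2
  obtain ⟨h1, h2, -⟩ := h F
  rw [hF] at h1 h2
  have hle := (Nat.pow_le_pow_left (sizeBound_encMasks_le (T := T) hcap hn hc) c).trans hN
  exact ⟨h1, fun t d hd => ⟨fun r => ((h2 t d hd).1 r).trans_le hle,
    fun a => ((h2 t d hd).2 a).trans_le hle⟩⟩

theorem DecidesSAT.decides {P : Prog} {K n T c : ℕ} (h : DecidesSAT P K n T c) :
    Decides n K (oracle P T n) := by
  intro L hL b hb
  obtain ⟨F, hF, hsat⟩ := exists_kcnf L hL.1 hL.2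
  obtain ⟨-, -, h3⟩ := h F
  rw [hF] at h3
  have hS : F.Satisfiable ↔ b = true := by
    rw [hb]; exact exists_congr hsat
  refine h3.trans ?_
  rw [oracle, ← PMF.toOuterMeasure_apply_singleton, PMF.toOuterMeasure_map_apply]
  refine PMF.toOuterMeasure_mono _ fun d hd => ?_
  have hd := hd.1
  simp only [Set.mem_ofPred_eq, hS] at hd
  simp only [Set.mem_preimage, Set.mem_singleton_iff]
  rcases hd with ⟨rfl, h⟩ | ⟨hb, h⟩
  · simp [h]
  · simp only [Bool.not_eq_true] at hb
    rw [hb, h]; rfl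

theorem valid_addPrefix_list {n K i v : ℕ} {L : List ℕ} (hi : i ≤ n) (hK : 1 ≤ K)
    (h : ValidList n K L) : ValidList n K (addPrefix i v L) :=
  ⟨nodup_addPrefix h.1, valid_addPrefix hi hK h.2⟩

/-! ### The error probability -/

/-- In the number of trials, `4^d` cancels the precision, `2^(n/g)` pays for the variance factor
`2^(γ n)` and for the number of levels, which is at most `C 2^(η n) / 12`, and `2^e` pays for
constants. The `2` in `he` compensates for rounding down in `n / g`. -/
theorem failure_trials {γ η C : ℝ} {g w : ℕ} (hg : 0 < g) (hη : (γ + η) * g ≤ 1)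
    (hC : ∀ n : ℕ, ((12 * (n * 2 ^ w + 1) : ℕ) : ℝ) ≤ C * 2 ^ (η * n)) {e : ℕ} (he : 2 * C ≤ 2 ^ e) (n d : ℕ) :
    ((n * 2 ^ w + 1 : ℕ) : ℝ) * (2 * 2 ^ (γ * n) * 4 ^ d / numTrials g e d n) ≤ 1 / 6 := by
  have hq : ((n : ℝ) / g) - 1 ≤ ((n / g : ℕ) : ℝ) := by
    have := Nat.lt_div_mul_add (a := n) hg
    have hg' : (0 : ℝ) < g := by exact_mod_cast hg
    rw [sub_le_iff_le_add, div_le_iff₀ hg']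
    have h2 : (n : ℝ) < (n / g : ℕ) * g + g := by exact_mod_cast this
    linarith
  have h1 : (2 : ℝ) ^ (γ * n) * 2 ^ (η * n) ≤ 2 * 2 ^ (n / g) := by
    rw [← Real.rpow_add (by norm_num), ← add_mul, ← pow_succ', ← Real.rpow_natCast]
    refine Real.rpow_le_rpow_of_exponent_le (by norm_num) ?_
    have hg' : (0 : ℝ) < g := by exact_mod_cast hg
    have : (γ + η) * n ≤ n / g := by
      rw [le_div_iff₀ hg']
      nlinarith [(Nat.cast_nonneg n : (0 : ℝ) ≤ n)]
    push_cast; linarith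
  have ht : (numTrials g e d n : ℝ) = 4 ^ d * (2 ^ (n / g) * 2 ^ e) := by
    rw [numTrials]; push_cast
    rw [pow_add, pow_add, pow_mul]; norm_num
  rw [ht, ← mul_div_assoc, div_le_iff₀ (by positivity)]
  have h3 := hC n
  push_cast at h3 ⊢
  have h5 : (0 : ℝ) < 2 ^ (γ * n) := by positivity
  have h6 : 12 * ((n : ℝ) * 2 ^ w + 1) * 2 ^ (γ * n) ≤ 2 ^ (n / g) * 2 ^ e := by
    calc _ ≤ C * 2 ^ (η * n) * 2 ^ (γ * n) := by gcongr
      _ = C * (2 ^ (γ * n) * 2 ^ (η * n)) := by ring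
      _ ≤ C * (2 * 2 ^ (n / g)) := by
          have : 0 ≤ C := by
            have h0 := hC 0
            simp only [Nat.cast_zero, mul_zero, Real.rpow_zero, mul_one] at h0
            exact le_trans (by positivity) h0
          gcongr
      _ = 2 ^ (n / g) * (2 * C) := by ring
      _ ≤ _ := by gcongr
  have h7 : (0 : ℝ) < 4 ^ d := by positivity
  nlinarith

theorem two_pow_le_nine_eighths (x : ℕ) : (2 : ℝ) ^ x ≤ (9 / 8) ^ (6 * x) := by
  rw [pow_mul]
  exact pow_le_pow_left₀ (by norm_num) (by norm_num) x

theorem numTrials_le (g e d n : ℕ) (hd : d ≤ n + 2) :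
    numTrials g e d n ≤ 2 ^ (2 * (n + 2) + (n + e)) :=
  Nat.pow_le_pow_right (by norm_num) (by have := Nat.div_le_self n g; omega)

/-- Levels, trials and queries multiply to at most `2^(8 n + w + 2 e + 14) / 6`, because the cap on
`d` bounds the trials by `2^(3 n + 4 + e)`. As `2 ≤ (9/8)^6`, six times this exponent is enough for
the power of `8/9`. -/
theorem failure_runs {g e w d n : ℕ} (hd : d ≤ n + 2) :
    ((n * 2 ^ w + 1 : ℕ) : ℝ) * (numTrials g e d n * ((numTrials g e d n * (8 * n + 2) : ℕ) *
      (8 / 9) ^ (48 * n + 6 * (w + 2 * e + 14)))) ≤ 1 / 6 := by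
  have ht := numTrials_le g e d n hd
  set t := numTrials g e d n
  have hn : n + 1 ≤ 2 ^ n := Nat.lt_two_pow_self
  have h2w : 1 ≤ 2 ^ w := Nat.one_le_two_pow
  have a1 : n * 2 ^ w + 1 ≤ 2 ^ n * 2 ^ w := by
    have := Nat.mul_le_mul_right (2 ^ w) hn
    rw [add_mul, one_mul] at this; omega
  have a2 : 8 * n + 2 ≤ 2 ^ n * 8 := by omega
  have key : 6 * ((n * 2 ^ w + 1) * (t * (t * (8 * n + 2)))) ≤
      2 ^ (8 * n + (w + 2 * e + 14)) := by
    calc _ ≤ 2 ^ 3 * ((2 ^ n * 2 ^ w) * (2 ^ (2 * (n + 2) + (n + e)) *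
          (2 ^ (2 * (n + 2) + (n + e)) * (2 ^ n * 2 ^ 3)))) := by gcongr <;> omega
      _ = _ := by simp only [← pow_add]; congr 1; ring
  have key' : (6 : ℝ) * ((n * 2 ^ w + 1 : ℕ) * (t * (t * (8 * n + 2) : ℕ))) ≤
      (9 / 8) ^ (48 * n + 6 * (w + 2 * e + 14)) := by
    have h := two_pow_le_nine_eighths (8 * n + (w + 2 * e + 14))
    rw [show 6 * (8 * n + (w + 2 * e + 14)) = 48 * n + 6 * (w + 2 * e + 14) by ring] at h
    refine le_trans ?_ h
    exact_mod_cast key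
  have hinv : (8 / 9 : ℝ) ^ (48 * n + 6 * (w + 2 * e + 14)) =
      ((9 / 8) ^ (48 * n + 6 * (w + 2 * e + 14)))⁻¹ := by
    rw [← inv_pow]; norm_num
  rw [hinv]
  have hX : (0 : ℝ) < (9 / 8) ^ (48 * n + 6 * (w + 2 * e + 14)) := by positivity
  generalize ((9 / 8 : ℝ) ^ (48 * n + 6 * (w + 2 * e + 14))) = X at key' hX ⊢
  rw [show ∀ a b c : ℝ, a * (b * (c * X⁻¹)) = (a * (b * c)) / X by intros; field_simp,
    div_le_iff₀ hX]
  linarith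

/-! ### The whole algorithm -/

/-- The polynomial factor of the running time. -/
def timeFactor (P : Prog) (k w c r n : ℕ) : ℕ :=
  (n * 2 ^ w + 1) * (hashTime n w (n * 2 ^ w) (arraySize k w n) + 40 + (8 * n + 2) *
    (nodeTime P n (arraySize k w n) 0 (numRuns r n) + 1 + 3 * numRuns r n) + 51) + 34 +
  ((2 * n + 1) ^ k * (k * 16 + 12 * arraySize k w n + 60) + 2 * k + 2 * c + 200)

theorem polyBound_timeFactor (P : Prog) (k w c r : ℕ) : PolyBound (timeFactor P k w c r) := by
  unfold timeFactor hashTime nodeTime queryTime callTime numRuns arraySize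
  repeat' first
    | exact PolyBound.const _
    | exact PolyBound.id
    | apply PolyBound.add
    | apply PolyBound.mul
    | apply PolyBound.pow

theorem nodeTime_eq (P : Prog) (n cap T R : ℕ) :
    nodeTime P n cap T R = nodeTime P n cap 0 R + R * (3 * T) := by
  unfold nodeTime queryTime callTime; ring

/-- The time splits into trials, decision time, and a factor that depends on `n` only. The latter
contains `nodeTime` for `T = 0`, because by `nodeTime_eq` the decision time enters linearly. -/
theorem time_le {P : Prog} {n k w c r t T : ℕ} (ht : 1 ≤ t) :
    (n * 2 ^ w + 1) * (levelTime P n w (arraySize k w n) T (numRuns r n) t (t * (8 * n + 2)) + 1) +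
      32 + ((2 * n + 1) ^ k * (k * 16 + 12 * arraySize k w n + 60) + 2 * k + 2 * c + 200) ≤
      t * (T + 1) * timeFactor P k w c r n := by
  unfold levelTime timeFactor
  rw [nodeTime_eq P n _ T]
  generalize hashTime n w (n * 2 ^ w) (arraySize k w n) + 40 = H
  generalize nodeTime P n (arraySize k w n) 0 (numRuns r n) = N
  generalize numRuns r n = R
  generalize (2 * n + 1) ^ k * (k * 16 + 12 * arraySize k w n + 60) = I
  have hu : 1 ≤ t * (T + 1) := Nat.mul_pos ht (by omega)
  have h1 : t * H ≤ t * (T + 1) * H := Nat.mul_le_mul_right _ (Nat.le_mul_of_pos_right _ (by omega))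
  have h2 : N + R * (3 * T) + 1 ≤ (T + 1) * (N + 1 + 3 * R) := by
    have : (T + 1) * (N + 1 + 3 * R) = N + R * (3 * T) + 1 + (N * T + T + 3 * R) := by ring
    omega
  have h3 := Nat.mul_le_mul_left (t * (8 * n + 2)) h2
  have h4 : t * (8 * n + 2) * ((T + 1) * (N + 1 + 3 * R)) =
      t * (T + 1) * ((8 * n + 2) * (N + 1 + 3 * R)) := by ring
  generalize t * (T + 1) = u at *
  have h5 : t * H + t * (8 * n + 2) * (N + R * (3 * T) + 1) + 50 + 1 ≤
      u * (H + (8 * n + 2) * (N + 1 + 3 * R) + 51) := by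
    rw [add_assoc, mul_add u, mul_add u]; omega
  have h6 := Nat.mul_le_mul_left (n * 2 ^ w + 1) h5
  have h7 : I + 2 * k + 2 * c + 234 ≤ u * (I + 2 * k + 2 * c + 234) := Nat.le_mul_of_pos_left _ hu
  have h8 : u * ((n * 2 ^ w + 1) * (H + (8 * n + 2) * (N + 1 + 3 * R) + 51) + 34 +
      (I + 2 * k + 2 * c + 200)) =
      (n * 2 ^ w + 1) * (u * (H + (8 * n + 2) * (N + 1 + 3 * R) + 51)) +
      u * (I + 2 * k + 2 * c + 234) := by ring
  omega

/-- A bound for the number of trials. -/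
def maxTrials (e n : ℕ) : ℕ := 2 ^ (2 * (n + 2) + (n + e))

/-- A bound for the words, up to the length of the input. -/
def wordSize (k w c C g e r n : ℕ) : ℕ :=
  (2 ^ (2 * n) + n + n) + 2 ^ (n + 1) + 2 ^ w + g + 96 + 2 * numRuns r n +
  (arraySize k w n + (k + 1) * (2 * n + 1) ^ k + 4) + regionSize k w c C n +
  2 ^ (n + 1) * (maxTrials e n * (8 * n + 2)) + maxTrials e n * (8 * n + 2) +
  (2 * (maxTrials e n * (8 * n + 2)) + 2 * maxTrials e n + 1) * (2 ^ w) ^ (n * 2 ^ w + 1) +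
  (n * 2 ^ w + 1) * (maxTrials e n * (8 * n + 2) * (numRuns r n * regionSize k w c C n)) + 1

/-- Every quantity is at most exponential in `n`, the scaling powers too, since `w` is constant. The
precision does not occur because of its cap; only the lengths of the parts of `ε` are left, and
these are bounded by the input length. -/
theorem expBound_wordSize (k w c C g e r : ℕ) : ExpBound (wordSize k w c C g e r) := by
  have h1 : ExpBound fun n => 2 ^ (n + 1) := by
    simpa only [pow_succ, one_mul] using (ExpBound.two_pow 1).mul (ExpBound.const 2)
  have h2 : ExpBound fun n => 2 ^ n := by simpa only [one_mul] using ExpBound.two_pow 1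
  have h3 : ExpBound (maxTrials e) := by
    have := (ExpBound.two_pow 3).mul (ExpBound.const (2 ^ (4 + e)))
    refine (funext fun n => ?_ : maxTrials e = fun n => 2 ^ (3 * n) * 2 ^ (4 + e)) ▸ this
    rw [maxTrials, ← pow_add]; congr 1; ring
  have h4 : ExpBound fun n => (2 ^ w) ^ (n * 2 ^ w + 1) := by
    have := (ExpBound.two_pow (w * 2 ^ w)).mul (ExpBound.const (2 ^ w))
    refine (funext fun n => ?_ : (fun n => (2 ^ w) ^ (n * 2 ^ w + 1)) =
      fun n => 2 ^ (w * 2 ^ w * n) * 2 ^ w) ▸ this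
    rw [pow_succ, ← pow_mul]; congr 2; ring
  unfold wordSize regionSize numRuns arraySize
  repeat' first
    | exact ExpBound.const _
    | exact ExpBound.id
    | exact h1
    | exact h2
    | exact h3
    | exact h4
    | exact ExpBound.two_pow 2
    | apply ExpBound.add
    | apply ExpBound.mul
    | apply ExpBound.pow

theorem lt_of_wordSize_le {M k w c C g e r n l : ℕ} (h : l + wordSize k w c C g e r n ≤ M) :
    2 ^ (2 * n) + n + n < M ∧ 2 ^ (n + 1) < M ∧ 2 ^ w < M ∧ g < M ∧ 96 < M ∧ 2 * numRuns r n < M ∧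
    regionSize k w c C n < M ∧ 2 ^ (n + 1) * (maxTrials e n * (8 * n + 2)) < M ∧
    maxTrials e n * (8 * n + 2) < M ∧
    (2 * (maxTrials e n * (8 * n + 2)) + 2 * maxTrials e n + 1) * (2 ^ w) ^ (n * 2 ^ w + 1) < M ∧
    l + 4 + (k + 1) * (2 * n + 1) ^ k + arraySize k w n +
      (n * 2 ^ w + 1) * (maxTrials e n * (8 * n + 2) * (numRuns r n * regionSize k w c C n)) <
      M := by
  unfold wordSize at h
  generalize 2 ^ (n + 1) * (maxTrials e n * (8 * n + 2)) = a₁ at *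
  generalize (2 * (maxTrials e n * (8 * n + 2)) + 2 * maxTrials e n + 1) *
    (2 ^ w) ^ (n * 2 ^ w + 1) = a₂ at *
  generalize (n * 2 ^ w + 1) * (maxTrials e n * (8 * n + 2) *
    (numRuns r n * regionSize k w c C n)) = a₃ at *
  generalize maxTrials e n * (8 * n + 2) = a₄ at *
  generalize (k + 1) * (2 * n + 1) ^ k = a₅ at *
  generalize 2 ^ (2 * n) = a₆ at *
  generalize 2 ^ (n + 1) = a₇ at *
  generalize 2 ^ w = a₈ at *
  omega

theorem ValidMask.mono {n K K' M : ℕ} (h : ValidMask n K M) (hK : K ≤ K') : ValidMask n K' M :=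
  ⟨h.1, h.2.trans hK⟩

theorem validList_baseMasks {n k K : ℕ} (F : KCNF k n) (hK : k ≤ K) :
    ValidList n K (baseMasks F) :=
  ⟨nodup_baseMasks F, fun M hM => (valid_baseMasks F M hM).mono hK⟩

/-- The approximate counting algorithm. -/
def approxP (k w c C g e r : ℕ) (P : Prog) : Prog := block (initP k w c C g e r ++ [countP w P])

/-- All bounds are instantiated here. Instances of the decision program have size at most `Y`, so
its words are below `Y^c`. The region size `Y^(c+1)` exceeds both this and the length of the
encoding, even for `c = 0`. -/
theorem sim_approx {M n k w c C g e r K T : ℕ} {P : Prog} (hP : DecidesSAT P K n T c)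
    (hw : 1 ≤ w) (hwK : w ≤ K) (hkK : k ≤ K) (hT : T + 4 ≤ C * 2 ^ n) (F : KCNF k n) {ε : ℚ}
    {s : State} (hb : s.Below M) (hreg : ∀ r, s.reg r = 0)
    (hmem : ∀ a, s.mem a = (encodeRat ε ++ F.encode).getD a 0) {t : ℕ}
    (ht : t = numTrials g e (precision ε.num.toNat.size ε.den.size n) n)
    (hM : ε.num.toNat.size + ε.den.size + wordSize k w c C g e r n ≤ M) :
    Sim M (fun p s' => s'.reg 0 = output w t p.1 p.2 ∧ s'.reg 1 = 1)
      (t * (T + 1) * timeFactor P k w c r n) [approxP k w c C g e r P] s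
      (levels (fun m => trials n w m (query (oracle P T n) (numRuns r n)) (baseMasks F) t
        (t * (8 * n + 2), 0)) (n * 2 ^ w + 1) 0) := by
  have htm : t ≤ maxTrials e n := ht ▸ numTrials_le g e _ n (min_le_right _ _)
  have ht1 : 1 ≤ t := ht ▸ Nat.one_le_two_pow
  have hΦ : t * (8 * n + 2) = fuel g e (precision ε.num.toNat.size ε.den.size n) n := by
    rw [fuel, ht]
  have hΦm := Nat.mul_le_mul_right (8 * n + 2) htm
  have hΦ1 := Nat.mul_le_mul_left (2 ^ (n + 1)) hΦm
  have hΦ2 := Nat.mul_le_mul_right ((2 ^ w) ^ (n * 2 ^ w + 1)) (show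
    2 * (t * (8 * n + 2)) + 2 * t + 1 ≤
      2 * (maxTrials e n * (8 * n + 2)) + 2 * maxTrials e n + 1 by omega)
  have hΦ3 := Nat.mul_le_mul_left (n * 2 ^ w + 1)
    (Nat.mul_le_mul_right (numRuns r n * regionSize k w c C n) hΦm)
  obtain ⟨f1, f2, f3, f4, f5, f6, f7, f8, f9, f10, f11⟩ := lt_of_wordSize_le hM
  have hcap : arraySize k w n = (2 * n + 1) ^ k + n * 2 ^ w + n + 1 := rfl
  have hAB : arrayBase k ε.num.toNat.size ε.den.size n =
    ε.num.toNat.size + ε.den.size + 4 + (k + 1) * (2 * n + 1) ^ k := rfl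
  have hbase := (length_baseMasks F).trans (length_clauses_le F)
  have hY : regionSize k w c C n =
    (2 * (arraySize k w n * (2 * n + 1)) + C * 2 ^ n) ^ (c + 1) := rfl
  set Y := 2 * (arraySize k w n * (2 * n + 1)) + C * 2 ^ n with hYd
  have hY1 : Y ≤ Y ^ (c + 1) := Nat.le_self_pow (by omega) Y
  have hYc : Y ^ c ≤ Y ^ (c + 1) := Nat.pow_le_pow_right (by omega) (by omega)
  have hB : Bounds M n (regionSize k w c C n) (numRuns r n) (arraySize k w n) (Y ^ c) :=
    ⟨by omega, by omega, by omega, f2, f6⟩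
  have hO : ∀ m ≤ n * 2 ^ w, ∀ L ∈ (hash n w m (baseMasks F)).support,
      L.length ≤ (baseMasks F).length + m ∧ (baseMasks F).length ≤ L.length ∧
      ∀ v < 2 ^ (n + 1), RunsOn P T (Y ^ c) (encMasks n (addPrefix (Nat.log 2 v) v L)) := by
    intro m hm L hL
    have hnm : 0 < n ∨ m = 0 := by
      rcases Nat.eq_zero_or_pos n with rfl | h
      · right; simpa using hm
      · exact Or.inl h
    obtain ⟨h1, h2, h3⟩ := hash_support hwK hnm _ (validList_baseMasks F hkK) L hL
    refine ⟨h2, h3.length_le, fun v hv => ?_⟩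
    have hlog := log_le_of_lt hv
    have hlen := length_addPrefix (Nat.log 2 v) v L
    exact hP.runsOn (cap := arraySize k w n) (valid_addPrefix_list hlog (hw.trans hwK) h1)
      (by omega) (by omega) (by omega) (Nat.pow_le_pow_left (by omega) c)
  have hx : encodeRat ε ++ F.encode = ε.num.toNat.size :: ε.den.size ::
      ((ε.num.toNat.bits ++ ε.den.bits).map Bool.toNat ++ n ::
        (F.clauses.map (List.map code)).length ::
        (F.clauses.map (List.map code)).flatMap fun C => C.length :: C) := by
    rw [encodeRat, KCNF.encode, ← Nat.size_eq_bits_len, ← Nat.size_eq_bits_len, List.length_map,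
      List.flatMap_map, List.cons_append, List.cons_append]
    simp only [List.length_map]
    rfl
  refine (sim_init (T := (n * 2 ^ w + 1) * (levelTime P n w (arraySize k w n) T (numRuns r n) t
    (t * (8 * n + 2)) + 1) + 32) (k := k) (w := w) (c := c) (C := C) (g := g) (e := e) (r := r) hx
    (by simp [Nat.size_eq_bits_len]) ?_ ?_ ?_ hb hreg hmem f1
    (by omega) f7 f3 f4 (hΦ ▸ hΦm.trans_lt f9) (by omega) f5 fun s' hb' hR => ?_).mono (time_le ht1)
  · intro C hC
    obtain ⟨D, hD, rfl⟩ := List.mem_map.1 hC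
    simpa using F.width D hD
  · intro C hC l hl
    obtain ⟨D, hD, rfl⟩ := List.mem_map.1 hC
    obtain ⟨l, -, rfl⟩ := List.mem_map.1 hl
    exact code_lt l
  · simpa using length_clauses_le F
  · have hL₀ : ((F.clauses.map (List.map code)).map (orMask 0)).foldl addMask [] = baseMasks F := by
      rw [List.map_map]; rfl
    rw [hL₀, ← ht, ← hΦ] at hR
    have hc := Sim.subConsCall (R' := fun (p : ℕ × ℕ) s' => s'.reg 0 = output w t p.1 p.2 ∧
        s'.reg 1 = 1) (g := PMF.pure) (qs := []) (L := [])
      (T := (n * 2 ^ w + 1) * (levelTime P n w (arraySize k w n) T (numRuns r n) t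
        (t * (8 * n + 2)) + 1) + 32)
      (sim_count (T := T) hB f3 (by omega) hO (hΦ1.trans_lt f8) (hΦ2.trans_lt f10) s' hb' hR.params hR.r4
        hR.r5 hR.r9 hR.r14 hR.r15 hR.r16 hR.r17 hR.r19 hR.array hR.r28.ge hR.fresh
        (by rw [hR.r28]; omega))
      fun p s2 hb2 h => Sim.subEnd hb2 (Sim.nil hb2 h)
    rwa [PMF.bind_pure] at hc

theorem solCount_baseMasks {n k : ℕ} (F : KCNF k n) : solCount n (baseMasks F) = F.numSat := by
  classical
  rw [solCount, KCNF.numSat, Nat.card_eq_fintype_card, Fintype.card_subtype]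
  congr 1
  ext a
  simp [sat_baseMasks]

/-- No program decides satisfiability in less than one step. -/
theorem not_ksatInTime {δ : ℝ} (hδ : 1 < δ) :
    ¬ KSATInTime 0 fun n => (2 : ℝ) ^ ((1 - δ) * (n : ℝ)) := by
  rintro ⟨P, A, c, h⟩
  have hy : (2 : ℝ) ^ (1 - δ) < 1 := Real.rpow_lt_one_of_one_lt_of_neg (by norm_num) (by linarith)
  obtain ⟨n, hn⟩ := exists_pow_lt_of_lt_one (show (0 : ℝ) < 1 / (|A| + 1) by positivity) hy
  obtain ⟨h1, -, -⟩ := h n ⟨[], by simp, by simp, by simp⟩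
  -- With a negative exponent the bound drops below `1` for large `n`, but the initial configuration
  -- has not halted yet.
  have hT : ⌊A * (2 : ℝ) ^ ((1 - δ) * (n : ℝ))⌋₊ = 0 := by
    rw [Nat.floor_eq_zero, Real.rpow_mul (by norm_num), Real.rpow_natCast]
    rw [lt_div_iff₀ (by positivity)] at hn
    have h0 : (0 : ℝ) < (2 ^ (1 - δ)) ^ n := by positivity
    nlinarith [le_abs_self A]
  rw [hT] at h1
  have := h1 _ (by rw [run, PMF.support_pure]; exact Set.mem_singleton _)
  simp [init] at this

/-- The running time of the algorithm. -/
theorem total_time_le {δ δ' A C₂ : ℝ} (hδ : δ ≤ 1) {g e n f : ℕ}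
    (hgδ : 1 / (g : ℝ) ≤ δ' / 2) (hC₂ : (f : ℝ) ≤ C₂ * 2 ^ (δ' / 2 * n)) {ε : ℚ} (h0 : 0 < ε)
    (h1 : ε < 1) :
    ((numTrials g e (precision ε.num.toNat.size ε.den.size n) n *
      (⌊A * (2 : ℝ) ^ ((1 - δ) * (n : ℝ))⌋₊ + 1) * f : ℕ) : ℝ) ≤
      ((ε : ℝ) ^ 2)⁻¹ * (64 * 2 ^ e * (|A| + 1) * C₂ * 2 ^ ((1 - δ + δ') * (n : ℝ))) := by
  have hn : (0 : ℝ) ≤ n := Nat.cast_nonneg n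
  have hp := (precision_good h0 h1 n).2
  set d := precision ε.num.toNat.size ε.den.size n
  have ht : (numTrials g e d n : ℝ) = 4 ^ d * (2 ^ (n / g) * 2 ^ e) := by
    rw [numTrials]; push_cast
    rw [pow_add, pow_add, pow_mul]; norm_num
  have h2 : (2 : ℝ) ^ (n / g) ≤ 2 ^ (δ' / 2 * n) := by
    rw [← Real.rpow_natCast]
    refine Real.rpow_le_rpow_of_exponent_le (by norm_num) (Nat.cast_div_le.trans ?_)
    rw [div_eq_mul_one_div, mul_comm]
    gcongr
  have h3 : ((⌊A * (2 : ℝ) ^ ((1 - δ) * (n : ℝ))⌋₊ : ℝ) + 1) ≤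
      (|A| + 1) * 2 ^ ((1 - δ) * (n : ℝ)) := by
    have e1 : (1 : ℝ) ≤ 2 ^ ((1 - δ) * (n : ℝ)) :=
      Real.one_le_rpow (by norm_num) (mul_nonneg (by linarith) hn)
    have e2 : A * (2 : ℝ) ^ ((1 - δ) * (n : ℝ)) ≤ |A| * 2 ^ ((1 - δ) * (n : ℝ)) := by
      gcongr; exact le_abs_self A
    have e3 := Nat.floor_le (show 0 ≤ |A| * (2 : ℝ) ^ ((1 - δ) * (n : ℝ)) by positivity)
    have e4 : (⌊A * (2 : ℝ) ^ ((1 - δ) * (n : ℝ))⌋₊ : ℝ) ≤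
        (⌊|A| * (2 : ℝ) ^ ((1 - δ) * (n : ℝ))⌋₊ : ℝ) := by
      exact_mod_cast Nat.floor_le_floor e2
    rw [add_mul, one_mul]; linarith
  have h4 : (2 : ℝ) ^ ((1 - δ + δ') * (n : ℝ)) =
      2 ^ (δ' / 2 * (n : ℝ)) * 2 ^ ((1 - δ) * (n : ℝ)) * 2 ^ (δ' / 2 * (n : ℝ)) := by
    rw [← Real.rpow_add (by norm_num), ← Real.rpow_add (by norm_num)]; congr 1; ring
  push_cast
  rw [ht]
  calc _ ≤ 64 * ((ε : ℝ) ^ 2)⁻¹ * (2 ^ (δ' / 2 * (n : ℝ)) * 2 ^ e) *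
        ((|A| + 1) * 2 ^ ((1 - δ) * (n : ℝ))) * (C₂ * 2 ^ (δ' / 2 * n)) := by gcongr
    _ = _ := by rw [h4]; ring

end SATCount

/-! ### Choice of the constants and conclusion -/

open WordRAM SATCount in
theorem mainTheorem3 (δ : ℝ) (hδ : 0 < δ)
    (h : ∀ k : ℕ, KSATInTime k fun n => (2 : ℝ) ^ ((1 - δ) * (n : ℝ))) :
    ∀ δ' : ℝ, 0 < δ' → ∀ k : ℕ,
      ApproxCountKSATInTime k fun n => (2 : ℝ) ^ ((1 - δ + δ') * (n : ℝ)) := by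
  intro δ' hδ' k
  rcases lt_or_ge 1 δ with hδ1 | hδ1
  · exact absurd (h 0) (not_ksatInTime hδ1)
  obtain ⟨g, hg⟩ := exists_nat_gt (2 / δ')
  have hg0 : 0 < g := by
    have : (0 : ℝ) < g := lt_trans (by positivity) hg
    exact_mod_cast this
  have hg' : (0 : ℝ) < g := by exact_mod_cast hg0
  have hgδ : 1 / (g : ℝ) ≤ δ' / 2 := by
    rw [div_lt_iff₀ hδ'] at hg
    rw [div_le_div_iff₀ hg' (by norm_num)]; linarith
  -- Half of the exponent `1 / g` is spent on the variance and half on the number of levels.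
  -- Together they cost at most `2^(δ' n / 2)`, and the other half of `δ'` pays for polynomial
  -- factors.
  obtain ⟨w, hw, hwidth⟩ := exists_width_of (show (0 : ℝ) < 1 / (2 * g) by positivity)
  -- The queries contain the clauses of the input, random clauses of width `w` and unit clauses. The
  -- width `w` depends on `δ'` only, so the hypothesis is used for one fixed width.
  obtain ⟨P, A, c, hP⟩ := h (max w k)
  have hpoly : PolyBound fun n => 12 * (n * 2 ^ w + 1) :=
    (PolyBound.const 12).mul ((PolyBound.id.mul (.const _)).add (.const 1))
  obtain ⟨C₁, -, hC₁⟩ := hpoly.le_rpow (show (0 : ℝ) < 1 / (2 * g) by positivity)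
  obtain ⟨e, he⟩ := pow_unbounded_of_one_lt (2 * C₁) (show (1 : ℝ) < 2 by norm_num)
  set r := 6 * (w + 2 * e + 14) with hr
  obtain ⟨C₂, hC₂1, hC₂⟩ := (polyBound_timeFactor P k w c r).le_rpow
    (show 0 < δ' / 2 by positivity)
  have hκ : 0 < 1 - δ + δ' := by linarith
  set C := ⌈|A|⌉₊ + 4 with hC
  -- Since the time bound is at least `2^(κ n)` with `κ = 1 - δ + δ' > 0`, words exponential in `n`
  -- are polynomial in the size of the instance.
  obtain ⟨c₀, hc₀⟩ := (expBound_wordSize k w c C g e r).mul_le_pow hκ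
  refine ⟨approxP k w c C g e r P, 64 * 2 ^ e * (|A| + 1) * C₂, c₀, fun n F ε h0 h1 => ?_⟩
  set T := ⌊A * (2 : ℝ) ^ ((1 - δ) * (n : ℝ))⌋₊ with hT
  set d := precision ε.num.toNat.size ε.den.size n with hd
  set T' := ⌊((ε : ℝ) ^ 2)⁻¹ * (64 * 2 ^ e * (|A| + 1) * C₂ * 2 ^ ((1 - δ + δ') * (n : ℝ)))⌋₊
  have hdec : DecidesSAT P (max w k) n T c := fun F => hP n F
  have hTC : T + 4 ≤ C * 2 ^ n := by
    have e1 : (T : ℝ) ≤ ⌈|A|⌉₊ * 2 ^ n := by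
      have e2 : A * (2 : ℝ) ^ ((1 - δ) * (n : ℝ)) ≤ ⌈|A|⌉₊ * 2 ^ n := by
        have e3 : (2 : ℝ) ^ ((1 - δ) * (n : ℝ)) ≤ 2 ^ n := by
          rw [← Real.rpow_natCast]
          refine Real.rpow_le_rpow_of_exponent_le (by norm_num) ?_
          nlinarith [(Nat.cast_nonneg n : (0 : ℝ) ≤ n)]
        calc _ ≤ |A| * (2 : ℝ) ^ ((1 - δ) * (n : ℝ)) := by gcongr; exact le_abs_self A
          _ ≤ _ := by gcongr; exact Nat.le_ceil _
      have e4 := Nat.floor_le_floor e2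
      have e5 : ⌊(⌈|A|⌉₊ : ℝ) * 2 ^ n⌋₊ = ⌈|A|⌉₊ * 2 ^ n := by
        rw [show (⌈|A|⌉₊ : ℝ) * 2 ^ n = ((⌈|A|⌉₊ * 2 ^ n : ℕ) : ℝ) by push_cast; rfl,
          Nat.floor_natCast]
      rw [e5] at e4
      exact_mod_cast e4
    have e6 : T ≤ ⌈|A|⌉₊ * 2 ^ n := by exact_mod_cast e1
    have e7 : 1 ≤ 2 ^ n := Nat.one_le_two_pow
    rw [hC, add_mul]; omega
  have htime := Nat.le_floor (total_time_le (A := A) (e := e) hδ1 hgδ (hC₂ n) h0 h1)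
  set x := encodeRat ε ++ F.encode with hx
  set Z := sizeBound x T' with hZ
  have hxl : ε.num.toNat.size + ε.den.size + 2 ≤ x.length := by
    rw [hx, encodeRat]; simp [Nat.size_eq_bits_len]
  have hZκ : (2 : ℝ) ^ ((1 - δ + δ') * n) ≤ Z := by
    have hε : (0 : ℝ) < ε := by exact_mod_cast h0
    have hε1 : (ε : ℝ) < 1 := by exact_mod_cast h1
    have e1 : (1 : ℝ) ≤ ((ε : ℝ) ^ 2)⁻¹ :=
      (one_le_inv₀ (by positivity)).2 (pow_le_one₀ hε.le hε1.le)
    have e2 : (1 : ℝ) ≤ 64 * 2 ^ e * (|A| + 1) * C₂ := by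
      have : (1 : ℝ) ≤ 2 ^ e := one_le_pow₀ (by norm_num)
      have : (1 : ℝ) ≤ |A| + 1 := by linarith [abs_nonneg A]
      refine one_le_mul_of_one_le_of_one_le (one_le_mul_of_one_le_of_one_le ?_ this) hC₂1
      linarith
    have e3 : (2 : ℝ) ^ ((1 - δ + δ') * n) ≤
        ((ε : ℝ) ^ 2)⁻¹ * (64 * 2 ^ e * (|A| + 1) * C₂ * 2 ^ ((1 - δ + δ') * (n : ℝ))) :=
      (le_mul_of_one_le_left (by positivity) e2).trans
        (le_mul_of_one_le_left (by positivity) e1)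
    refine (e3.trans (Nat.lt_floor_add_one _).le).trans ?_
    have : T' + 1 ≤ Z := by rw [hZ, sizeBound]; omega
    rw [← Nat.cast_add_one]
    exact Nat.cast_le.2 this
  have hZ2 : 2 ≤ Z := by rw [hZ, sizeBound]; omega
  have hW : 1 ≤ wordSize k w c C g e r n := Nat.le_add_left 1 _
  have hZM := hc₀ n Z hZ2 hZκ
  -- This is `(Z - 1) * (wordSize - 1) ≥ 0`; it turns the product bound into a bound for the sum
  -- with the input length.
  have hZW : Z + wordSize k w c C g e r n ≤ Z * wordSize k w c C g e r n + 1 := by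
    obtain ⟨u, hu⟩ := Nat.exists_eq_add_of_le hW
    rw [hu]; nlinarith [Nat.zero_le (u * (Z - 1)), Nat.mul_le_mul_left u (show 1 ≤ Z by omega)]
  have hM : ε.num.toNat.size + ε.den.size + wordSize k w c C g e r n ≤ Z ^ c₀ := by
    have : x.length + 2 ≤ Z := by rw [hZ, sizeBound]; omega
    omega
  have hb : (init (approxP k w c C g e r P) x).st.Below (Z ^ c₀) := by
    have hZ' : x.foldr max 0 < Z ^ c₀ := by
      have : x.foldr max 0 + 2 ≤ Z := by rw [hZ, sizeBound]; omega
      omega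
    refine ⟨fun _ => lt_of_le_of_lt (Nat.zero_le _) hZ', fun a => lt_of_le_of_lt ?_ hZ'⟩
    change x.getD a 0 ≤ _
    rcases Nat.lt_or_ge a x.length with ha | ha
    · rw [List.getD_eq_getElem _ _ ha]; exact le_foldr_max (List.getElem_mem ha)
    · rw [List.getD_eq_default _ _ ha]; exact Nat.zero_le _
  have hsim := (sim_approx hdec hw (le_max_left _ _) (le_max_right _ _) hTC F (ε := ε) (g := g)
    (e := e) (r := r) hb (fun _ => rfl) (fun _ => rfl) rfl hM).mono htime
  refine ⟨hsim.halts, hsim.wordsBelow, ?_⟩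
  have ht1 : 0 < numTrials g e d n := by unfold numTrials; positivity
  have hgood := levels_good (n := n) hw (le_max_left w k) (fun m L => hwidth n m L) hdec.decides
    (r := 48 * n + r) ht1 (validList_baseMasks F (le_max_right w k))
    (failure_trials hg0 (le_of_eq (by field_simp; norm_num)) hC₁ he.le n d)
    (failure_runs (min_le_right _ _))
  refine le_trans ?_ (hsim.prob_le {p | GoodEst d (numTrials g e d n)
    (solCount n (baseMasks F) * satProb w ^ p.1) p.2} (fun s => s.reg 1 ≠ 0 ∧
      |(s.reg 0 : ℚ) / (s.reg 1 : ℚ) - F.numSat| ≤ ε * F.numSat) ?_)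
  · rw [toOuterMeasure_eq_ex]
    have hc := ex_ind_compl (levels (fun m => trials n w m (query (oracle P T n) (numRuns r n))
      (baseMasks F) (numTrials g e d n) (numTrials g e d n * (8 * n + 2), 0)) (n * 2 ^ w + 1) 0)
      (fun p => GoodEst d (numTrials g e d n) (solCount n (baseMasks F) * satProb w ^ p.1) p.2)
    -- The success probability is bounded from below through its complement: if it were below `2/3`,
    -- adding the failure probability of at most `1/3` would give a total below `1`.
    by_contra hlt
    have h13 : (2 / 3 : ℝ≥0∞) + 1 / 3 = 1 := by
      rw [ENNReal.div_add_div_same, show (2 : ℝ≥0∞) + 1 = 3 by norm_num]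
      exact ENNReal.div_self (by norm_num) (by norm_num)
    refine absurd hc (ne_of_lt ?_)
    rw [← h13]
    exact ENNReal.add_lt_add_of_lt_of_le
      (ne_top_of_le_ne_top (ENNReal.div_ne_top (by norm_num) (by norm_num)) hgood) (not_le.1 hlt) hgood
  · rintro p hp s' ⟨hs0, hs1⟩
    have hout := output_good hw ht1 (solCount_le _) hp (precision_good h0 h1 n).1
      (by exact_mod_cast h0.le)
    rw [solCount_baseMasks] at hout
    refine ⟨by omega, ?_⟩
    rw [hs0, hs1]
    have : ((|(output w (numTrials g e d n) p.1 p.2 : ℚ) - F.numSat| : ℚ) : ℝ) ≤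
        ((ε * F.numSat : ℚ) : ℝ) := by push_cast; exact hout
    simpa using (by exact_mod_cast this :
      |(output w (numTrials g e d n) p.1 p.2 : ℚ) - F.numSat| ≤ ε * F.numSat)
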